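/- **Setting.** Let $\omega\subset\mathbb R^2$ be a bounded domain (open, connected, with $\omega=\operatorname{int}\overline\omega$) and let $\partial_D\omega\subset\partial\omega$ have positive one-dimensional Hausdorff measure. Let $\mathcal T_h$ be a conforming partition of $\omega$ into closed axis-parallel rectangles (finitely many rectangles covering $\overline\omega$, two different ones being disjoint or sharing exactly one vertex or one full edge), with vertices $\mathcal N_h$, edges $\mathcal E_h$, midpoints $z_E$, $z_T$ of edges and elements, and shape regularity constant $\sigma$: $\operatorname{diam}T\le\sigma\rho_T$ for all $T$, where $\rho_T$ is the diameter of the largest disc in $T$. All derivatives of piecewise polynomials are taken elementwise. * $\mathbb W_h$ is the set of $w\in C(\overline\omega)$ with $w|_T\in\mathbb Q_3(T)$ for all $T\in\mathcal T_h$, with $\nabla w$ continuous at every vertex and $\nabla w(z_E)\cdot n_E=\frac12\big(\nabla w(z_E^1)+\nabla w(z_E^2)\big)\cdot n_E$ for every edge $E$ with end points $z_E^1,z_E^2$ and normal $n_E$. * $\mathcal I^2_h\psi$ is the continuous, piecewise $\mathbb Q_2$ function with the values of $\psi$ at all vertices and all midpoints of edges, and with the mean of the four vertex values of $\psi$ on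 $T$ at $z_T$. $\mathcal I_h^1$ is the Lagrange interpolation into continuous piecewise $\mathbb Q_1$ functions. $\nabla_h w:=\mathcal I_h^2[\nabla w]$ has the columns $\partial_1^hw,\partial_2^hw$. * $(\phi,\psi)_h:=\sum_{T}\frac{|T|}4\sum_{z\in\mathcal N_h\cap T}\phi|_T(z)\cdot\psi|_T(z)$ and $\|\phi\|_{L^1_h}:=(|\phi|,1)_h$, with Frobenius norms and products for matrices. * For $\delta\ge0$, $\mathcal A_h^\delta$ is the set of $y_h\in\mathbb W_h^3$ with $y_h=y_{D,h}$ and $\nabla_hy_h=\Phi_{D,h}$ on $\partial_D\omega$, with $\nabla y_h(z)^T\nabla y_h(z)-I_2$ positive semidefinite for all $z\in\mathcal N_h$, and with $\|\nabla y_h^T\nabla y_h-I_2\|_{L^1_h}\le\delta$. * The discrete energy is $$\widetilde E_h[y_h]:=\frac12\int_\omega|\nabla\nabla_hy_h|^2+\sum_{i,j=1}^2\Big(\partial_i\mathcal I_h^1[\partial_j^hy_h]\cdot\Big[\frac{\partial_1^hy_h}{|\partial_1^hy_h|}\times\frac{\partial_2^hy_h}{|\partial_2^hy_h|}\Big],Z_{ij}\Big)_h+\frac12(Z,Z)_h-(f,y_h)_h$$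 if $y_h\in\mathcal A_h^\delta$, and $\widetilde E_h[y_h]:=+\infty$ otherwise. **Proposition (coercivity).** Let $y_D\in H^3(\omega)^3$ and $\Phi_D\in H^2(\omega)^{3\times2}$ (identified with their representatives that are $C^1$, respectively continuous, on $\overline\omega$). Let $y_{D,h}\in\mathbb W_h^3$ be a nodal interpolant of $y_D$, that is, a function with the values and gradients of $y_D$ at all vertices, and let $\Phi_{D,h}:=\mathcal I_h^2\Phi_D$. Let $Z\in\prod_{T\in\mathcal T_h}C^0(T)^{2\times2}$ and $f\in\prod_{T\in\mathcal T_h}C^0(T)^3$. If $\{y_h\}_{h>0}$ is a sequence of displacements with $$\widetilde E_h[y_h]\le C$$ for a constant $C$ independent of $h$, then $y_h\in\mathcal A_h^\delta$ and $$\|\nabla\nabla_hy_h\|_{L^2(\omega)}\le\widetilde C .$$ Here $\widetilde C$ depends only on $C$, $\omega$, $\partial_D\omega$, the shape regularity constant $\sigma$, and upper bounds for $\|Z\|_{L^\infty(\omega)}$, $\|f\|_{L^\infty(\omega)}$, $\|y_D\|_{H^3(\omega)}$ and $\|\Phi_D\|_{H^2(\omega)}$. In particular it depends neither on $\delta$ nor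 on the partition, hence not on $h$. -/

import Mathlib

open MeasureTheory Set
open scoped ENNReal Matrix

namespace Bilayer

noncomputable section

/-- The plane. Only its topology, linear structure and Lebesgue measure are used. -/
abbrev Plane := ℝ × ℝ

/-- Vectors of three-space; Euclidean quantities are formed explicitly with the dot product. -/
abbrev Vec := Fin 3 → ℝ

/-- Coordinate directions of the plane. -/
def dir (i : Fin 2) : Plane := if i = 0 then (1, 0) else (0, 1)

/-- Euclidean length in three-space. -/
def vnorm (v : Vec) : ℝ := Real.sqrt (v ⬝ᵥ v)

/-- Frobenius norm of a two by two matrix. -/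
def frob (A : Matrix (Fin 2) (Fin 2) ℝ) : ℝ := Real.sqrt (∑ i, ∑ j, A i j ^ 2)

/-! ### Sobolev spaces through weak derivatives -/

/-- Classical partial derivative. -/
def pd (i : Fin 2) (φ : Plane → ℝ) : Plane → ℝ := fun x => fderiv ℝ φ x (dir i)

/-- `g` is the weak derivative of `u` on `ω` of order `a` in the first and `b` in the second
variable. -/
def IsWeakDeriv (ω : Set Plane) (a b : ℕ) (u g : Plane → ℝ) : Prop :=
  LocallyIntegrableOn u ω ∧ LocallyIntegrableOn g ω ∧
    ∀ φ : Plane → ℝ, ContDiff ℝ ((⊤ : ℕ∞) : WithTop ℕ∞) φ → HasCompactSupport φ → tsupport φ ⊆ ω →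
      ∫ x in ω, u x * ((pd 0)^[a] ((pd 1)^[b] φ)) x = (-1) ^ (a + b) * ∫ x in ω, g x * φ x

/-- `u` belongs to the Sobolev space of order `k` on `ω` (square integrable derivatives). -/
def MemH (ω : Set Plane) (k : ℕ) (u : Plane → ℝ) : Prop :=
  ∀ a b : ℕ, a + b ≤ k → ∃ g : Plane → ℝ, MemLp g 2 (volume.restrict ω) ∧ IsWeakDeriv ω a b u g

open Classical in
/-- A square integrable weak derivative (almost everywhere unique on open sets);
zero if there is none. -/
def weakDeriv (ω : Set Plane) (a b : ℕ) (u : Plane → ℝ) : Plane → ℝ :=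
  if h : ∃ g : Plane → ℝ, MemLp g 2 (volume.restrict ω) ∧ IsWeakDeriv ω a b u g then h.choose else 0

/-- The Sobolev norm of order `k` on `ω` of a finite family of components. -/
def normH {ι : Type} [Fintype ι] (ω : Set Plane) (k : ℕ) (u : ι → Plane → ℝ) : ℝ :=
  Real.sqrt (∑ m, ∑ a ∈ Finset.range (k + 1), ∑ b ∈ Finset.range (k + 1 - a),
    ∫ x in ω, weakDeriv ω a b (u m) x ^ 2)

/-! ### Rectangles and conforming partitions -/

/-- A nondegenerate rectangle with sides parallel to the axes. -/
structure Rect where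
  x0 : ℝ
  x1 : ℝ
  y0 : ℝ
  y1 : ℝ
  hx : x0 < x1
  hy : y0 < y1

namespace Rect

/-- The closed rectangle as a set. -/
def carrier (T : Rect) : Set Plane := Icc T.x0 T.x1 ×ˢ Icc T.y0 T.y1

def area (T : Rect) : ℝ := (T.x1 - T.x0) * (T.y1 - T.y0)

/-- The Euclidean diameter of the rectangle. -/
def diam (T : Rect) : ℝ := Real.sqrt ((T.x1 - T.x0) ^ 2 + (T.y1 - T.y0) ^ 2)

/-- The point with relative coordinates `s`, `t` (in the unit interval inside the rectangle). -/
def pt (T : Rect) (s t : ℝ) : Plane := (T.x0 + s * (T.x1 - T.x0), T.y0 + t * (T.y1 - T.y0))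

/-- First relative coordinate of a point. -/
def relx (T : Rect) (x : Plane) : ℝ := (x.1 - T.x0) / (T.x1 - T.x0)

/-- Second relative coordinate of a point. -/
def rely (T : Rect) (x : Plane) : ℝ := (x.2 - T.y0) / (T.y1 - T.y0)

/-- The four vertices. -/
def vertex (T : Rect) (a b : Fin 2) : Plane := T.pt ((a : ℕ) : ℝ) ((b : ℕ) : ℝ)

def vertices (T : Rect) : Set Plane := {z | ∃ a b : Fin 2, z = T.vertex a b}

end Rect

/-- A conforming partition of `ω`: the closed rectangles cover exactly the closure of `ω`, and two
different ones meet in the convex hull of their common vertices, that is, they are disjoint or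
share exactly one vertex or exactly one full edge. -/
structure IsConformingMesh (ω : Set Plane) (𝒯 : Finset Rect) : Prop where
  cover : (⋃ T ∈ 𝒯, T.carrier) = closure ω
  conforming : ∀ T ∈ 𝒯, ∀ T' ∈ 𝒯, T ≠ T' →
    T.carrier ∩ T'.carrier = convexHull ℝ (T.vertices ∩ T'.vertices)

/-- Shape regularity: the diameter is at most `σ` times the diameter of the largest
inscribed disc. -/
def ShapeRegular (σ : ℝ) (𝒯 : Finset Rect) : Prop :=
  ∀ T ∈ 𝒯, T.diam ≤ σ * min (T.x1 - T.x0) (T.y1 - T.y0)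

/-! ### Elementwise derivatives and finite element spaces -/

/-- The partial derivative of the restriction of `u` to the closed rectangle `T`
(one-sided on the boundary of `T`). -/
def pdOn {V : Type} [NormedAddCommGroup V] [NormedSpace ℝ V] (i : Fin 2) (T : Rect)
    (u : Plane → V) (x : Plane) : V :=
  fderivWithin ℝ u T.carrier x (dir i)

/-- On `T` the function `w` is a polynomial of degree at most `r` in each variable. -/
def IsQ (r : ℕ) (T : Rect) (w : Plane → ℝ) : Prop :=
  ∃ c : Fin (r + 1) → Fin (r + 1) → ℝ, ∀ x ∈ T.carrier,
    w x = ∑ i, ∑ j, c i j * x.1 ^ (i : ℕ) * x.2 ^ (j : ℕ)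

/-- The scalar Kirchhoff space: continuous, piecewise bicubic, with gradient continuous at all
vertices and with the normal derivative at every edge midpoint equal to the average of the normal
derivatives at the two end points. -/
structure InW (ω : Set Plane) (𝒯 : Finset Rect) (w : Plane → ℝ) : Prop where
  cont : ContinuousOn w (closure ω)
  poly : ∀ T ∈ 𝒯, IsQ 3 T w
  grad_cont : ∀ T ∈ 𝒯, ∀ T' ∈ 𝒯, ∀ z ∈ T.vertices ∩ T'.vertices, ∀ i,
    pdOn i T w z = pdOn i T' w z
  /-- edges parallel to the second axis, with normal in the first direction -/
  normal_fst : ∀ T ∈ 𝒯, ∀ a : Fin 2, pdOn 0 T w (T.pt ((a : ℕ) : ℝ) (1 / 2)) =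
    (1 / 2) * (pdOn 0 T w (T.vertex a 0) + pdOn 0 T w (T.vertex a 1))
  /-- edges parallel to the first axis, with normal in the second direction -/
  normal_snd : ∀ T ∈ 𝒯, ∀ b : Fin 2, pdOn 1 T w (T.pt (1 / 2) ((b : ℕ) : ℝ)) =
    (1 / 2) * (pdOn 1 T w (T.vertex 0 b) + pdOn 1 T w (T.vertex 1 b))

/-- Deformations all of whose three components lie in the Kirchhoff space. -/
def InW3 (ω : Set Plane) (𝒯 : Finset Rect) (y : Plane → Vec) : Prop :=
  ∀ k, InW ω 𝒯 (fun x => y x k)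

/-! ### Interpolation operators -/

section Interp

variable {V : Type} [AddCommGroup V] [Module ℝ V]

/-- One-dimensional quadratic Lagrange basis on the unit interval, nodes `0`, `1/2`, `1`. -/
def quadShape (a : Fin 3) (s : ℝ) : ℝ :=
  if a = 0 then (1 - s) * (1 - 2 * s) else if a = 1 then 4 * s * (1 - s) else s * (2 * s - 1)

/-- Nodal values of the modified biquadratic interpolant on `T`: point values at vertices and at
midpoints of edges, the average of the four vertex values at the element midpoint. -/
def quadNodal (T : Rect) (ψ : Plane → V) (a b : Fin 3) : V :=
  if a = 1 ∧ b = 1 then (1 / 4 : ℝ) • ∑ c, ∑ d, ψ (T.vertex c d)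
  else ψ (T.pt (((a : ℕ) : ℝ) / 2) (((b : ℕ) : ℝ) / 2))

/-- The biquadratic interpolation operator restricted to the element `T`. -/
def quadInterp (T : Rect) (ψ : Plane → V) (x : Plane) : V :=
  ∑ a, ∑ b, (quadShape a (T.relx x) * quadShape b (T.rely x)) • quadNodal T ψ a b

/-- One-dimensional linear Lagrange basis on the unit interval, nodes `0`, `1`. -/
def linShape (a : Fin 2) (s : ℝ) : ℝ := if a = 0 then 1 - s else s

/-- The canonical bilinear Lagrange interpolation operator restricted to the element `T`. -/
def bilinInterp (T : Rect) (ψ : Plane → V) (x : Plane) : V :=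
  ∑ a, ∑ b, (linShape a (T.relx x) * linShape b (T.rely x)) • ψ (T.vertex a b)

theorem relx_pt (T : Rect) (s t : ℝ) : T.relx (T.pt s t) = s := by
  have := T.hx
  have h : T.x1 - T.x0 ≠ 0 := by linarith
  simp [Rect.relx, Rect.pt, h]

theorem rely_pt (T : Rect) (s t : ℝ) : T.rely (T.pt s t) = t := by
  have := T.hy
  have h : T.y1 - T.y0 ≠ 0 := by linarith
  simp [Rect.rely, Rect.pt, h]

/-- The biquadratic interpolant has the prescribed nine nodal values. -/
theorem quadInterp_node (T : Rect) (ψ : Plane → V) (a b : Fin 3) :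
    quadInterp T ψ (T.pt (((a : ℕ) : ℝ) / 2) (((b : ℕ) : ℝ) / 2)) = quadNodal T ψ a b := by
  have key : ∀ a c : Fin 3, quadShape c (((a : ℕ) : ℝ) / 2) = if c = a then 1 else 0 := by
    intro a c
    fin_cases a <;> fin_cases c <;> norm_num [quadShape]
  simp [quadInterp, relx_pt, rely_pt, key]

/-- The bilinear interpolant has the prescribed vertex values. -/
theorem bilinInterp_vertex (T : Rect) (ψ : Plane → V) (a b : Fin 2) :
    bilinInterp T ψ (T.vertex a b) = ψ (T.vertex a b) := by
  have key : ∀ a c : Fin 2, linShape c ((a : ℕ) : ℝ) = if c = a then 1 else 0 := by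
    intro a c
    fin_cases a <;> fin_cases c <;> norm_num [linShape]
  rw [bilinInterp]
  rw [show T.vertex a b = T.pt ((a : ℕ) : ℝ) ((b : ℕ) : ℝ) from rfl]
  simp only [relx_pt, rely_pt, key]
  simp [Rect.vertex]

end Interp

/-- `yh` is a nodal interpolant of `y` in the Kirchhoff space: it has the values and the gradients
of `y` at all vertices (normal derivatives at edge midpoints are averages by membership in the
space). Point values are those of the continuously differentiable representative of `y`. -/
def IsInterp3 (ω : Set Plane) (𝒯 : Finset Rect) (y yh : Plane → Vec) : Prop :=
  InW3 ω 𝒯 yh ∧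
    ∃ u : Plane → Vec, u =ᵐ[volume.restrict ω] y ∧ ContDiffOn ℝ 1 u (closure ω) ∧
      ∀ T ∈ 𝒯, ∀ a b : Fin 2, yh (T.vertex a b) = u (T.vertex a b) ∧
        ∀ i, pdOn i T yh (T.vertex a b) = pdOn i T u (T.vertex a b)

/-- `Φh` is the piecewise biquadratic interpolant of `Φ` (both given by their two columns). Point
values are those of the continuous representative of `Φ`. -/
def IsInterp2 (ω : Set Plane) (𝒯 : Finset Rect) (Φ Φh : Fin 2 → Plane → Vec) : Prop :=
  ∃ U : Fin 2 → Plane → Vec, (∀ j, U j =ᵐ[volume.restrict ω] Φ j) ∧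
    (∀ j, ContinuousOn (U j) (closure ω)) ∧
    ∀ j, ∀ T ∈ 𝒯, ∀ x ∈ T.carrier, Φh j x = quadInterp T (U j) x

/-- The `j`-th column of the discrete gradient of `y`, restricted to the element `T`. -/
def discGrad (T : Rect) (y : Plane → Vec) (j : Fin 2) : Plane → Vec :=
  quadInterp T (pdOn j T y)

/-! ### Discrete admissible set and discrete energy -/

/-- The discrete inner product of `F` with the constant one: vertex quadrature on each element. -/
def vertexSum (𝒯 : Finset Rect) (F : Rect → Plane → ℝ) : ℝ :=
  ∑ T ∈ 𝒯, T.area / 4 * ∑ a, ∑ b, F T (T.vertex a b)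

/-- The first fundamental form of the restriction of `y` to `T`. -/
def gram (T : Rect) (y : Plane → Vec) (x : Plane) : Matrix (Fin 2) (Fin 2) ℝ :=
  Matrix.of fun i j => pdOn i T y x ⬝ᵥ pdOn j T y x

/-- The discrete admissible set. -/
structure Admissible (ω ΓD : Set Plane) (𝒯 : Finset Rect) (δ : ℝ)
    (yDh : Plane → Vec) (ΦDh : Fin 2 → Plane → Vec) (y : Plane → Vec) : Prop where
  mem : InW3 ω 𝒯 y
  bdry : ∀ x ∈ ΓD, y x = yDh x
  bdry_grad : ∀ T ∈ 𝒯, ∀ x ∈ ΓD ∩ T.carrier, ∀ j, discGrad T y j x = ΦDh j x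
  stretch : ∀ T ∈ 𝒯, ∀ a b : Fin 2, (gram T y (T.vertex a b) - 1).PosSemidef
  isometry : vertexSum 𝒯 (fun T z => frob (gram T y z - 1)) ≤ δ

/-- The squared norm in `L²(ω)` of the gradient of the discrete gradient, computed elementwise. -/
def hessSq (𝒯 : Finset Rect) (y : Plane → Vec) : ℝ :=
  ∑ T ∈ 𝒯, ∫ x in T.carrier, ∑ i, ∑ j, vnorm (pdOn i T (discGrad T y j) x) ^ 2

/-- The cross product of the normalized columns of the discrete gradient. -/
def discNormal (T : Rect) (y : Plane → Vec) (z : Plane) : Vec :=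
  crossProduct ((vnorm (discGrad T y 0 z))⁻¹ • discGrad T y 0 z)
    ((vnorm (discGrad T y 1 z))⁻¹ • discGrad T y 1 z)

/-- The value of the discrete energy on admissible deformations. The elementwise continuous data
`Z` and `f` are families of functions, one for each element. -/
def energyValue (𝒯 : Finset Rect) (Z : Rect → Plane → Matrix (Fin 2) (Fin 2) ℝ)
    (f : Rect → Plane → Vec) (y : Plane → Vec) : ℝ :=
  (1 / 2) * hessSq 𝒯 y
    + ∑ i, ∑ j, vertexSum 𝒯 (fun T z =>
        (pdOn i T (bilinInterp T (discGrad T y j)) z ⬝ᵥ discNormal T y z) * Z T z i j)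
    + (1 / 2) * vertexSum 𝒯 (fun T z => ∑ i, ∑ j, Z T z i j * Z T z i j)
    - vertexSum 𝒯 (fun T z => f T z ⬝ᵥ y z)

open Classical in
/-- The discrete energy, infinite outside the discrete admissible set. -/
def discEnergy (ω ΓD : Set Plane) (𝒯 : Finset Rect) (δ : ℝ)
    (yDh : Plane → Vec) (ΦDh : Fin 2 → Plane → Vec)
    (Z : Rect → Plane → Matrix (Fin 2) (Fin 2) ℝ) (f : Rect → Plane → Vec)
    (y : Plane → Vec) : EReal :=
  if Admissible ω ΓD 𝒯 δ yDh ΦDh y then ((energyValue 𝒯 Z f y : ℝ) : EReal) else ⊤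

/-- The essential supremum over the partitioned domain of an elementwise defined function. -/
def brokenLinfty (𝒯 : Finset Rect) (g : Rect → Plane → ℝ) : ℝ≥0∞ :=
  ⨆ T ∈ 𝒯, eLpNorm (g T) ∞ (volume.restrict T.carrier)

end

end Bilayer

open Bilayer

/-! Write H for `hessSq`. Up to a constant that depends only on the data, the energy is at least
H/4. Of the bending term H/2, the coupling term costs H/8, the load costs another H/8, and the (Z,Z)
term is nonnegative.

Coupling (`neg_le_coupling`): the cross product of normalized columns has length at most one. At the
vertices, the gradient of the bilinear interpolant of the discrete gradient is bounded by H through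
an inverse estimate for biquadratic functions. Young's inequality with a small weight then suffices.

Load (`exists_vertexSum_sq_le`): only vertex values of the deformation occur, and these are the
vertex values of its bilinear interpolant. Friedrichs' inequality is applied twice to each
component. First it is applied to the discrete gradient, which is continuous across edges by the
Kirchhoff conditions (`quadInterp_pdOn_consistent`) and has prescribed values on the Dirichlet part.
Then it is applied to the bilinear interpolant. Along an edge the tangential derivative of a
Kirchhoff function is quadratic, hence reproduced exactly by the discrete gradient. So the discrete
gradient controls the gradient of the interpolant and, by shape regularity, its distance to the
prescribed boundary values.

Uniformity: if the domain has no conforming partition, nothing is claimed. Otherwise one reference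
partition is fixed, and the Friedrichs and embedding constants are computed on its finitely many
rectangles. Functions belonging to any other partition enter Friedrichs' inequality only through
`HasLineGrad`, which does not mention a partition. Control of the mean square starts at an element
with an edge that carries positive Dirichlet length (`IsConformingMesh.exists_controlled`). It
passes between overlapping rectangles and reaches the whole domain by connectedness
(`controlled_of_subset`).

Boundary data: an elementary Sobolev embedding, obtained from product test functions
(`exists_sup_le_of_tensorDeriv`), bounds values by the H² norm and gradients by the H³ norm. Nodal
interpolation passes these bounds on to the discrete boundary data. -/

namespace Bilayer

/-! ### Geometry of rectangles -/

namespace Rect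

theorem mem_carrier {T : Rect} {x : Plane} :
    x ∈ T.carrier ↔ (T.x0 ≤ x.1 ∧ x.1 ≤ T.x1) ∧ (T.y0 ≤ x.2 ∧ x.2 ≤ T.y1) := Iff.rfl

theorem isCompact_carrier (T : Rect) : IsCompact T.carrier :=
  isCompact_Icc.prod isCompact_Icc

theorem isClosed_carrier (T : Rect) : IsClosed T.carrier := T.isCompact_carrier.isClosed

theorem measurableSet_carrier (T : Rect) : MeasurableSet T.carrier :=
  T.isClosed_carrier.measurableSet

theorem interior_carrier (T : Rect) :
    interior T.carrier = Ioo T.x0 T.x1 ×ˢ Ioo T.y0 T.y1 := by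
  rw [carrier, interior_prod_eq, interior_Icc, interior_Icc]

theorem mem_interior {T : Rect} {x : Plane} :
    x ∈ interior T.carrier ↔ (T.x0 < x.1 ∧ x.1 < T.x1) ∧ (T.y0 < x.2 ∧ x.2 < T.y1) := by
  rw [interior_carrier]; exact Iff.rfl

theorem closure_interior (T : Rect) : closure (interior T.carrier) = T.carrier := by
  rw [interior_carrier, closure_prod_eq, closure_Ioo T.hx.ne, closure_Ioo T.hy.ne, carrier]

theorem uniqueDiffOn (T : Rect) : UniqueDiffOn ℝ T.carrier :=
  (uniqueDiffOn_Icc T.hx).prod (uniqueDiffOn_Icc T.hy)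

theorem area_pos (T : Rect) : 0 < T.area :=
  mul_pos (sub_pos.2 T.hx) (sub_pos.2 T.hy)

theorem volume_carrier (T : Rect) : volume T.carrier = ENNReal.ofReal T.area := by
  rw [carrier, Measure.volume_eq_prod, Measure.prod_prod, Real.volume_Icc, Real.volume_Icc, area,
    ENNReal.ofReal_mul (sub_pos.2 T.hx).le]

theorem volume_real_carrier (T : Rect) : volume.real T.carrier = T.area := by
  rw [Measure.real, volume_carrier, ENNReal.toReal_ofReal T.area_pos.le]

theorem pt_mem {T : Rect} {s t : ℝ} (hs : s ∈ Icc (0 : ℝ) 1) (ht : t ∈ Icc (0 : ℝ) 1) :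
    T.pt s t ∈ T.carrier := by
  have hx := sub_pos.2 T.hx
  have hy := sub_pos.2 T.hy
  rw [mem_carrier]
  refine ⟨⟨?_, ?_⟩, ?_, ?_⟩ <;> simp only [pt] <;> nlinarith [hs.1, hs.2, ht.1, ht.2]

theorem fin_mem_unit (a : Fin 2) : ((a : ℕ) : ℝ) ∈ Icc (0 : ℝ) 1 := by
  fin_cases a <;> norm_num

theorem half_mem_unit (a : Fin 3) : ((a : ℕ) : ℝ) / 2 ∈ Icc (0 : ℝ) 1 := by
  fin_cases a <;> norm_num

theorem vertex_mem (T : Rect) (a b : Fin 2) : T.vertex a b ∈ T.carrier :=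
  pt_mem (fin_mem_unit a) (fin_mem_unit b)

theorem vertex_mem_vertices (T : Rect) (a b : Fin 2) : T.vertex a b ∈ T.vertices := ⟨a, b, rfl⟩

theorem mem_vertices {T : Rect} {z : Plane} :
    z ∈ T.vertices ↔ (z.1 = T.x0 ∨ z.1 = T.x1) ∧ (z.2 = T.y0 ∨ z.2 = T.y1) := by
  constructor
  · rintro ⟨a, b, rfl⟩
    fin_cases a <;> fin_cases b <;> simp [vertex, pt]
  · rcases z with ⟨z1, z2⟩
    rintro ⟨h1 | h1, h2 | h2⟩ <;> simp only at h1 h2 <;> subst h1 h2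
    · exact ⟨0, 0, by simp [vertex, pt]⟩
    · exact ⟨0, 1, by simp [vertex, pt]⟩
    · exact ⟨1, 0, by simp [vertex, pt]⟩
    · exact ⟨1, 1, by simp [vertex, pt]⟩

theorem pt_rel (T : Rect) (x : Plane) : T.pt (T.relx x) (T.rely x) = x := by
  have h1 := (sub_pos.2 T.hx).ne'
  have h2 := (sub_pos.2 T.hy).ne'
  ext
  · simp only [pt, relx]; field_simp; ring
  · simp only [pt, rely]; field_simp; ring

theorem relx_mem {T : Rect} {x : Plane} (h : x ∈ T.carrier) : T.relx x ∈ Icc (0 : ℝ) 1 := by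
  have h1 := sub_pos.2 T.hx
  rw [mem_carrier] at h
  exact ⟨div_nonneg (by linarith) h1.le, (div_le_one h1).2 (by linarith)⟩

theorem rely_mem {T : Rect} {x : Plane} (h : x ∈ T.carrier) : T.rely x ∈ Icc (0 : ℝ) 1 := by
  have h1 := sub_pos.2 T.hy
  rw [mem_carrier] at h
  exact ⟨div_nonneg (by linarith) h1.le, (div_le_one h1).2 (by linarith)⟩

theorem ext_sides {T T' : Rect} (h1 : T.x0 = T'.x0) (h2 : T.x1 = T'.x1) (h3 : T.y0 = T'.y0)
    (h4 : T.y1 = T'.y1) : T = T' := by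
  cases T; cases T'; simp_all

end Rect

/-! ### Geometry of conforming partitions -/

section Mesh

variable {ω : Set Plane} {𝒯 : Finset Rect}

theorem IsConformingMesh.carrier_subset (h : IsConformingMesh ω 𝒯) {T : Rect} (hT : T ∈ 𝒯) :
    T.carrier ⊆ closure ω := by
  rw [← h.cover]
  exact subset_biUnion_of_mem (u := fun T : Rect => T.carrier) hT

theorem IsConformingMesh.exists_mem (h : IsConformingMesh ω 𝒯) {x : Plane} (hx : x ∈ closure ω) :
    ∃ T ∈ 𝒯, x ∈ T.carrier := by
  rw [← h.cover] at hx
  simpa using hx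

theorem IsConformingMesh.interior_carrier_subset (h : IsConformingMesh ω 𝒯)
    (hω : interior (closure ω) = ω) {T : Rect} (hT : T ∈ 𝒯) : interior T.carrier ⊆ ω := by
  conv_rhs => rw [← hω]
  exact interior_mono (h.carrier_subset hT)

theorem IsConformingMesh.isCompact (h : IsConformingMesh ω 𝒯) : IsCompact (closure ω) := by
  rw [← h.cover]
  exact 𝒯.isCompact_biUnion fun T _ => T.isCompact_carrier

/-- A point interior to both rectangles lies in the hull of the common vertices. If some side
differed, all common vertices would lie strictly on one side of that point, and a linear functional
would separate it from the hull. So all four sides agree. -/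
theorem IsConformingMesh.disjoint_interior (h : IsConformingMesh ω 𝒯) {T T' : Rect} (hT : T ∈ 𝒯)
    (hT' : T' ∈ 𝒯) (hne : T ≠ T') : Disjoint (interior T.carrier) (interior T'.carrier) := by
  rw [Set.disjoint_left]
  intro p hp hp'
  have hmem : p ∈ convexHull ℝ (T.vertices ∩ T'.vertices) := by
    rw [← h.conforming T hT T' hT' hne]
    exact ⟨interior_subset hp, interior_subset hp'⟩
  rw [Rect.mem_interior] at hp hp'
  have key : ∀ (l : Plane →ₗ[ℝ] ℝ), (∀ q ∈ T.vertices ∩ T'.vertices, l p < l q) → False := by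
    intro l hl
    have := convexHull_min (t := {q | l p < l q}) hl (convex_halfSpace_gt l.isLinear _) hmem
    exact lt_irrefl (l p) this
  apply hne
  have hfst : T.x0 = T'.x0 ∧ T.x1 = T'.x1 := by
    constructor
    · by_contra hc
      apply key (LinearMap.fst ℝ ℝ ℝ)
      rintro q ⟨hq, hq'⟩
      rw [Rect.mem_vertices] at hq hq'
      simp only [LinearMap.fst_apply]
      rcases hq.1 with h1 | h1 <;> rcases hq'.1 with h2 | h2 <;> rw [h1] at h2 <;> first
        | exact absurd h2 hc | linarith [hp.1.1, hp.1.2, hp'.1.1, hp'.1.2]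
    · by_contra hc
      apply key (-LinearMap.fst ℝ ℝ ℝ)
      rintro q ⟨hq, hq'⟩
      rw [Rect.mem_vertices] at hq hq'
      simp only [LinearMap.neg_apply, LinearMap.fst_apply]
      rcases hq.1 with h1 | h1 <;> rcases hq'.1 with h2 | h2 <;> rw [h1] at h2 <;> first
        | exact absurd h2 hc | linarith [hp.1.1, hp.1.2, hp'.1.1, hp'.1.2]
  have hsnd : T.y0 = T'.y0 ∧ T.y1 = T'.y1 := by
    constructor
    · by_contra hc
      apply key (LinearMap.snd ℝ ℝ ℝ)
      rintro q ⟨hq, hq'⟩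
      rw [Rect.mem_vertices] at hq hq'
      simp only [LinearMap.snd_apply]
      rcases hq.2 with h1 | h1 <;> rcases hq'.2 with h2 | h2 <;> rw [h1] at h2 <;> first
        | exact absurd h2 hc | linarith [hp.2.1, hp.2.2, hp'.2.1, hp'.2.2]
    · by_contra hc
      apply key (-LinearMap.snd ℝ ℝ ℝ)
      rintro q ⟨hq, hq'⟩
      rw [Rect.mem_vertices] at hq hq'
      simp only [LinearMap.neg_apply, LinearMap.snd_apply]
      rcases hq.2 with h1 | h1 <;> rcases hq'.2 with h2 | h2 <;> rw [h1] at h2 <;> first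
        | exact absurd h2 hc | linarith [hp.2.1, hp.2.2, hp'.2.1, hp'.2.2]
  exact Rect.ext_sides hfst.1 hfst.2 hsnd.1 hsnd.2

/-- Two different elements meet in a common vertex, in a full common vertical edge, or in a full
common horizontal edge. -/
theorem IsConformingMesh.mem_inter (h : IsConformingMesh ω 𝒯) {T T' : Rect} (hT : T ∈ 𝒯)
    (hT' : T' ∈ 𝒯) (hne : T ≠ T') {x : Plane} (hx : x ∈ T.carrier) (hx' : x ∈ T'.carrier) :
    x ∈ T.vertices ∩ T'.vertices ∨
    ((T.y0 = T'.y0 ∧ T.y1 = T'.y1) ∧ (x.1 = T.x0 ∨ x.1 = T.x1) ∧ (x.1 = T'.x0 ∨ x.1 = T'.x1)) ∨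
    ((T.x0 = T'.x0 ∧ T.x1 = T'.x1) ∧ (x.2 = T.y0 ∨ x.2 = T.y1) ∧ (x.2 = T'.y0 ∨ x.2 = T'.y1)) := by
  have hmem : x ∈ convexHull ℝ (T.vertices ∩ T'.vertices) := by
    rw [← h.conforming T hT T' hT' hne]
    exact ⟨hx, hx'⟩
  have hTx := T.hx
  have hTy := T.hy
  have hTx' := T'.hx
  have hTy' := T'.hy
  obtain ⟨q0, hq0⟩ : (T.vertices ∩ T'.vertices).Nonempty := by
    rw [← convexHull_nonempty_iff (𝕜 := ℝ)]; exact ⟨x, hmem⟩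
  by_cases h1 : ∃ q ∈ T.vertices ∩ T'.vertices, q.1 ≠ q0.1
  -- Two common vertices with different first coordinates use up both vertical sides of both
  -- rectangles.
  · have hxs : T.x0 = T'.x0 ∧ T.x1 = T'.x1 := by
      obtain ⟨q, hq, hn⟩ := h1
      simp only [mem_inter_iff, Rect.mem_vertices] at hq hq0
      obtain ⟨⟨a, -⟩, ⟨b, -⟩⟩ := hq
      obtain ⟨⟨c, -⟩, ⟨d, -⟩⟩ := hq0
      rcases a with a | a <;> rcases b with b | b <;> rcases c with c | c <;>
        rcases d with d | d <;> first
        | exact absurd (a.trans c.symm) hn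
        | exact absurd (b.trans d.symm) hn
        | (constructor <;> linarith)
    by_cases h2 : ∃ q ∈ T.vertices ∩ T'.vertices, q.2 ≠ q0.2
    -- If both coordinates vary among the common vertices, all four sides coincide.
    · exfalso
      have hys : T.y0 = T'.y0 ∧ T.y1 = T'.y1 := by
        obtain ⟨q, hq, hn⟩ := h2
        simp only [mem_inter_iff, Rect.mem_vertices] at hq hq0
        obtain ⟨⟨-, a⟩, ⟨-, b⟩⟩ := hq
        obtain ⟨⟨-, c⟩, ⟨-, d⟩⟩ := hq0
        rcases a with a | a <;> rcases b with b | b <;> rcases c with c | c <;>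
          rcases d with d | d <;> first
          | exact absurd (a.trans c.symm) hn
          | exact absurd (b.trans d.symm) hn
          | (constructor <;> linarith)
      exact hne (Rect.ext_sides hxs.1 hxs.2 hys.1 hys.2)
    · push Not at h2
      have : x.2 = q0.2 := convexHull_min (t := {q : Plane | q.2 = q0.2}) h2
        (convex_hyperplane (f := fun q : Plane => q.2) (LinearMap.snd ℝ ℝ ℝ).isLinear _) hmem
      right; right
      simp only [mem_inter_iff, Rect.mem_vertices] at hq0
      rw [this]
      exact ⟨hxs, hq0.1.2, hq0.2.2⟩
  · push Not at h1
    have e1 : x.1 = q0.1 := convexHull_min (t := {q : Plane | q.1 = q0.1}) h1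
        (convex_hyperplane (f := fun q : Plane => q.1) (LinearMap.fst ℝ ℝ ℝ).isLinear _) hmem
    by_cases h2 : ∃ q ∈ T.vertices ∩ T'.vertices, q.2 ≠ q0.2
    · have hys : T.y0 = T'.y0 ∧ T.y1 = T'.y1 := by
        obtain ⟨q, hq, hn⟩ := h2
        simp only [mem_inter_iff, Rect.mem_vertices] at hq hq0
        obtain ⟨⟨-, a⟩, ⟨-, b⟩⟩ := hq
        obtain ⟨⟨-, c⟩, ⟨-, d⟩⟩ := hq0
        rcases a with a | a <;> rcases b with b | b <;> rcases c with c | c <;>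
          rcases d with d | d <;> first
          | exact absurd (a.trans c.symm) hn
          | exact absurd (b.trans d.symm) hn
          | (constructor <;> linarith)
      right; left
      simp only [mem_inter_iff, Rect.mem_vertices] at hq0
      rw [e1]
      exact ⟨hys, hq0.1.1, hq0.2.1⟩
    · push Not at h2
      have e2 : x.2 = q0.2 := convexHull_min (t := {q : Plane | q.2 = q0.2}) h2
        (convex_hyperplane (f := fun q : Plane => q.2) (LinearMap.snd ℝ ℝ ℝ).isLinear _) hmem
      left
      rwa [Prod.ext e1 e2]

/-! ### Integration over a partition -/

theorem Rect.volume_interior (T : Rect) : volume (interior T.carrier) = volume T.carrier := by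
  rw [T.interior_carrier, Rect.carrier, Measure.volume_eq_prod, Measure.prod_prod,
    Measure.prod_prod, Real.volume_Icc, Real.volume_Icc, Real.volume_Ioo, Real.volume_Ioo]

theorem Rect.interior_ae_eq (T : Rect) : interior T.carrier =ᵐ[volume] T.carrier :=
  ae_eq_of_subset_of_measure_ge interior_subset T.volume_interior.ge
    isOpen_interior.measurableSet.nullMeasurableSet
    T.isCompact_carrier.measure_lt_top.ne

theorem IsConformingMesh.setIntegral_eq_sum (h : IsConformingMesh ω 𝒯) {F : Plane → ℝ}
    (hF : ∀ T ∈ 𝒯, IntegrableOn F T.carrier) :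
    ∫ x in closure ω, F x = ∑ T ∈ 𝒯, ∫ x in T.carrier, F x := by
  have h1 : (⋃ T ∈ 𝒯, interior T.carrier) =ᵐ[volume] ⋃ T ∈ 𝒯, T.carrier :=
    Filter.EventuallyEq.biUnion 𝒯.finite_toSet fun T _ => T.interior_ae_eq
  rw [← h.cover, ← setIntegral_congr_set h1,
    integral_biUnion_finset 𝒯 (fun T _ => isOpen_interior.measurableSet)
      (fun T hT T' hT' hne => h.disjoint_interior hT hT' hne)
      (fun T hT => (hF T hT).mono_set interior_subset)]
  exact Finset.sum_congr rfl fun T _ => setIntegral_congr_set T.interior_ae_eq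

theorem IsConformingMesh.sum_area (h : IsConformingMesh ω 𝒯) :
    ∑ T ∈ 𝒯, T.area = volume.real (closure ω) := by
  have := h.setIntegral_eq_sum (F := fun _ => 1) (fun T _ => by
    rw [integrableOn_const_iff]; right; exact T.isCompact_carrier.measure_lt_top)
  simp only [setIntegral_const, smul_eq_mul, mul_one, Rect.volume_real_carrier] at this
  exact this.symm

end Mesh

/-! ### Partial derivatives along lines -/

section Lines

variable {V : Type} [NormedAddCommGroup V] [NormedSpace ℝ V] {T : Rect} {u : Plane → V} {x : Plane}

theorem hasDerivWithinAt_fst (hx : x ∈ T.carrier) (hu : DifferentiableWithinAt ℝ u T.carrier x) :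
    HasDerivWithinAt (fun s => u (s, x.2)) (pdOn 0 T u x) (Icc T.x0 T.x1) x.1 := by
  have h1 : HasDerivWithinAt (fun s : ℝ => ((s, x.2) : Plane)) (dir 0) (Icc T.x0 T.x1) x.1 :=
    (((hasDerivAt_id x.1).prodMk (hasDerivAt_const x.1 x.2))).hasDerivWithinAt
  exact HasFDerivWithinAt.comp_hasDerivWithinAt (f := fun s : ℝ => ((s, x.2) : Plane)) x.1
    (t := T.carrier) hu.hasFDerivWithinAt h1 (fun s hs => ⟨hs, hx.2⟩)

theorem hasDerivWithinAt_snd (hx : x ∈ T.carrier) (hu : DifferentiableWithinAt ℝ u T.carrier x) :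
    HasDerivWithinAt (fun s => u (x.1, s)) (pdOn 1 T u x) (Icc T.y0 T.y1) x.2 := by
  have h1 : HasDerivWithinAt (fun s : ℝ => ((x.1, s) : Plane)) (dir 1) (Icc T.y0 T.y1) x.2 :=
    (((hasDerivAt_const x.2 x.1).prodMk (hasDerivAt_id x.2))).hasDerivWithinAt
  exact HasFDerivWithinAt.comp_hasDerivWithinAt (f := fun s : ℝ => ((x.1, s) : Plane)) x.2
    (t := T.carrier) hu.hasFDerivWithinAt h1 (fun s hs => ⟨hx.1, hs⟩)

theorem pdOn_zero_eq (hx : x ∈ T.carrier) (hu : DifferentiableWithinAt ℝ u T.carrier x) {d : V}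
    (hd : HasDerivWithinAt (fun s => u (s, x.2)) d (Icc T.x0 T.x1) x.1) : pdOn 0 T u x = d :=
  (uniqueDiffOn_Icc T.hx x.1 hx.1).eq_deriv _ (hasDerivWithinAt_fst hx hu) hd

theorem pdOn_one_eq (hx : x ∈ T.carrier) (hu : DifferentiableWithinAt ℝ u T.carrier x) {d : V}
    (hd : HasDerivWithinAt (fun s => u (x.1, s)) d (Icc T.y0 T.y1) x.2) : pdOn 1 T u x = d :=
  (uniqueDiffOn_Icc T.hy x.2 hx.2).eq_deriv _ (hasDerivWithinAt_snd hx hu) hd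

theorem pdOn_congr {u v : Plane → V} (h : ∀ x ∈ T.carrier, u x = v x) (hx : x ∈ T.carrier)
    (i : Fin 2) : pdOn i T u x = pdOn i T v x := by
  rw [pdOn, pdOn, fderivWithin_congr h (h x hx)]

theorem pdOn_apply {ι : Type} [Fintype ι] {y : Plane → ι → ℝ} (hx : x ∈ T.carrier)
    (hy : DifferentiableWithinAt ℝ y T.carrier x) (i : Fin 2) (k : ι) :
    pdOn i T y x k = pdOn i T (fun x => y x k) x := by
  have h := (hasFDerivWithinAt_pi'.1 hy.hasFDerivWithinAt k).fderivWithin (T.uniqueDiffOn x hx)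
  simp only [pdOn]
  rw [h]
  rfl

theorem continuousOn_pdOn (hu : ContDiffOn ℝ 1 u T.carrier) (i : Fin 2) :
    ContinuousOn (pdOn i T u) T.carrier :=
  (hu.continuousOn_fderivWithin T.uniqueDiffOn le_rfl).clm_apply continuousOn_const

theorem norm_sub_le_fst (hu : DifferentiableOn ℝ u T.carrier) {B t s s' : ℝ}
    (ht : t ∈ Icc T.y0 T.y1) (hB : ∀ s ∈ Icc T.x0 T.x1, ‖pdOn 0 T u (s, t)‖ ≤ B)
    (hs : s ∈ Icc T.x0 T.x1) (hs' : s' ∈ Icc T.x0 T.x1) :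
    ‖u (s', t) - u (s, t)‖ ≤ B * |s' - s| :=
  Convex.norm_image_sub_le_of_norm_hasDerivWithin_le (f := fun s => u (s, t))
    (f' := fun s => pdOn 0 T u (s, t))
    (fun s hs => hasDerivWithinAt_fst (x := (s, t)) ⟨hs, ht⟩ (hu _ ⟨hs, ht⟩)) hB
    (convex_Icc _ _) hs hs'

theorem norm_sub_le_snd (hu : DifferentiableOn ℝ u T.carrier) {B t s s' : ℝ}
    (ht : t ∈ Icc T.x0 T.x1) (hB : ∀ s ∈ Icc T.y0 T.y1, ‖pdOn 1 T u (t, s)‖ ≤ B)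
    (hs : s ∈ Icc T.y0 T.y1) (hs' : s' ∈ Icc T.y0 T.y1) :
    ‖u (t, s') - u (t, s)‖ ≤ B * |s' - s| :=
  Convex.norm_image_sub_le_of_norm_hasDerivWithin_le (f := fun s => u (t, s))
    (f' := fun s => pdOn 1 T u (t, s))
    (fun s hs => hasDerivWithinAt_snd (x := (t, s)) ⟨ht, hs⟩ (hu _ ⟨ht, hs⟩)) hB
    (convex_Icc _ _) hs hs'

end Lines

/-! ### A Friedrichs inequality for piecewise smooth functions -/

/-- Cauchy–Schwarz against the constant one: the integral of (g - c)² is nonnegative, and c is taken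
to be the mean value of g. -/
theorem sq_setIntegral_le {α : Type*} [MeasurableSpace α] {μ : Measure α} {A : Set α}
    (hA : μ A ≠ ∞) {g : α → ℝ} (hg : IntegrableOn g A μ)
    (hg2 : IntegrableOn (fun x => g x ^ 2) A μ) :
    (∫ x in A, g x ∂μ) ^ 2 ≤ μ.real A * ∫ x in A, g x ^ 2 ∂μ := by
  have key : ∀ c : ℝ, 0 ≤ (∫ x in A, g x ^ 2 ∂μ) - 2 * c * (∫ x in A, g x ∂μ)
      + c ^ 2 * μ.real A := by
    intro c
    have hc : IntegrableOn (fun _ : α => c ^ 2) A μ := integrableOn_const hA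
    have h1 : ∫ x in A, (g x - c) ^ 2 ∂μ = (∫ x in A, g x ^ 2 ∂μ)
        - 2 * c * (∫ x in A, g x ∂μ) + c ^ 2 * μ.real A := by
      have : ∀ x, (g x - c) ^ 2 = g x ^ 2 - 2 * c * g x + c ^ 2 := fun x => by ring
      simp_rw [this]
      have hi : IntegrableOn (fun x => g x ^ 2 - 2 * c * g x) A μ := hg2.sub (hg.const_mul _)
      rw [integral_add hi hc, integral_sub hg2 (hg.const_mul _),
        integral_const_mul, setIntegral_const, smul_eq_mul]
      ring
    rw [← h1]
    exact integral_nonneg fun x => sq_nonneg _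
  rcases (measureReal_nonneg (μ := μ) (s := A)).eq_or_lt with h0 | h0
  · have h2 : μ A = 0 := by
      rcases (ENNReal.toReal_eq_zero_iff _).1 h0.symm with h | h
      · exact h
      · exact absurd h hA
    rw [Measure.restrict_eq_zero.2 h2]; simp
  · have h3 := key ((∫ x in A, g x ∂μ) / μ.real A)
    have h4 : (∫ x in A, g x ^ 2 ∂μ) - 2 * ((∫ x in A, g x ∂μ) / μ.real A) * (∫ x in A, g x ∂μ)
      + ((∫ x in A, g x ∂μ) / μ.real A) ^ 2 * μ.real A =
      (μ.real A * (∫ x in A, g x ^ 2 ∂μ) - (∫ x in A, g x ∂μ) ^ 2) / μ.real A := by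
      field_simp; ring
    rw [h4] at h3
    have := mul_nonneg h3 h0.le
    rw [div_mul_cancel₀ _ h0.ne'] at this
    linarith

theorem setIntegral_prod_symm {A B : Set ℝ} {F : Plane → ℝ} (hF : IntegrableOn F (A ×ˢ B)) :
    ∫ x in A ×ˢ B, F x = ∫ t in B, ∫ s in A, F (s, t) := by
  rw [IntegrableOn, Measure.volume_eq_prod, ← Measure.prod_restrict] at hF
  rw [Measure.volume_eq_prod, ← Measure.prod_restrict]
  exact integral_prod_symm _ hF

theorem IntegrableOn.integral_slice {A B : Set ℝ} {F : Plane → ℝ}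
    (hF : IntegrableOn F (A ×ˢ B)) : IntegrableOn (fun t => ∫ s in A, F (s, t)) B := by
  rw [IntegrableOn, Measure.volume_eq_prod, ← Measure.prod_restrict] at hF
  exact hF.integral_prod_right

/-- `v` is continuous on `S` and is, along almost all segments in `S` parallel to the axes, the
integral of its partial derivatives `G0`, `G1`. -/
structure HasLineGrad (S : Set Plane) (v G0 G1 : Plane → ℝ) : Prop where
  cont : ContinuousOn v S
  meas0 : Measurable G0
  meas1 : Measurable G1
  bdd0 : ∃ B, ∀ x, |G0 x| ≤ B
  bdd1 : ∃ B, ∀ x, |G1 x| ≤ B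
  ftc0 : ∃ N : Set ℝ, N.Countable ∧ ∀ t ∉ N, ∀ a b : ℝ, a ≤ b → (∀ s ∈ Icc a b, (s, t) ∈ S) →
    v (b, t) - v (a, t) = ∫ s in Icc a b, G0 (s, t)
  ftc1 : ∃ N : Set ℝ, N.Countable ∧ ∀ s ∉ N, ∀ a b : ℝ, a ≤ b → (∀ t ∈ Icc a b, (s, t) ∈ S) →
    v (s, b) - v (s, a) = ∫ t in Icc a b, G1 (s, t)

theorem integrableOn_sq_of_bdd {α : Type*} [MeasurableSpace α] {μ : Measure α} {A : Set α}
    (hA : μ A ≠ ∞) {G : α → ℝ} (hm : Measurable G) (hb : ∃ B, ∀ x, |G x| ≤ B) :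
    IntegrableOn G A μ ∧ IntegrableOn (fun x => G x ^ 2) A μ := by
  obtain ⟨B, hB⟩ := hb
  constructor
  · exact Measure.integrableOn_of_bounded (M := B) hA hm.aestronglyMeasurable
      (Filter.Eventually.of_forall hB)
  · refine Measure.integrableOn_of_bounded (M := B ^ 2) hA (hm.pow_const 2).aestronglyMeasurable
      (Filter.Eventually.of_forall fun x => ?_)
    rw [Real.norm_eq_abs, abs_pow]
    exact pow_le_pow_left₀ (abs_nonneg _) (hB x) 2

/-- The reflected rectangle. -/
def Rect.swap (R : Rect) : Rect := ⟨R.y0, R.y1, R.x0, R.x1, R.hy, R.hx⟩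

theorem Rect.swap_carrier (R : Rect) : R.swap.carrier = Prod.swap ⁻¹' R.carrier := by
  ext x; simp only [Rect.mem_carrier, mem_preimage, Rect.swap, Prod.fst_swap, Prod.snd_swap]; tauto

theorem setIntegral_swap (A : Set Plane) (F : Plane → ℝ) :
    ∫ x in Prod.swap ⁻¹' A, F x.swap = ∫ x in A, F x := by
  have h : MeasurePreserving (Prod.swap : Plane → Plane) volume volume :=
    Measure.measurePreserving_swap
  exact h.setIntegral_preimage_emb MeasurableEquiv.prodComm.measurableEmbedding F A

namespace HasLineGrad

variable {S : Set Plane} {v G0 G1 : Plane → ℝ}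

/-- Estimates are proved along the first variable and transported to the second by this reflection.
-/
protected theorem swap (h : HasLineGrad S v G0 G1) :
    HasLineGrad (Prod.swap ⁻¹' S) (fun x => v x.swap) (fun x => G1 x.swap)
      (fun x => G0 x.swap) where
  cont := h.cont.comp continuous_swap.continuousOn fun _ hx => hx
  meas0 := h.meas1.comp measurable_swap
  meas1 := h.meas0.comp measurable_swap
  bdd0 := h.bdd1.imp fun _ hB _ => hB _
  bdd1 := h.bdd0.imp fun _ hB _ => hB _
  ftc0 := h.ftc1
  ftc1 := h.ftc0

/-- Fundamental theorem along a horizontal segment, followed by Cauchy–Schwarz. The exceptional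
heights are countable, hence negligible once the height is integrated. -/
theorem sq_sub_le (h : HasLineGrad S v G0 G1) {R : Rect} (hR : R.carrier ⊆ S) :
    ∃ N : Set ℝ, N.Countable ∧ ∀ t ∉ N, t ∈ Icc R.y0 R.y1 → ∀ s ∈ Icc R.x0 R.x1,
      ∀ s' ∈ Icc R.x0 R.x1, (v (s, t) - v (s', t)) ^ 2 ≤
        (R.x1 - R.x0) * ∫ τ in Icc R.x0 R.x1, G0 (τ, t) ^ 2 := by
  obtain ⟨N, hN, hftc⟩ := h.ftc0
  refine ⟨N, hN, fun t ht htm => ?_⟩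
  have hm : Measurable fun τ => G0 (τ, t) := h.meas0.comp measurable_prodMk_right
  have hb : ∃ B, ∀ τ, |G0 (τ, t)| ≤ B := h.bdd0.imp fun _ hB x => hB _
  have main : ∀ s ∈ Icc R.x0 R.x1, ∀ s' ∈ Icc R.x0 R.x1, s ≤ s' → (v (s', t) - v (s, t)) ^ 2 ≤
        (R.x1 - R.x0) * ∫ τ in Icc R.x0 R.x1, G0 (τ, t) ^ 2 := by
    intro s hs s' hs' hle
    have hsub : Icc s s' ⊆ Icc R.x0 R.x1 := Icc_subset_Icc hs.1 hs'.2
    rw [hftc t ht s s' hle fun τ hτ => hR ⟨hsub hτ, htm⟩]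
    have hi := integrableOn_sq_of_bdd (A := Icc s s') (μ := volume) (by simp) hm hb
    have hi' := integrableOn_sq_of_bdd (A := Icc R.x0 R.x1) (μ := volume) (by simp) hm hb
    refine (sq_setIntegral_le (by simp) hi.1 hi.2).trans ?_
    rw [Real.volume_real_Icc_of_le hle]
    have h2 : 0 ≤ ∫ τ in Icc s s', G0 (τ, t) ^ 2 := integral_nonneg fun x => sq_nonneg _
    have h3 : ∫ τ in Icc s s', G0 (τ, t) ^ 2 ≤ ∫ τ in Icc R.x0 R.x1, G0 (τ, t) ^ 2 :=
      setIntegral_mono_set hi'.2 (Filter.Eventually.of_forall fun x => sq_nonneg _)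
        hsub.eventuallyLE
    exact mul_le_mul (by linarith [hs.1, hs'.2]) h3 h2 (by linarith [R.hx])
  intro s hs s' hs'
  rcases le_total s s' with hle | hle
  · have := main s hs s' hs' hle
    rwa [← neg_sub, neg_sq] at this
  · exact main s' hs' s hs hle

theorem integrableOn_sq (h : HasLineGrad S v G0 G1) {R : Rect} (hR : R.carrier ⊆ S) :
    IntegrableOn (fun x => v x ^ 2) R.carrier :=
  ((h.cont.mono hR).pow 2).integrableOn_compact R.isCompact_carrier

/-- On a horizontal line, v(s)² is at most 2v(s')² plus the squared oscillation. Averaging over s'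
in K and integrating over s and the height carries a bound from a vertical strip to the full
rectangle. -/
theorem extend (h : HasLineGrad S v G0 G1) {R : Rect} (hR : R.carrier ⊆ S) {K : Set ℝ}
    (hK : MeasurableSet K) (hKR : K ⊆ Icc R.x0 R.x1) :
    volume.real K * ∫ x in R.carrier, v x ^ 2 ≤
      2 * (R.x1 - R.x0) * (∫ x in K ×ˢ Icc R.y0 R.y1, v x ^ 2)
        + 2 * volume.real K * (R.x1 - R.x0) ^ 2 * ∫ x in R.carrier, G0 x ^ 2 := by
  obtain ⟨N, hN, hsq⟩ := h.sq_sub_le hR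
  have hKfin : volume K ≠ ∞ := ((measure_mono hKR).trans_lt (by simp)).ne
  have iv := h.integrableOn_sq hR
  have iK : IntegrableOn (fun x => v x ^ 2) (K ×ˢ Icc R.y0 R.y1) :=
    iv.mono_set (prod_mono hKR subset_rfl)
  have iG : IntegrableOn (fun x => G0 x ^ 2) R.carrier :=
    (integrableOn_sq_of_bdd R.isCompact_carrier.measure_lt_top.ne h.meas0 h.bdd0).2
  have hl := sub_pos.2 R.hx
  have hk := measureReal_nonneg (μ := volume) (s := K)
  have hslice : ∀ t ∉ N, t ∈ Icc R.y0 R.y1 →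
      volume.real K * ∫ s in Icc R.x0 R.x1, v (s, t) ^ 2 ≤
      2 * (R.x1 - R.x0) * (∫ s in K, v (s, t) ^ 2)
        + 2 * volume.real K * (R.x1 - R.x0) ^ 2 * ∫ s in Icc R.x0 R.x1, G0 (s, t) ^ 2 := by
    intro t ht htm
    set I := ∫ s in Icc R.x0 R.x1, G0 (s, t) ^ 2
    have hcont : ContinuousOn (fun s => v (s, t) ^ 2) (Icc R.x0 R.x1) :=
      ((h.cont.mono hR).comp (by fun_prop) fun s hs => ⟨hs, htm⟩).pow 2
    have iR := hcont.integrableOn_compact (μ := volume) isCompact_Icc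
    have iK' := iR.mono_set hKR
    have h1 : ∀ s ∈ Icc R.x0 R.x1, volume.real K * v (s, t) ^ 2 ≤
        2 * (∫ s in K, v (s, t) ^ 2) + 2 * volume.real K * (R.x1 - R.x0) * I := by
      intro s hs
      have h2 : ∀ s' ∈ K, v (s, t) ^ 2 ≤ 2 * v (s', t) ^ 2 + 2 * ((R.x1 - R.x0) * I) := by
        intro s' hs'
        have := hsq t ht htm s hs s' (hKR hs')
        nlinarith [sq_nonneg (v (s, t) - 2 * v (s', t))]
      have h3 : ∫ s' in K, v (s, t) ^ 2 ≤ ∫ s' in K, (2 * v (s', t) ^ 2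
          + 2 * ((R.x1 - R.x0) * I)) :=
        setIntegral_mono_on (integrableOn_const hKfin)
          ((iK'.const_mul 2).add (integrableOn_const hKfin)) hK h2
      rw [setIntegral_const, integral_add (iK'.const_mul 2) (integrableOn_const hKfin),
        setIntegral_const, integral_const_mul, smul_eq_mul, smul_eq_mul] at h3
      linarith
    have h4 := setIntegral_mono_on (μ := volume) (iR.const_mul (volume.real K))
      (integrableOn_const (by simp)) measurableSet_Icc h1
    rw [integral_const_mul, setIntegral_const, Real.volume_real_Icc_of_le R.hx.le,
      smul_eq_mul] at h4
    linarith
  have e1 := setIntegral_prod_symm iv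
  have e2 := setIntegral_prod_symm iK
  have e3 := setIntegral_prod_symm iG
  rw [show R.carrier = Icc R.x0 R.x1 ×ˢ Icc R.y0 R.y1 from rfl, e1, e2, e3,
    ← integral_const_mul, ← integral_const_mul, ← integral_const_mul, ← integral_add
      ((IntegrableOn.integral_slice iK).const_mul _) ((IntegrableOn.integral_slice iG).const_mul _)]
  refine setIntegral_mono_on_ae ((IntegrableOn.integral_slice iv).const_mul _)
    (((IntegrableOn.integral_slice iK).const_mul _).add
      ((IntegrableOn.integral_slice iG).const_mul _)) measurableSet_Icc ?_
  filter_upwards [compl_mem_ae_iff.2 (hN.measure_zero volume)] with t ht htm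
  exact hslice t ht htm

/-- The same oscillation bound, now started from the single abscissa e: the values on the part K of
the line control the strip of height set K. -/
theorem extend_edge (h : HasLineGrad S v G0 G1) {R : Rect} (hR : R.carrier ⊆ S) {K : Set ℝ}
    (hK : MeasurableSet K) (hKR : K ⊆ Icc R.y0 R.y1) {e M : ℝ} (he : e ∈ Icc R.x0 R.x1)
    (hM : ∀ t ∈ K, |v (e, t)| ≤ M) :
    ∫ x in Icc R.x0 R.x1 ×ˢ K, v x ^ 2 ≤
      2 * (R.x1 - R.x0) * volume.real K * M ^ 2
        + 2 * (R.x1 - R.x0) ^ 2 * ∫ x in R.carrier, G0 x ^ 2 := by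
  obtain ⟨N, hN, hsq⟩ := h.sq_sub_le hR
  have hKfin : volume K ≠ ∞ := ((measure_mono hKR).trans_lt (by simp)).ne
  have iv : IntegrableOn (fun x => v x ^ 2) (Icc R.x0 R.x1 ×ˢ K) :=
    (h.integrableOn_sq hR).mono_set (prod_mono subset_rfl hKR)
  have iG : IntegrableOn (fun x => G0 x ^ 2) R.carrier :=
    (integrableOn_sq_of_bdd R.isCompact_carrier.measure_lt_top.ne h.meas0 h.bdd0).2
  have iG' : IntegrableOn (fun x => G0 x ^ 2) (Icc R.x0 R.x1 ×ˢ K) :=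
    iG.mono_set (prod_mono subset_rfl hKR)
  have hl := sub_pos.2 R.hx
  have hslice : ∀ t ∉ N, t ∈ K → ∫ s in Icc R.x0 R.x1, v (s, t) ^ 2 ≤
      2 * (R.x1 - R.x0) * M ^ 2 + 2 * (R.x1 - R.x0) ^ 2 * ∫ s in Icc R.x0 R.x1, G0 (s, t) ^ 2 := by
    intro t ht htK
    have htm := hKR htK
    set I := ∫ s in Icc R.x0 R.x1, G0 (s, t) ^ 2
    have hcont : ContinuousOn (fun s => v (s, t) ^ 2) (Icc R.x0 R.x1) :=
      ((h.cont.mono hR).comp (by fun_prop) fun s hs => ⟨hs, htm⟩).pow 2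
    have iR := hcont.integrableOn_compact (μ := volume) isCompact_Icc
    have h1 : ∀ s ∈ Icc R.x0 R.x1, v (s, t) ^ 2 ≤ 2 * M ^ 2 + 2 * (R.x1 - R.x0) * I := by
      intro s hs
      have h2 := hsq t ht htm s hs e he
      have h3 : v (e, t) ^ 2 ≤ M ^ 2 := sq_le_sq' (abs_le.1 (hM t htK)).1 (abs_le.1 (hM t htK)).2
      nlinarith [sq_nonneg (v (s, t) - 2 * v (e, t))]
    have h4 := setIntegral_mono_on (μ := volume) iR
      (integrableOn_const (by simp)) measurableSet_Icc h1
    rw [setIntegral_const, Real.volume_real_Icc_of_le R.hx.le, smul_eq_mul] at h4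
    linarith
  have h5 : ∫ x in Icc R.x0 R.x1 ×ˢ K, v x ^ 2 ≤
      2 * (R.x1 - R.x0) * volume.real K * M ^ 2
        + 2 * (R.x1 - R.x0) ^ 2 * ∫ x in Icc R.x0 R.x1 ×ˢ K, G0 x ^ 2 := by
    have h6 : 2 * (R.x1 - R.x0) * volume.real K * M ^ 2 =
        ∫ _ in K, 2 * (R.x1 - R.x0) * M ^ 2 := by
      rw [setIntegral_const, smul_eq_mul]; ring
    have hc : IntegrableOn (fun _ : ℝ => 2 * (R.x1 - R.x0) * M ^ 2) K := integrableOn_const hKfin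
    rw [setIntegral_prod_symm iv, setIntegral_prod_symm iG', h6, ← integral_const_mul,
      ← integral_add hc ((IntegrableOn.integral_slice iG').const_mul _)]
    refine setIntegral_mono_on_ae (IntegrableOn.integral_slice iv)
      (hc.add ((IntegrableOn.integral_slice iG').const_mul _)) hK ?_
    filter_upwards [compl_mem_ae_iff.2 (hN.measure_zero volume)] with t ht htm
    exact hslice t ht htm
  refine h5.trans ?_
  gcongr
  · exact Filter.Eventually.of_forall fun x => sq_nonneg _
  · exact prod_mono subset_rfl hKR

end HasLineGrad

/-- On the rectangle `R` the mean square is controlled by the boundary values on `Γ` and by the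
gradient on `S`. -/
def Controlled (S Γ : Set Plane) (R : Rect) : Prop :=
  ∃ κ : ℝ, 0 ≤ κ ∧ ∀ (v G0 G1 : Plane → ℝ) (M : ℝ), HasLineGrad S v G0 G1 →
    (∀ x ∈ Γ, |v x| ≤ M) →
    ∫ x in R.carrier, v x ^ 2 ≤ κ * (M ^ 2 + (∫ x in S, G0 x ^ 2) + ∫ x in S, G1 x ^ 2)

namespace Controlled

variable {S Γ : Set Plane} {R R' : Rect}

protected theorem swap (h : Controlled (Prod.swap ⁻¹' S) (Prod.swap ⁻¹' Γ) R.swap) :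
    Controlled S Γ R := by
  obtain ⟨κ, hκ, h⟩ := h
  refine ⟨κ, hκ, fun v G0 G1 M hv hM => ?_⟩
  have := h _ _ _ M hv.swap fun x hx => hM _ hx
  rw [R.swap_carrier, setIntegral_swap R.carrier (fun x => v x ^ 2),
    setIntegral_swap S (fun x => G1 x ^ 2), setIntegral_swap S (fun x => G0 x ^ 2)] at this
  linarith

theorem swap_iff : Controlled (Prod.swap ⁻¹' S) (Prod.swap ⁻¹' Γ) R.swap ↔ Controlled S Γ R :=
  ⟨Controlled.swap, fun h => Controlled.swap (R := R.swap) h⟩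

theorem mono (h : Controlled S Γ R) (hRS : R.carrier ⊆ S) (hR : R'.carrier ⊆ R.carrier) :
    Controlled S Γ R' := by
  obtain ⟨κ, hκ, h⟩ := h
  refine ⟨κ, hκ, fun v G0 G1 M hv hM => (setIntegral_mono_set (hv.integrableOn_sq hRS)
    (Filter.Eventually.of_forall fun x => sq_nonneg _) hR.eventuallyLE).trans (h v G0 G1 M hv hM)⟩

/-- The strip over the smaller width already satisfies the bound. Widening it divides by that width,
so the constant depends on the two rectangles but not on the function. -/
theorem extend_fst (hS : volume S ≠ ∞) (h : Controlled S Γ R') (hRS : R.carrier ⊆ S)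
    (h0 : R.x0 ≤ R'.x0) (h1 : R'.x1 ≤ R.x1) (h2 : R'.y0 = R.y0) (h3 : R'.y1 = R.y1) :
    Controlled S Γ R := by
  obtain ⟨κ, hκ, h⟩ := h
  have hl := sub_pos.2 R.hx
  have hl' := sub_pos.2 R'.hx
  set l := R.x1 - R.x0
  set l' := R'.x1 - R'.x0
  refine ⟨(2 * l * κ + 2 * l' * l ^ 2) / l', by positivity, fun v G0 G1 M hv hM => ?_⟩
  have h4 := hv.extend hRS (K := Icc R'.x0 R'.x1) measurableSet_Icc (Icc_subset_Icc h0 h1)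
  have h5 := h v G0 G1 M hv hM
  rw [Real.volume_real_Icc_of_le R'.hx.le, ← h2, ← h3] at h4
  have iG := (integrableOn_sq_of_bdd hS hv.meas0 hv.bdd0).2
  have h6 : ∫ x in R.carrier, G0 x ^ 2 ≤ ∫ x in S, G0 x ^ 2 :=
    setIntegral_mono_set iG (Filter.Eventually.of_forall fun x => sq_nonneg _) hRS.eventuallyLE
  have h7 : 0 ≤ ∫ x in S, G1 x ^ 2 := integral_nonneg fun x => sq_nonneg _
  rw [div_mul_eq_mul_div, le_div_iff₀ hl']
  set X := ∫ x in R'.carrier, v x ^ 2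
  set Y := ∫ x in R.carrier, v x ^ 2
  set Q := M ^ 2 + (∫ x in S, G0 x ^ 2) + ∫ x in S, G1 x ^ 2
  have h8 : ∫ x in R.carrier, G0 x ^ 2 ≤ Q := by
    have : 0 ≤ M ^ 2 := sq_nonneg _
    linarith
  have h9 : l' * Y ≤ 2 * l * X + 2 * l' * l ^ 2 * ∫ x in R.carrier, G0 x ^ 2 := h4
  calc Y * l' = l' * Y := mul_comm _ _
    _ ≤ 2 * l * X + 2 * l' * l ^ 2 * ∫ x in R.carrier, G0 x ^ 2 := h9
    _ ≤ 2 * l * (κ * Q) + 2 * l' * l ^ 2 * Q := by gcongr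
    _ = _ := by ring

theorem extend_snd (hS : volume S ≠ ∞) (h : Controlled S Γ R') (hRS : R.carrier ⊆ S)
    (h0 : R.y0 ≤ R'.y0) (h1 : R'.y1 ≤ R.y1) (h2 : R'.x0 = R.x0) (h3 : R'.x1 = R.x1) :
    Controlled S Γ R := by
  rw [← swap_iff] at h ⊢
  refine extend_fst (R' := R'.swap) ?_ h ?_ h0 h1 h2 h3
  · have hmp : MeasurePreserving (Prod.swap : Plane → Plane) volume volume :=
      Measure.measurePreserving_swap
    rwa [hmp.measure_preimage_emb MeasurableEquiv.prodComm.measurableEmbedding]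
  · rw [R.swap_carrier]; exact preimage_mono hRS

theorem extend (hS : volume S ≠ ∞) (h : Controlled S Γ R') (hRS : R.carrier ⊆ S)
    (hR : R'.carrier ⊆ R.carrier) : Controlled S Γ R := by
  have a := hR (show (R'.x0, R'.y0) ∈ R'.carrier from
    ⟨left_mem_Icc.2 R'.hx.le, left_mem_Icc.2 R'.hy.le⟩)
  have b := hR (show (R'.x1, R'.y1) ∈ R'.carrier from
    ⟨right_mem_Icc.2 R'.hx.le, right_mem_Icc.2 R'.hy.le⟩)
  -- Widen first, at unchanged height; the intermediate rectangle still lies in the large one.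
  have h1 : Controlled S Γ ⟨R.x0, R.x1, R'.y0, R'.y1, R.hx, R'.hy⟩ :=
    extend_fst hS h ((prod_mono subset_rfl (Icc_subset_Icc a.2.1 b.2.2)).trans hRS) a.1.1 b.1.2
      rfl rfl
  exact extend_snd hS h1 hRS a.2.1 b.2.2 rfl rfl

/-- The boundary values control a horizontal strip over the heights that meet Γ. This strip has
positive height measure, so a vertical extension fills the rectangle. -/
theorem of_edge_fst (hS : IsCompact S) (hRS : R.carrier ⊆ S) {e : ℝ}
    (he : e ∈ Icc R.x0 R.x1) (hpos : 0 < volume {t ∈ Icc R.y0 R.y1 | (e, t) ∈ Γ}) :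
    Controlled S Γ R := by
  -- The closure makes the set of heights measurable without any measurability of Γ. The bound on v
  -- survives by continuity.
  set K := closure {t ∈ Icc R.y0 R.y1 | (e, t) ∈ Γ}
  have hKR : K ⊆ Icc R.y0 R.y1 := closure_minimal (fun t ht => ht.1) isClosed_Icc
  have hKm : MeasurableSet K := isClosed_closure.measurableSet
  have hKfin : volume K ≠ ∞ := ((measure_mono hKR).trans_lt (by simp)).ne
  have hk : 0 < volume.real K := by
    rw [Measure.real, ENNReal.toReal_pos_iff]
    exact ⟨hpos.trans_le (measure_mono subset_closure), hKfin.lt_top⟩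
  set k := volume.real K
  have hl := sub_pos.2 R.hx
  have hm := sub_pos.2 R.hy
  set l := R.x1 - R.x0
  set m := R.y1 - R.y0
  refine ⟨(2 * m * (2 * l * k + 2 * l ^ 2) + 2 * k * m ^ 2) / k, by positivity,
    fun v G0 G1 M hv hM => ?_⟩
  have hMK : ∀ t ∈ K, |v (e, t)| ≤ M := by
    have hc : ContinuousOn (fun t => |v (e, t)|) (Icc R.y0 R.y1) :=
      ((hv.cont.mono hRS).comp (by fun_prop) fun t ht => ⟨he, ht⟩).abs
    have hcl := hc.preimage_isClosed_of_isClosed isClosed_Icc (isClosed_Iic (a := M))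
    exact fun t ht => (closure_minimal (fun s hs => mem_inter hs.1 (hM _ hs.2)) hcl ht).2
  have h1 := hv.extend_edge hRS hKm hKR he hMK
  have h2 := hv.swap.extend (R := R.swap) (S := Prod.swap ⁻¹' S)
    (by rw [R.swap_carrier]; exact preimage_mono hRS) hKm hKR
  have e1 : K ×ˢ Icc R.swap.y0 R.swap.y1 = Prod.swap ⁻¹' (Icc R.x0 R.x1 ×ˢ K) := by
    ext x; simp [Rect.swap, and_comm]
  rw [R.swap_carrier, setIntegral_swap R.carrier (fun x => v x ^ 2),
    setIntegral_swap R.carrier (fun x => G1 x ^ 2), e1,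
    setIntegral_swap _ (fun x => v x ^ 2)] at h2
  have hfin := hS.measure_lt_top (μ := volume)
  have j0 : ∫ x in R.carrier, G0 x ^ 2 ≤ ∫ x in S, G0 x ^ 2 :=
    setIntegral_mono_set (integrableOn_sq_of_bdd hfin.ne hv.meas0 hv.bdd0).2
      (Filter.Eventually.of_forall fun x => sq_nonneg _) hRS.eventuallyLE
  have j1 : ∫ x in R.carrier, G1 x ^ 2 ≤ ∫ x in S, G1 x ^ 2 :=
    setIntegral_mono_set (integrableOn_sq_of_bdd hfin.ne hv.meas1 hv.bdd1).2
      (Filter.Eventually.of_forall fun x => sq_nonneg _) hRS.eventuallyLE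
  have p0 : 0 ≤ ∫ x in S, G0 x ^ 2 := integral_nonneg fun x => sq_nonneg _
  have p1 : 0 ≤ ∫ x in S, G1 x ^ 2 := integral_nonneg fun x => sq_nonneg _
  have p2 : 0 ≤ M ^ 2 := sq_nonneg _
  rw [div_mul_eq_mul_div, le_div_iff₀ hk]
  set Q := M ^ 2 + (∫ x in S, G0 x ^ 2) + ∫ x in S, G1 x ^ 2
  have q0 : ∫ x in R.carrier, G0 x ^ 2 ≤ Q := by linarith
  have q1 : ∫ x in R.carrier, G1 x ^ 2 ≤ Q := by linarith
  have q2 : M ^ 2 ≤ Q := by linarith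
  set Y := ∫ x in R.carrier, v x ^ 2
  set X := ∫ x in Icc R.x0 R.x1 ×ˢ K, v x ^ 2
  calc Y * k = k * Y := mul_comm _ _
    _ ≤ 2 * m * X + 2 * k * m ^ 2 * ∫ x in R.carrier, G1 x ^ 2 := h2
    _ ≤ 2 * m * (2 * l * k * Q + 2 * l ^ 2 * Q) + 2 * k * m ^ 2 * Q := by
        have : X ≤ 2 * l * k * Q + 2 * l ^ 2 * Q :=
          h1.trans (by gcongr)
        gcongr
    _ = _ := by ring

theorem of_edge_snd (hS : IsCompact S) (hRS : R.carrier ⊆ S) {e : ℝ}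
    (he : e ∈ Icc R.y0 R.y1) (hpos : 0 < volume {t ∈ Icc R.x0 R.x1 | (t, e) ∈ Γ}) :
    Controlled S Γ R := by
  rw [← swap_iff]
  refine of_edge_fst (R := R.swap) ((Homeomorph.prodComm ℝ ℝ).isCompact_preimage.2 hS) ?_ he hpos
  rw [R.swap_carrier]; exact preimage_mono hRS

end Controlled

/-! ### Functions that are smooth on each element -/

section PiecewiseSmooth

variable {ω : Set Plane} {𝒯 : Finset Rect}

theorem IsConformingMesh.continuousOn (h : IsConformingMesh ω 𝒯) {v : Plane → ℝ}
    (hv : ∀ T ∈ 𝒯, ContinuousOn v T.carrier) : ContinuousOn v (closure ω) := by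
  have hS : closure ω = ⋃ T : {T // T ∈ 𝒯}, T.1.carrier := by
    rw [← h.cover, iUnion_subtype]
  rw [hS]
  exact (locallyFinite_of_finite _).continuousOn_iUnion (fun T => T.1.isClosed_carrier)
    fun T => hv T.1 T.2

open Classical in
/-- The elementwise partial derivative as a globally defined function. -/
noncomputable def pwGrad (𝒯 : Finset Rect) (v : Plane → ℝ) (i : Fin 2) (x : Plane) : ℝ :=
  ∑ T ∈ 𝒯, (interior T.carrier).indicator (pdOn i T v) x

theorem IsConformingMesh.pwGrad_eq (h : IsConformingMesh ω 𝒯) (v : Plane → ℝ) (i : Fin 2)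
    {T : Rect} (hT : T ∈ 𝒯) {x : Plane} (hx : x ∈ interior T.carrier) :
    pwGrad 𝒯 v i x = pdOn i T v x := by
  rw [pwGrad, Finset.sum_eq_single_of_mem T hT, indicator_of_mem hx]
  intro T' hT' hne
  exact indicator_of_notMem (fun hx' => Set.disjoint_left.1
    (h.disjoint_interior hT' hT hne) hx' hx) _

theorem measurable_pwGrad {v : Plane → ℝ} (hv : ∀ T ∈ 𝒯, ContDiffOn ℝ 1 v T.carrier)
    (i : Fin 2) : Measurable (pwGrad 𝒯 v i) := by
  classical
  refine Finset.measurable_sum _ fun T hT => ?_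
  rw [← piecewise_eq_indicator]
  exact ((continuousOn_pdOn (hv T hT) i).mono interior_subset).measurable_piecewise
    continuousOn_const isOpen_interior.measurableSet

theorem bdd_pwGrad {v : Plane → ℝ} (hv : ∀ T ∈ 𝒯, ContDiffOn ℝ 1 v T.carrier)
    (i : Fin 2) : ∃ B, ∀ x, |pwGrad 𝒯 v i x| ≤ B := by
  have h1 : ∀ T : Rect, ∃ B, T ∈ 𝒯 → ∀ x,
      |(interior T.carrier).indicator (pdOn i T v) x| ≤ B := by
    intro T
    by_cases hT : T ∈ 𝒯
    · obtain ⟨B, hB⟩ := T.isCompact_carrier.exists_bound_of_continuousOn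
        (continuousOn_pdOn (hv T hT) i)
      refine ⟨max B 0, fun _ x => ?_⟩
      by_cases hx : x ∈ interior T.carrier
      · rw [indicator_of_mem hx]
        exact (hB x (interior_subset hx)).trans (le_max_left _ _)
      · rw [indicator_of_notMem hx]; simp
    · exact ⟨0, fun hc => absurd hc hT⟩
  choose B hB using h1
  exact ⟨∑ T ∈ 𝒯, B T, fun x => (Finset.abs_sum_le_sum_abs _ _).trans
    (Finset.sum_le_sum fun T hT => hB T hT x)⟩

/-- The first coordinates of the vertices of a partition. -/
def gridFst (𝒯 : Finset Rect) : Set ℝ := ⋃ T ∈ 𝒯, {T.x0, T.x1}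

/-- The second coordinates of the vertices of a partition. -/
def gridSnd (𝒯 : Finset Rect) : Set ℝ := ⋃ T ∈ 𝒯, {T.y0, T.y1}

theorem countable_gridFst : (gridFst 𝒯).Countable :=
  𝒯.countable_toSet.biUnion fun _ _ => (toFinite _).countable

theorem countable_gridSnd : (gridSnd 𝒯).Countable :=
  𝒯.countable_toSet.biUnion fun _ _ => (toFinite _).countable

theorem IsConformingMesh.exists_mem_interior (h : IsConformingMesh ω 𝒯) {x : Plane}
    (hx : x ∈ closure ω) (h1 : x.1 ∉ gridFst 𝒯) (h2 : x.2 ∉ gridSnd 𝒯) :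
    ∃ T ∈ 𝒯, x ∈ interior T.carrier := by
  obtain ⟨T, hT, hxT⟩ := h.exists_mem hx
  refine ⟨T, hT, ?_⟩
  simp only [gridFst, gridSnd, mem_iUnion, not_exists, mem_insert_iff, mem_singleton_iff,
    not_or] at h1 h2
  rw [Rect.mem_carrier] at hxT
  rw [Rect.mem_interior]
  exact ⟨⟨lt_of_le_of_ne hxT.1.1 (Ne.symm (h1 T hT).1), lt_of_le_of_ne hxT.1.2 (h1 T hT).2⟩,
    lt_of_le_of_ne hxT.2.1 (Ne.symm (h2 T hT).1), lt_of_le_of_ne hxT.2.2 (h2 T hT).2⟩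

/-- A line that avoids the grid coordinates crosses element boundaries only at the countably many
grid values of the other coordinate. The function is continuous there, so the fundamental theorem
with a countable exceptional set applies. -/
theorem IsConformingMesh.hasLineGrad (h : IsConformingMesh ω 𝒯) {v : Plane → ℝ}
    (hv : ∀ T ∈ 𝒯, ContDiffOn ℝ 1 v T.carrier) :
    HasLineGrad (closure ω) v (pwGrad 𝒯 v 0) (pwGrad 𝒯 v 1) where
  cont := h.continuousOn fun T hT => (hv T hT).continuousOn
  meas0 := measurable_pwGrad hv 0
  meas1 := measurable_pwGrad hv 1
  bdd0 := bdd_pwGrad hv 0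
  bdd1 := bdd_pwGrad hv 1
  ftc0 := by
    refine ⟨gridSnd 𝒯, countable_gridSnd, fun t ht a b hab hS => ?_⟩
    have hc := h.continuousOn fun T hT => (hv T hT).continuousOn
    obtain ⟨B, hB⟩ := bdd_pwGrad hv 0
    have hint := (integrableOn_sq_of_bdd (A := Icc a b) (μ := volume) (by simp)
      ((measurable_pwGrad hv 0).comp measurable_prodMk_right) ⟨B, fun s => hB (s, t)⟩).1
    rw [← integral_eq_of_hasDerivAt_off_countable_of_le (fun s => v (s, t))
      (fun s => pwGrad 𝒯 v 0 (s, t)) hab (countable_gridFst (𝒯 := 𝒯))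
      (hc.comp (by fun_prop) hS) ?_
      ((intervalIntegrable_iff_integrableOn_Icc_of_le hab).2 hint),
      intervalIntegral.integral_of_le hab, integral_Icc_eq_integral_Ioc]
    rintro s ⟨hs, hsN⟩
    obtain ⟨T, hT, hx⟩ := h.exists_mem_interior (hS s (Ioo_subset_Icc_self hs)) hsN ht
    rw [h.pwGrad_eq v 0 hT hx]
    have hxT := interior_subset hx
    rw [Rect.mem_interior] at hx
    exact (hasDerivWithinAt_fst hxT ((hv T hT).differentiableOn one_ne_zero _ hxT)).hasDerivAt
      (Icc_mem_nhds hx.1.1 hx.1.2)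
  ftc1 := by
    refine ⟨gridFst 𝒯, countable_gridFst, fun s hs a b hab hS => ?_⟩
    have hc := h.continuousOn fun T hT => (hv T hT).continuousOn
    obtain ⟨B, hB⟩ := bdd_pwGrad hv 1
    have hint := (integrableOn_sq_of_bdd (A := Icc a b) (μ := volume) (by simp)
      ((measurable_pwGrad hv 1).comp measurable_prodMk_left) ⟨B, fun t => hB (s, t)⟩).1
    rw [← integral_eq_of_hasDerivAt_off_countable_of_le (fun t => v (s, t))
      (fun t => pwGrad 𝒯 v 1 (s, t)) hab (countable_gridSnd (𝒯 := 𝒯))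
      (hc.comp (by fun_prop) hS) ?_
      ((intervalIntegrable_iff_integrableOn_Icc_of_le hab).2 hint),
      intervalIntegral.integral_of_le hab, integral_Icc_eq_integral_Ioc]
    rintro t ⟨ht, htN⟩
    obtain ⟨T, hT, hx⟩ := h.exists_mem_interior (hS t (Ioo_subset_Icc_self ht)) hs htN
    rw [h.pwGrad_eq v 1 hT hx]
    have hxT := interior_subset hx
    rw [Rect.mem_interior] at hx
    exact (hasDerivWithinAt_snd hxT ((hv T hT).differentiableOn one_ne_zero _ hxT)).hasDerivAt
      (Icc_mem_nhds hx.2.1 hx.2.2)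

theorem IsConformingMesh.setIntegral_pwGrad_sq (h : IsConformingMesh ω 𝒯) {v : Plane → ℝ}
    (hv : ∀ T ∈ 𝒯, ContDiffOn ℝ 1 v T.carrier) (i : Fin 2) :
    ∫ x in closure ω, pwGrad 𝒯 v i x ^ 2 = ∑ T ∈ 𝒯, ∫ x in T.carrier, pdOn i T v x ^ 2 := by
  rw [h.setIntegral_eq_sum fun T _ => (integrableOn_sq_of_bdd
    T.isCompact_carrier.measure_lt_top.ne (measurable_pwGrad hv i) (bdd_pwGrad hv i)).2]
  refine Finset.sum_congr rfl fun T hT => ?_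
  rw [← setIntegral_congr_set T.interior_ae_eq, ← setIntegral_congr_set T.interior_ae_eq]
  exact setIntegral_congr_fun isOpen_interior.measurableSet fun x hx => by
    simp only [h.pwGrad_eq v i hT hx]

end PiecewiseSmooth

/-! ### Spreading the control from one edge to the whole domain -/

/-- An axis-parallel line is an isometric copy of ℝ, also for the maximum metric of the product, and
on ℝ the one-dimensional Hausdorff measure is Lebesgue measure. -/
theorem pos_slice_of_hausdorffMeasure_fst {Γ : Set Plane} {e c d : ℝ}
    (h : 0 < Measure.hausdorffMeasure 1 (Γ ∩ {x : Plane | x.1 = e ∧ x.2 ∈ Icc c d})) :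
    0 < volume {t ∈ Icc c d | (e, t) ∈ Γ} := by
  have hiso : Isometry fun t : ℝ => ((e, t) : Plane) := by
    refine Isometry.of_dist_eq fun s t => ?_
    simp [Prod.dist_eq]
  have himg : Γ ∩ {x : Plane | x.1 = e ∧ x.2 ∈ Icc c d} =
      (fun t : ℝ => ((e, t) : Plane)) '' {t ∈ Icc c d | (e, t) ∈ Γ} := by
    ext ⟨x, y⟩
    constructor
    · rintro ⟨h1, h2, h3⟩
      simp only at h2; subst h2
      exact ⟨y, ⟨h3, h1⟩, rfl⟩
    · rintro ⟨t, ⟨h1, h2⟩, h3⟩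
      rw [← h3]
      exact ⟨h2, rfl, h1⟩
  rwa [himg, hiso.hausdorffMeasure_image (Or.inl zero_le_one), hausdorffMeasure_real] at h

theorem pos_slice_of_hausdorffMeasure_snd {Γ : Set Plane} {e c d : ℝ}
    (h : 0 < Measure.hausdorffMeasure 1 (Γ ∩ {x : Plane | x.2 = e ∧ x.1 ∈ Icc c d})) :
    0 < volume {t ∈ Icc c d | (t, e) ∈ Γ} := by
  have hiso : Isometry fun t : ℝ => ((t, e) : Plane) := by
    refine Isometry.of_dist_eq fun s t => ?_
    simp [Prod.dist_eq]
  have himg : Γ ∩ {x : Plane | x.2 = e ∧ x.1 ∈ Icc c d} =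
      (fun t : ℝ => ((t, e) : Plane)) '' {t ∈ Icc c d | (t, e) ∈ Γ} := by
    ext ⟨x, y⟩
    constructor
    · rintro ⟨h1, h2, h3⟩
      simp only at h2; subst h2
      exact ⟨x, ⟨h3, h1⟩, rfl⟩
    · rintro ⟨t, ⟨h1, h2⟩, h3⟩
      rw [← h3]
      exact ⟨h2, rfl, h1⟩
  rwa [himg, hiso.hausdorffMeasure_image (Or.inl zero_le_one), hausdorffMeasure_real] at h

theorem IsConformingMesh.mem_edge {ω : Set Plane} {𝒯 : Finset Rect} (h : IsConformingMesh ω 𝒯)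
    (hω : interior (closure ω) = ω) {x : Plane} (hx : x ∈ frontier ω) {T : Rect} (hT : T ∈ 𝒯)
    (hxT : x ∈ T.carrier) :
    (x.1 = T.x0 ∨ x.1 = T.x1) ∨ (x.2 = T.y0 ∨ x.2 = T.y1) := by
  by_contra hc
  push Not at hc
  have hopen : IsOpen ω := hω ▸ isOpen_interior
  rw [hopen.frontier_eq] at hx
  refine hx.2 (h.interior_carrier_subset hω hT ?_)
  rw [Rect.mem_carrier] at hxT
  rw [Rect.mem_interior]
  exact ⟨⟨lt_of_le_of_ne hxT.1.1 hc.1.1.symm, lt_of_le_of_ne hxT.1.2 hc.1.2⟩,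
    lt_of_le_of_ne hxT.2.1 hc.2.1.symm, lt_of_le_of_ne hxT.2.2 hc.2.2⟩

/-- A frontier point can only lie on the edges of an element that contains it. If no element were
controlled, each of the finitely many edges would carry zero Dirichlet length, and so would their
union. -/
theorem IsConformingMesh.exists_controlled {ω ΓD : Set Plane} {𝒯 : Finset Rect}
    (h : IsConformingMesh ω 𝒯) (hω : interior (closure ω) = ω) (hΓ : ΓD ⊆ frontier ω)
    (hΓpos : 0 < Measure.hausdorffMeasure 1 ΓD) :
    ∃ T ∈ 𝒯, Controlled (closure ω) ΓD T := by
  by_contra hc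
  push Not at hc
  have hΓS : ΓD ⊆ closure ω := hΓ.trans frontier_subset_closure
  have hnull : ∀ T ∈ 𝒯, Measure.hausdorffMeasure 1 (ΓD ∩ T.carrier) = 0 := by
    intro T hT
    have hTS := h.carrier_subset hT
    have e1 : ∀ e ∈ Icc T.x0 T.x1, Measure.hausdorffMeasure 1
        (ΓD ∩ {x : Plane | x.1 = e ∧ x.2 ∈ Icc T.y0 T.y1}) = 0 := by
      intro e he
      by_contra hp
      exact hc T hT (Controlled.of_edge_fst h.isCompact hTS he
        (pos_slice_of_hausdorffMeasure_fst (pos_iff_ne_zero.2 hp)))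
    have e2 : ∀ e ∈ Icc T.y0 T.y1, Measure.hausdorffMeasure 1
        (ΓD ∩ {x : Plane | x.2 = e ∧ x.1 ∈ Icc T.x0 T.x1}) = 0 := by
      intro e he
      by_contra hp
      exact hc T hT (Controlled.of_edge_snd h.isCompact hTS he
        (pos_slice_of_hausdorffMeasure_snd (pos_iff_ne_zero.2 hp)))
    refine measure_mono_null ?_ (measure_union_null
      (measure_union_null (e1 _ (left_mem_Icc.2 T.hx.le)) (e1 _ (right_mem_Icc.2 T.hx.le)))
      (measure_union_null (e2 _ (left_mem_Icc.2 T.hy.le)) (e2 _ (right_mem_Icc.2 T.hy.le))))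
    rintro x ⟨hx, hxT⟩
    rcases h.mem_edge hω (hΓ hx) hT hxT with (h1 | h1) | h1 | h1
    · exact Or.inl (Or.inl ⟨hx, h1, hxT.2⟩)
    · exact Or.inl (Or.inr ⟨hx, h1, hxT.2⟩)
    · exact Or.inr (Or.inl ⟨hx, h1, hxT.1⟩)
    · exact Or.inr (Or.inr ⟨hx, h1, hxT.1⟩)
  refine hΓpos.ne' (measure_mono_null (t := ⋃ T ∈ 𝒯, ΓD ∩ T.carrier) ?_
    ((measure_biUnion_null_iff 𝒯.countable_toSet).2 hnull))
  intro x hx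
  obtain ⟨T, hT, hxT⟩ := h.exists_mem (hΓS hx)
  exact mem_biUnion hT ⟨hx, hxT⟩

/-- The closed square with centre `x` and side length `2 * r`. -/
def Rect.square (x : Plane) (r : ℝ) (hr : 0 < r) : Rect :=
  ⟨x.1 - r, x.1 + r, x.2 - r, x.2 + r, by linarith, by linarith⟩

theorem Rect.square_carrier (x : Plane) (r : ℝ) (hr : 0 < r) :
    (Rect.square x r hr).carrier = Metric.closedBall x r := by
  rw [← Prod.mk.eta (p := x), ← closedBall_prod_same, Real.closedBall_eq_Icc,
    Real.closedBall_eq_Icc]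
  rfl

theorem exists_square_subset {x : Plane} {U : Set Plane} (hU : U ∈ nhds x) :
    ∃ R : Rect, x ∈ interior R.carrier ∧ R.carrier ⊆ U := by
  obtain ⟨r, hr, hrU⟩ := Metric.nhds_basis_closedBall.mem_iff.1 hU
  refine ⟨Rect.square x r hr, ?_, by rwa [Rect.square_carrier]⟩
  rw [Rect.mem_interior]
  simp [Rect.square, hr]

/-- Control passes to smaller rectangles and from a subrectangle to any larger rectangle in the
closed domain, hence between any two whose interiors overlap. Connectedness does the rest. -/
theorem controlled_of_subset {ω ΓD : Set Plane} (hω : interior (closure ω) = ω)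
    (hconn : IsConnected ω) (hfin : volume (closure ω) ≠ ∞) {R0 : Rect}
    (hR0 : R0.carrier ⊆ closure ω) (h0 : Controlled (closure ω) ΓD R0) {R : Rect}
    (hR : R.carrier ⊆ closure ω) : Controlled (closure ω) ΓD R := by
  have hint : ∀ {R : Rect}, R.carrier ⊆ closure ω → interior R.carrier ⊆ ω := by
    intro R hR
    conv_rhs => rw [← hω]
    exact interior_mono hR
  have hopen : IsOpen ω := hω ▸ isOpen_interior
  let u : Set Plane := ⋃ R ∈ {R : Rect | Controlled (closure ω) ΓD R ∧ R.carrier ⊆ closure ω},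
    interior R.carrier
  have hu : IsOpen u := isOpen_biUnion fun _ _ => isOpen_interior
  have hne : ∀ R : Rect, (interior R.carrier).Nonempty := by
    intro R
    rw [R.interior_carrier]
    exact (nonempty_Ioo.2 R.hx).prod (nonempty_Ioo.2 R.hy)
  have hsub : ω ⊆ u := by
    refine hconn.isPreconnected.subset_of_closure_inter_subset hu ?_ ?_
    · obtain ⟨x, hx⟩ := hne R0
      exact ⟨x, hint hR0 hx, mem_biUnion (show R0 ∈ {R : Rect | _} from ⟨h0, hR0⟩) hx⟩
    -- Relative closedness: a square around a limit point overlaps a controlled rectangle, and a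
    -- small square in the overlap transmits the control.
    · rintro x ⟨hxu, hxω⟩
      obtain ⟨Q, hxQ, hQ⟩ := exists_square_subset (hopen.mem_nhds hxω)
      obtain ⟨y, hyQ, hyu⟩ := mem_closure_iff.1 hxu _ isOpen_interior hxQ
      obtain ⟨R', ⟨hc, hR'⟩, hyR'⟩ := mem_iUnion₂.1 hyu
      obtain ⟨R'', -, hR''⟩ := exists_square_subset
        ((isOpen_interior.inter isOpen_interior).mem_nhds ⟨hyQ, hyR'⟩)
      have hc'' := hc.mono hR' (hR''.trans (inter_subset_right.trans interior_subset))
      have hQS := hQ.trans subset_closure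
      exact mem_biUnion (show Q ∈ {R : Rect | _} from ⟨hc''.extend hfin hQS
        (hR''.trans (inter_subset_left.trans interior_subset)), hQS⟩) hxQ
  obtain ⟨x, hx⟩ := hne R
  obtain ⟨R', ⟨hc, hR'⟩, hyR'⟩ := mem_iUnion₂.1 (hsub (hint hR hx))
  obtain ⟨R'', -, hR''⟩ := exists_square_subset
    ((isOpen_interior.inter isOpen_interior).mem_nhds ⟨hx, hyR'⟩)
  exact (hc.mono hR' (hR''.trans (inter_subset_right.trans interior_subset))).extend hfin hR
    (hR''.trans (inter_subset_left.trans interior_subset))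

/-- Friedrichs' inequality for functions that are continuous and piecewise continuously
differentiable, with a constant that does not depend on the partition. -/
theorem exists_friedrichs {ω ΓD : Set Plane} (hω : interior (closure ω) = ω)
    (hconn : IsConnected ω) (hΓ : ΓD ⊆ frontier ω)
    (hΓpos : 0 < Measure.hausdorffMeasure 1 ΓD) :
    ∃ κ : ℝ, 0 ≤ κ ∧ ∀ 𝒯 : Finset Rect, IsConformingMesh ω 𝒯 → ∀ v : Plane → ℝ,
      (∀ T ∈ 𝒯, ContDiffOn ℝ 1 v T.carrier) → ∀ M : ℝ, (∀ x ∈ ΓD, |v x| ≤ M) →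
      ∑ T ∈ 𝒯, ∫ x in T.carrier, v x ^ 2 ≤ κ * (M ^ 2 +
        (∑ T ∈ 𝒯, ∫ x in T.carrier, pdOn 0 T v x ^ 2) +
        ∑ T ∈ 𝒯, ∫ x in T.carrier, pdOn 1 T v x ^ 2) := by
  -- The constant is computed on a reference partition chosen here, before the partition in the
  -- claim is introduced. Without any partition the claim is vacuous.
  by_cases hex : ∃ 𝒯₀ : Finset Rect, IsConformingMesh ω 𝒯₀
  swap
  · exact ⟨0, le_rfl, fun 𝒯 h => absurd ⟨𝒯, h⟩ hex⟩
  obtain ⟨𝒯₀, h₀⟩ := hex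
  obtain ⟨T₀, hT₀, hc₀⟩ := h₀.exists_controlled hω hΓ hΓpos
  have hfin : volume (closure ω) ≠ ∞ := h₀.isCompact.measure_lt_top.ne
  have hall : ∀ T : Rect, ∃ κ : ℝ, T ∈ 𝒯₀ → 0 ≤ κ ∧ ∀ (v G0 G1 : Plane → ℝ) (M : ℝ),
      HasLineGrad (closure ω) v G0 G1 → (∀ x ∈ ΓD, |v x| ≤ M) →
      ∫ x in T.carrier, v x ^ 2 ≤
        κ * (M ^ 2 + (∫ x in closure ω, G0 x ^ 2) + ∫ x in closure ω, G1 x ^ 2) := by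
    intro T
    by_cases hT : T ∈ 𝒯₀
    · obtain ⟨κ, h1, h2⟩ := controlled_of_subset hω hconn hfin (h₀.carrier_subset hT₀) hc₀
        (h₀.carrier_subset hT)
      exact ⟨κ, fun _ => ⟨h1, h2⟩⟩
    · exact ⟨0, fun h => absurd h hT⟩
  choose κ hκ using hall
  refine ⟨∑ T ∈ 𝒯₀, κ T, Finset.sum_nonneg fun T hT => (hκ T hT).1, ?_⟩
  intro 𝒯 h v hv M hM
  have hline := h.hasLineGrad hv
  -- The integral over the closed domain is the bridge: it is reassembled from the given partition
  -- and cut again along the reference partition.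
  rw [← h.setIntegral_pwGrad_sq hv, ← h.setIntegral_pwGrad_sq hv, Finset.sum_mul,
    ← h.setIntegral_eq_sum fun T hT => hline.integrableOn_sq (h.carrier_subset hT),
    h₀.setIntegral_eq_sum fun T hT => hline.integrableOn_sq (h₀.carrier_subset hT)]
  exact Finset.sum_le_sum fun T hT => (hκ T hT).2 v _ _ M hline hM

/-! ### Test functions in product form -/

/-- Smooth functions with compact support in the open interval. -/
structure IsTest (a b : ℝ) (α : ℝ → ℝ) : Prop where
  smooth : ContDiff ℝ ((⊤ : ℕ∞) : WithTop ℕ∞) α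
  supp : tsupport α ⊆ Ioo a b

namespace IsTest

variable {a b : ℝ} {α f : ℝ → ℝ}

theorem eq_zero (h : IsTest a b α) {x : ℝ} (hx : x ∉ Ioo a b) : α x = 0 := by
  by_contra hne
  exact hx (h.supp (subset_tsupport _ hne))

theorem isCompact (h : IsTest a b α) : IsCompact (tsupport α) :=
  isCompact_Icc.of_isClosed_subset (isClosed_tsupport _) (h.supp.trans Ioo_subset_Icc_self)

theorem continuous (h : IsTest a b α) : Continuous α := h.smooth.continuous

theorem differentiable (h : IsTest a b α) : Differentiable ℝ α :=
  h.smooth.differentiable (by simp)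

protected theorem deriv (h : IsTest a b α) : IsTest a b (deriv α) :=
  ⟨(contDiff_infty_iff_deriv.1 h.smooth).2, (tsupport_deriv_subset).trans h.supp⟩

theorem iterate (h : IsTest a b α) (n : ℕ) : IsTest a b (deriv^[n] α) := by
  induction n with
  | zero => exact h
  | succ n ih => rw [Function.iterate_succ_apply']; exact ih.deriv

theorem sub (h : IsTest a b α) (h' : IsTest a b f) : IsTest a b (fun x => α x - f x) :=
  ⟨h.smooth.sub h'.smooth, (tsupport_sub α f).trans (union_subset h.supp h'.supp)⟩

/-- The vanishing mean is what makes the primitive vanish again beyond the support of `f`. -/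
theorem exists_primitive (hab : a < b) (hf : IsTest a b f) (h0 : ∫ x in Icc a b, f x = 0) :
    ∃ α, IsTest a b α ∧ deriv α = f ∧ ∀ x, |α x| ≤ ∫ x in Icc a b, |f x| := by
  obtain ⟨a', b', ha', hb', hsub⟩ : ∃ a' b', a < a' ∧ b' < b ∧ tsupport f ⊆ Icc a' b' := by
    -- The inserted midpoint keeps the set nonempty when `f` is zero, so that extreme points exist.
    have hK : IsCompact (insert ((a + b) / 2) (tsupport f)) := hf.isCompact.insert _
    have hsub : insert ((a + b) / 2) (tsupport f) ⊆ Ioo a b :=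
      insert_subset ⟨by linarith, by linarith⟩ hf.supp
    obtain ⟨a', h1, h2⟩ := hK.exists_isLeast (insert_nonempty _ _)
    obtain ⟨b', h3, h4⟩ := hK.exists_isGreatest (insert_nonempty _ _)
    exact ⟨a', b', (hsub h1).1, (hsub h3).2, fun x hx =>
      ⟨h2 (mem_insert_of_mem _ hx), h4 (mem_insert_of_mem _ hx)⟩⟩
  have hz : ∀ x, x ∉ Icc a' b' → f x = 0 := by
    intro x hx
    by_contra hne
    exact hx (hsub (subset_tsupport _ hne))
  have hint : ∀ x y : ℝ, IntervalIntegrable f volume x y :=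
    fun x y => hf.continuous.intervalIntegrable x y
  set α : ℝ → ℝ := fun x => ∫ t in a..x, f t with hα
  have hd : ∀ x, HasDerivAt α (f x) x := fun x =>
    intervalIntegral.integral_hasDerivAt_right (hint a x)
      hf.continuous.stronglyMeasurable.stronglyMeasurableAtFilter hf.continuous.continuousAt
  have hderiv : deriv α = f := funext fun x => (hd x).deriv
  have hleft : ∀ x, x < a' → α x = 0 := by
    intro x hx
    refine (intervalIntegral.integral_congr (g := fun _ => 0) fun t ht => ?_).trans (by simp)
    refine hz t fun h => ?_
    rcases le_total a x with hax | hax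
    · rw [uIcc_of_le hax] at ht; linarith [ht.2, h.1]
    · rw [uIcc_of_ge hax] at ht; linarith [ht.2, h.1]
  have hright : ∀ x, b' < x → α x = 0 := by
    intro x hx
    have h1 : ∫ t in a..b, f t = 0 := by
      rw [intervalIntegral.integral_of_le hab.le, ← integral_Icc_eq_integral_Ioc, h0]
    have h2 : ∫ t in b..x, f t = 0 := by
      refine (intervalIntegral.integral_congr (g := fun _ => 0) fun t ht => ?_).trans (by simp)
      refine hz t fun h => ?_
      rcases le_total b x with hax | hax
      · rw [uIcc_of_le hax] at ht; linarith [ht.1, h.2]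
      · rw [uIcc_of_ge hax] at ht; linarith [ht.1, h.2]
    rw [hα]
    simp only
    rw [← intervalIntegral.integral_add_adjacent_intervals (hint a b) (hint b x), h1, h2, add_zero]
  have hzero : ∀ x, x ∉ Icc a' b' → α x = 0 := by
    intro x hx
    by_cases h : x < a'
    · exact hleft x h
    · exact hright x (not_le.1 fun h' => hx ⟨not_lt.1 h, h'⟩)
  have hsupp : tsupport α ⊆ Icc a' b' :=
    closure_minimal (fun x hx => by by_contra h; exact hx (hzero x h)) isClosed_Icc
  refine ⟨α, ⟨?_, hsupp.trans fun x hx => ⟨ha'.trans_le hx.1, hx.2.trans_lt hb'⟩⟩, hderiv, ?_⟩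
  · exact contDiff_infty_iff_deriv.2 ⟨fun x => (hd x).differentiableAt, hderiv ▸ hf.smooth⟩
  · intro x
    have hi : IntegrableOn (fun x => |f x|) (Icc a b) :=
      hf.continuous.abs.continuousOn.integrableOn_compact isCompact_Icc
    by_cases hx : x ∈ Icc a b
    · rw [hα]
      simp only
      rw [intervalIntegral.integral_of_le hx.1]
      exact (abs_integral_le_integral_abs).trans (setIntegral_mono_set hi
        (Filter.Eventually.of_forall fun x => abs_nonneg _)
        (show Ioc a x ⊆ Icc a b from fun y hy => ⟨hy.1.le, hy.2.trans hx.2⟩).eventuallyLE)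
    · rw [hzero x fun h => hx ⟨ha'.le.trans h.1, h.2.trans hb'.le⟩, abs_zero]
      exact integral_nonneg fun x => abs_nonneg _

theorem exists_mollifier {p ε : ℝ} (hp : p ∈ Ioo a b) (hε : 0 < ε) :
    ∃ ρ, IsTest a b ρ ∧ (∀ x, 0 ≤ ρ x) ∧ (∀ x, ρ x ≠ 0 → |x - p| < ε) ∧
      ∫ x in Icc a b, ρ x = 1 := by
  obtain ⟨r, hr, hrab⟩ := Metric.isOpen_iff.1 isOpen_Ioo p hp
  have hm : 0 < min r ε := lt_min hr hε
  -- The outer radius is half of the admissible one, so the closed support stays in the open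
  -- interval.
  let F : ContDiffBump p := ⟨min r ε / 4, min r ε / 2, by linarith, by linarith⟩
  have hball : Metric.closedBall p F.rOut ⊆ Ioo a b := by
    refine (Metric.closedBall_subset_ball ?_).trans hrab
    change min r ε / 2 < r
    linarith [min_le_left r ε]
  have ht : IsTest a b (F.normed volume) :=
    ⟨F.contDiff_normed, by rw [F.tsupport_normed_eq]; exact hball⟩
  refine ⟨F.normed volume, ht, F.nonneg_normed, fun x hx => ?_, ?_⟩
  · have h1 : x ∈ Function.support (F.normed volume) := hx
    rw [F.support_normed_eq, Metric.mem_ball, Real.dist_eq] at h1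
    refine h1.trans ?_
    change min r ε / 2 < ε
    linarith [min_le_right r ε]
  · rw [setIntegral_eq_integral_of_forall_compl_eq_zero, F.integral_normed]
    exact fun x hx => ht.eq_zero fun h => hx (Ioo_subset_Icc_self h)

end IsTest

/-- Tensor product of two functions of one variable. -/
def tensor (α β : ℝ → ℝ) (x : Plane) : ℝ := α x.1 * β x.2

theorem pd_zero_tensor {α β : ℝ → ℝ} (hα : Differentiable ℝ α) (hβ : Differentiable ℝ β) :
    pd 0 (tensor α β) = tensor (deriv α) β := by
  funext x
  have h1 : HasFDerivAt (fun x : Plane => α x.1) _ x :=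
    (hα x.1).hasDerivAt.hasFDerivAt.comp x hasFDerivAt_fst
  have h2 : HasFDerivAt (fun x : Plane => β x.2) _ x :=
    (hβ x.2).hasDerivAt.hasFDerivAt.comp x hasFDerivAt_snd
  have h3 : HasFDerivAt (tensor α β) _ x := h1.mul h2
  rw [pd, h3.fderiv]
  simp [tensor, dir, mul_comm]

theorem pd_one_tensor {α β : ℝ → ℝ} (hα : Differentiable ℝ α) (hβ : Differentiable ℝ β) :
    pd 1 (tensor α β) = tensor α (deriv β) := by
  funext x
  have h1 : HasFDerivAt (fun x : Plane => α x.1) _ x :=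
    (hα x.1).hasDerivAt.hasFDerivAt.comp x hasFDerivAt_fst
  have h2 : HasFDerivAt (fun x : Plane => β x.2) _ x :=
    (hβ x.2).hasDerivAt.hasFDerivAt.comp x hasFDerivAt_snd
  have h3 : HasFDerivAt (tensor α β) _ x := h1.mul h2
  rw [pd, h3.fderiv]
  simp [tensor, dir]

section Tensor

variable {R : Rect} {α β : ℝ → ℝ}

theorem iterate_pd_tensor (hα : IsTest R.x0 R.x1 α) (hβ : IsTest R.y0 R.y1 β) (m n : ℕ) :
    (pd 0)^[m] ((pd 1)^[n] (tensor α β)) = tensor (deriv^[m] α) (deriv^[n] β) := by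
  have h1 : (pd 1)^[n] (tensor α β) = tensor α (deriv^[n] β) := by
    induction n with
    | zero => rfl
    | succ n ih =>
      rw [Function.iterate_succ_apply', ih, pd_one_tensor hα.differentiable
        (hβ.iterate n).differentiable, Function.iterate_succ_apply']
  rw [h1]
  induction m with
  | zero => rfl
  | succ m ih =>
    rw [Function.iterate_succ_apply', ih, pd_zero_tensor (hα.iterate m).differentiable
        (hβ.iterate n).differentiable, Function.iterate_succ_apply']

theorem continuous_tensor (hα : Continuous α) (hβ : Continuous β) : Continuous (tensor α β) :=
  (hα.comp continuous_fst).mul (hβ.comp continuous_snd)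

theorem tensor_eq_zero (hα : IsTest R.x0 R.x1 α) (hβ : IsTest R.y0 R.y1 β) {x : Plane}
    (hx : x ∉ interior R.carrier) : tensor α β x = 0 := by
  rw [Rect.interior_carrier] at hx
  by_cases h : x.1 ∈ Ioo R.x0 R.x1
  · rw [tensor, hβ.eq_zero fun h' => hx ⟨h, h'⟩, mul_zero]
  · rw [tensor, hα.eq_zero h, zero_mul]

theorem tsupport_tensor (hα : IsTest R.x0 R.x1 α) (hβ : IsTest R.y0 R.y1 β) :
    tsupport (tensor α β) ⊆ interior R.carrier := by
  have h1 : tsupport (tensor α β) ⊆ tsupport α ×ˢ tsupport β := by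
    refine closure_minimal (fun x hx => ?_) ((isClosed_tsupport _).prod (isClosed_tsupport _))
    rw [Function.mem_support, tensor] at hx
    exact ⟨subset_tsupport _ (left_ne_zero_of_mul hx), subset_tsupport _ (right_ne_zero_of_mul hx)⟩
  rw [R.interior_carrier]
  exact h1.trans (prod_mono hα.supp hβ.supp)

theorem contDiff_tensor (hα : IsTest R.x0 R.x1 α) (hβ : IsTest R.y0 R.y1 β) :
    ContDiff ℝ ((⊤ : ℕ∞) : WithTop ℕ∞) (tensor α β) :=
  (hα.smooth.comp contDiff_fst).mul (hβ.smooth.comp contDiff_snd)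

theorem hasCompactSupport_tensor (hα : IsTest R.x0 R.x1 α) (hβ : IsTest R.y0 R.y1 β) :
    HasCompactSupport (tensor α β) :=
  R.isCompact_carrier.of_isClosed_subset (isClosed_tsupport _)
    ((tsupport_tensor hα hβ).trans interior_subset)

theorem setIntegral_mul_tensor (hα : IsTest R.x0 R.x1 α) (hβ : IsTest R.y0 R.y1 β) {ω : Set Plane}
    (hR : interior R.carrier ⊆ ω) (u : Plane → ℝ) :
    ∫ x in ω, u x * tensor α β x = ∫ x in R.carrier, u x * tensor α β x := by
  have h : ∀ A : Set Plane, interior R.carrier ⊆ A →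
      ∫ x in A, u x * tensor α β x = ∫ x, u x * tensor α β x := fun A hA =>
    setIntegral_eq_integral_of_forall_compl_eq_zero fun x hx => by
      rw [tensor_eq_zero hα hβ fun h => hx (hA h), mul_zero]
  rw [h ω hR, h R.carrier interior_subset]

end Tensor

/-- `g` is the derivative of `U` of the given order when tested with products. -/
def IsTensorDeriv (R : Rect) (m n : ℕ) (U g : Plane → ℝ) : Prop :=
  ∀ α β : ℝ → ℝ, IsTest R.x0 R.x1 α → IsTest R.y0 R.y1 β →
    ∫ x in R.carrier, U x * tensor (deriv^[m] α) (deriv^[n] β) x =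
      (-1) ^ (m + n) * ∫ x in R.carrier, g x * tensor α β x

/-- Products of one-variable test functions suffice for the embedding below. Testing inside a single
rectangle also allows passing to the continuous representative. -/
theorem IsWeakDeriv.isTensorDeriv {ω : Set Plane} {R : Rect} (hR : interior R.carrier ⊆ ω)
    {m n : ℕ} {u g U : Plane → ℝ} (h : IsWeakDeriv ω m n u g)
    (hU : U =ᵐ[volume.restrict ω] u) : IsTensorDeriv R m n U g := by
  intro α β hα hβ
  have h1 := h.2.2 (tensor α β) (contDiff_tensor hα hβ) (hasCompactSupport_tensor hα hβ)
    ((tsupport_tensor hα hβ).trans hR)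
  rw [iterate_pd_tensor hα hβ, setIntegral_mul_tensor hα hβ hR] at h1
  rw [← h1, ← setIntegral_mul_tensor (hα.iterate m) (hβ.iterate n) hR]
  refine integral_congr_ae ?_
  filter_upwards [hU] with x hx
  rw [hx]

theorem abs_setIntegral_mul_le {A : Set Plane} (hA : MeasurableSet A) {g w : Plane → ℝ}
    (hg : IntegrableOn g A) {B : ℝ} (hw : ∀ x ∈ A, |w x| ≤ B) :
    |∫ x in A, g x * w x| ≤ B * ∫ x in A, |g x| := by
  rw [← integral_const_mul, ← Real.norm_eq_abs]
  refine norm_integral_le_of_norm_le (hg.abs.const_mul B) ?_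
  refine (ae_restrict_iff' hA).2 (Filter.Eventually.of_forall fun x hx => ?_)
  rw [Real.norm_eq_abs, abs_mul, mul_comm]
  exact mul_le_mul_of_nonneg_right (hw x hx) (abs_nonneg _)

/-- Mixed second derivatives control point values. -/
theorem exists_sup_le_of_tensorDeriv (R : Rect) :
    ∃ K : ℝ, 0 ≤ K ∧ ∀ (U g00 g10 g01 g11 : Plane → ℝ), ContinuousOn U R.carrier →
      IntegrableOn g00 R.carrier → IntegrableOn g10 R.carrier → IntegrableOn g01 R.carrier →
      IntegrableOn g11 R.carrier → IsTensorDeriv R 0 0 U g00 → IsTensorDeriv R 1 0 U g10 →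
      IsTensorDeriv R 0 1 U g01 → IsTensorDeriv R 1 1 U g11 → ∀ p ∈ R.carrier,
      |U p| ≤ K * ((∫ x in R.carrier, |g00 x|) + (∫ x in R.carrier, |g10 x|) +
        (∫ x in R.carrier, |g01 x|) + ∫ x in R.carrier, |g11 x|) := by
  -- Fixed reference densities of mass one in each variable. The final constant depends only on
  -- their maxima.
  obtain ⟨θ, hθ, hθ0, -, hθ1⟩ := IsTest.exists_mollifier (a := R.x0) (b := R.x1)
    (p := (R.x0 + R.x1) / 2) ⟨by linarith [R.hx], by linarith [R.hx]⟩ one_pos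
  obtain ⟨η, hη, hη0, -, hη1⟩ := IsTest.exists_mollifier (a := R.y0) (b := R.y1)
    (p := (R.y0 + R.y1) / 2) ⟨by linarith [R.hy], by linarith [R.hy]⟩ one_pos
  have hbound : ∀ {a b : ℝ} {f : ℝ → ℝ}, IsTest a b f → ∃ B, 0 ≤ B ∧ ∀ x ∈ Icc a b, |f x| ≤ B := by
    intro a b f hf
    obtain ⟨B, hB⟩ := isCompact_Icc.exists_bound_of_continuousOn (hf.continuous.continuousOn
      (s := Icc a b))
    exact ⟨max B 0, le_max_right _ _, fun x hx => (hB x hx).trans (le_max_left _ _)⟩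
  obtain ⟨B, hB0, hB⟩ := hbound hθ
  obtain ⟨D, hD0, hD⟩ := hbound hη
  refine ⟨B * D + 2 * D + 2 * B + 4, by positivity, ?_⟩
  intro U g00 g10 g01 g11 hU i00 i10 i01 i11 h00 h10 h01 h11
  set n00 := ∫ x in R.carrier, |g00 x|
  set n10 := ∫ x in R.carrier, |g10 x|
  set n01 := ∫ x in R.carrier, |g01 x|
  set n11 := ∫ x in R.carrier, |g11 x|
  have hn00 : 0 ≤ n00 := integral_nonneg fun x => abs_nonneg _
  have hn10 : 0 ≤ n10 := integral_nonneg fun x => abs_nonneg _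
  have hn01 : 0 ≤ n01 := integral_nonneg fun x => abs_nonneg _
  have hn11 : 0 ≤ n11 := integral_nonneg fun x => abs_nonneg _
  have hint : ∀ {α β : ℝ → ℝ}, Continuous α → Continuous β →
      IntegrableOn (fun x => U x * tensor α β x) R.carrier := fun hα hβ =>
    (hU.mul (continuous_tensor hα hβ).continuousOn).integrableOn_compact R.isCompact_carrier
  -- Any density of mass one differs from the reference by the derivative of a test function. This
  -- function is bounded by 1 + 1 = 2, however concentrated the density is.
  have prim : ∀ {a b : ℝ} {ρ θ : ℝ → ℝ}, a < b → IsTest a b ρ → IsTest a b θ → (∀ x, 0 ≤ ρ x) →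
      (∀ x, 0 ≤ θ x) → ∫ x in Icc a b, ρ x = 1 → ∫ x in Icc a b, θ x = 1 →
      ∃ α, IsTest a b α ∧ (∀ x, ρ x = deriv α x + θ x) ∧ ∀ x, |α x| ≤ 2 := by
    intro a b ρ θ hab hρ hθ hρ0 hθ0 hρ1 hθ1
    have iρ : IntegrableOn ρ (Icc a b) :=
      hρ.continuous.continuousOn.integrableOn_compact isCompact_Icc
    have iθ : IntegrableOn θ (Icc a b) :=
      hθ.continuous.continuousOn.integrableOn_compact isCompact_Icc
    obtain ⟨α, h1, h2, h3⟩ := IsTest.exists_primitive hab (hρ.sub hθ)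
      (by rw [integral_sub iρ iθ, hρ1, hθ1, sub_self])
    refine ⟨α, h1, fun x => by rw [h2]; ring, fun x => (h3 x).trans ?_⟩
    have : ∫ x in Icc a b, |ρ x - θ x| ≤ ∫ x in Icc a b, (ρ x + θ x) :=
      integral_mono (iρ.sub iθ).abs (iρ.add iθ) fun x => by
        refine (abs_sub _ _).trans ?_
        rw [abs_of_nonneg (hρ0 x), abs_of_nonneg (hθ0 x)]
    rw [integral_add iρ iθ, hρ1, hθ1] at this
    linarith
  have hint_pt : ∀ p ∈ interior R.carrier, |U p| ≤ (B * D + 2 * D + 2 * B + 4) *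
      (n00 + n10 + n01 + n11) := by
    intro p hp
    refine le_of_forall_pos_le_add fun e he => ?_
    have hUp : ContinuousAt U p := hU.continuousAt (mem_interior_iff_mem_nhds.1 hp)
    obtain ⟨ε, hε, hεU⟩ := Metric.continuousAt_iff.1 hUp e he
    rw [Rect.interior_carrier] at hp
    obtain ⟨ρ, hρ, hρ0, hρs, hρ1⟩ := IsTest.exists_mollifier hp.1 hε
    obtain ⟨τ, hτ, hτ0, hτs, hτ1⟩ := IsTest.exists_mollifier hp.2 hε
    obtain ⟨α, hα, hαd, hα2⟩ := prim R.hx hρ hθ hρ0 hθ0 hρ1 hθ1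
    obtain ⟨β, hβ, hβd, hβ2⟩ := prim R.hy hτ hη hτ0 hη0 hτ1 hη1
    have e11 := h11 α β hα hβ
    have e10 := h10 α η hα hη
    have e01 := h01 θ β hθ hβ
    have e00 := h00 θ η hθ hη
    simp only [Function.iterate_one, Function.iterate_zero, id_eq] at e11 e10 e01 e00
    -- Expanding (α' + θ)(β' + η) moves every derivative onto `U`. The four factors left over are
    -- bounded uniformly as the mollifiers concentrate at the point.
    have hsplit : ∫ x in R.carrier, U x * tensor ρ τ x =
        (∫ x in R.carrier, g11 x * tensor α β x) - (∫ x in R.carrier, g10 x * tensor α η x)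
        - (∫ x in R.carrier, g01 x * tensor θ β x) + ∫ x in R.carrier, g00 x * tensor θ η x := by
      have hpt : ∀ x, U x * tensor ρ τ x = ((U x * tensor (deriv α) (deriv β) x +
          U x * tensor (deriv α) η x) + U x * tensor θ (deriv β) x) + U x * tensor θ η x := by
        intro x; simp only [tensor]; rw [hαd, hβd]; ring
      simp_rw [hpt]
      have j1 := hint hα.deriv.continuous hβ.deriv.continuous
      have j2 := hint hα.deriv.continuous hη.continuous
      have j3 := hint hθ.continuous hβ.deriv.continuous
      have j4 := hint hθ.continuous hη.continuous
      have j12 : IntegrableOn (fun x => U x * tensor (deriv α) (deriv β) x +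
          U x * tensor (deriv α) η x) R.carrier := j1.add j2
      have j123 : IntegrableOn (fun x => U x * tensor (deriv α) (deriv β) x +
          U x * tensor (deriv α) η x + U x * tensor θ (deriv β) x) R.carrier := j12.add j3
      rw [integral_add j123 j4, integral_add j12 j3, integral_add j1 j2, e11, e10, e01, e00]
      ring
    have hconv : |U p - ∫ x in R.carrier, U x * tensor ρ τ x| ≤ e := by
      have h1 : ∫ x in R.carrier, tensor ρ τ x = 1 := by
        have := setIntegral_prod_mul (μ := (volume : Measure ℝ)) (ν := (volume : Measure ℝ))
          ρ τ (Icc R.x0 R.x1) (Icc R.y0 R.y1)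
        rw [hρ1, hτ1, ← Measure.volume_eq_prod, one_mul] at this
        exact this
      have i1 : IntegrableOn (tensor ρ τ) R.carrier :=
        (continuous_tensor hρ.continuous hτ.continuous).continuousOn.integrableOn_compact
          R.isCompact_carrier
      have h2 : U p - ∫ x in R.carrier, U x * tensor ρ τ x =
          ∫ x in R.carrier, (U p * tensor ρ τ x - U x * tensor ρ τ x) := by
        rw [integral_sub (i1.const_mul _) (hint hρ.continuous hτ.continuous), integral_const_mul,
          h1, mul_one]
      rw [h2]
      have h3 : ∫ x in R.carrier, e * tensor ρ τ x = e := by rw [integral_const_mul, h1, mul_one]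
      rw [← h3, ← Real.norm_eq_abs]
      refine norm_integral_le_of_norm_le (i1.const_mul e) (Filter.Eventually.of_forall fun x => ?_)
      have hnn : 0 ≤ tensor ρ τ x := mul_nonneg (hρ0 _) (hτ0 _)
      rw [← sub_mul, Real.norm_eq_abs, abs_mul, abs_of_nonneg hnn]
      by_cases hx : tensor ρ τ x = 0
      · rw [hx, mul_zero, mul_zero]
      · refine mul_le_mul_of_nonneg_right ?_ hnn
        rw [tensor] at hx
        have hd : dist x p < ε := by
          rw [Prod.dist_eq, max_lt_iff, Real.dist_eq, Real.dist_eq]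
          exact ⟨hρs _ (left_ne_zero_of_mul hx), hτs _ (right_ne_zero_of_mul hx)⟩
        have := hεU hd
        rw [dist_comm, Real.dist_eq] at this
        exact this.le
    have hm := R.measurableSet_carrier
    have b11 : |∫ x in R.carrier, g11 x * tensor α β x| ≤ 4 * n11 :=
      abs_setIntegral_mul_le hm i11 fun x _ => by
        rw [tensor, abs_mul]
        nlinarith [hα2 x.1, hβ2 x.2, abs_nonneg (α x.1), abs_nonneg (β x.2)]
    have b10 : |∫ x in R.carrier, g10 x * tensor α η x| ≤ (2 * D) * n10 :=
      abs_setIntegral_mul_le hm i10 fun x hx => by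
        rw [tensor, abs_mul]
        exact mul_le_mul (hα2 _) (hD _ hx.2) (abs_nonneg _) zero_le_two
    have b01 : |∫ x in R.carrier, g01 x * tensor θ β x| ≤ (B * 2) * n01 :=
      abs_setIntegral_mul_le hm i01 fun x hx => by
        rw [tensor, abs_mul]
        exact mul_le_mul (hB _ hx.1) (hβ2 _) (abs_nonneg _) hB0
    have b00 : |∫ x in R.carrier, g00 x * tensor θ η x| ≤ (B * D) * n00 :=
      abs_setIntegral_mul_le hm i00 fun x hx => by
        rw [tensor, abs_mul]
        exact mul_le_mul (hB _ hx.1) (hD _ hx.2) (abs_nonneg _) hB0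
    rw [hsplit] at hconv
    have htot : |U p| ≤ e + (4 * n11 + 2 * D * n10 + B * 2 * n01 + B * D * n00) := by
      rw [abs_le] at *
      constructor <;> linarith [hconv.1, hconv.2, b11.1, b11.2, b10.1, b10.2, b01.1, b01.2,
        b00.1, b00.2]
    have : 4 * n11 + 2 * D * n10 + B * 2 * n01 + B * D * n00 ≤
        (B * D + 2 * D + 2 * B + 4) * (n00 + n10 + n01 + n11) := by
      have hBD := mul_nonneg hB0 hD0
      nlinarith [mul_nonneg hBD hn10, mul_nonneg hBD hn01, mul_nonneg hBD hn11,
        mul_nonneg hD0 hn00, mul_nonneg hD0 hn01, mul_nonneg hD0 hn11, mul_nonneg hB0 hn00,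
        mul_nonneg hB0 hn10, mul_nonneg hB0 hn11]
    linarith
  intro p hp
  have hcl := hU.abs.preimage_isClosed_of_isClosed R.isClosed_carrier
    (isClosed_Iic (a := (B * D + 2 * D + 2 * B + 4) * (n00 + n10 + n01 + n11)))
  rw [← R.closure_interior] at hp
  exact (closure_minimal (fun x hx => mem_inter (interior_subset hx) (hint_pt x hx)) hcl hp).2

/-! ### Sobolev bounds for boundary data -/

/-- `g` is square integrable on `ω` with norm at most `M`. -/
def L2Bound (ω : Set Plane) (M : ℝ) (g : Plane → ℝ) : Prop :=
  MemLp g 2 (volume.restrict ω) ∧ ∫ x in ω, g x ^ 2 ≤ M ^ 2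

/-- The norm is built from chosen weak derivatives, and the chosen one is the witness. Its square
integral is a single summand of the squared norm. -/
theorem exists_weakDeriv_bound {ι : Type} [Fintype ι] {ω : Set Plane} {k : ℕ}
    {u : ι → Plane → ℝ} {M : ℝ} (hu : ∀ m, MemH ω k (u m)) (hM : normH ω k u ≤ M) (m : ι)
    {a b : ℕ} (hab : a + b ≤ k) : ∃ g, L2Bound ω M g ∧ IsWeakDeriv ω a b (u m) g := by
  have hex := hu m a b hab
  have hw : weakDeriv ω a b (u m) = hex.choose := dif_pos hex
  refine ⟨weakDeriv ω a b (u m), ⟨?_, ?_⟩, ?_⟩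
  · rw [hw]; exact hex.choose_spec.1
  · have hnn : ∀ m a b, 0 ≤ ∫ x in ω, weakDeriv ω a b (u m) x ^ 2 :=
      fun m a b => integral_nonneg fun x => sq_nonneg _
    have h1 : ∫ x in ω, weakDeriv ω a b (u m) x ^ 2 ≤ ∑ m, ∑ a ∈ Finset.range (k + 1),
        ∑ b ∈ Finset.range (k + 1 - a), ∫ x in ω, weakDeriv ω a b (u m) x ^ 2 := by
      have s1 := Finset.single_le_sum (f := fun b => ∫ x in ω, weakDeriv ω a b (u m) x ^ 2)
        (s := Finset.range (k + 1 - a)) (fun b _ => hnn m a b)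
        (show b ∈ _ by rw [Finset.mem_range]; omega)
      have s2 := Finset.single_le_sum (f := fun a => ∑ b ∈ Finset.range (k + 1 - a),
        ∫ x in ω, weakDeriv ω a b (u m) x ^ 2) (s := Finset.range (k + 1))
        (fun a _ => Finset.sum_nonneg fun b _ => hnn m a b)
        (show a ∈ _ by rw [Finset.mem_range]; omega)
      have s3 := Finset.single_le_sum (f := fun m => ∑ a ∈ Finset.range (k + 1),
        ∑ b ∈ Finset.range (k + 1 - a), ∫ x in ω, weakDeriv ω a b (u m) x ^ 2)
        (s := Finset.univ) (fun m _ => Finset.sum_nonneg fun a _ => Finset.sum_nonneg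
          fun b _ => hnn m a b) (Finset.mem_univ m)
      exact s1.trans (s2.trans s3)
    refine h1.trans ?_
    rw [normH] at hM
    have h0 := (Real.sqrt_nonneg _).trans hM
    exact (Real.sqrt_le_left h0).1 hM
  · rw [hw]; exact hex.choose_spec.2

theorem L2Bound.integrableOn_rect {ω : Set Plane} {M : ℝ} (hM : 0 ≤ M) {g : Plane → ℝ}
    (h : L2Bound ω M g) {R : Rect} (hR : interior R.carrier ⊆ ω) :
    IntegrableOn g R.carrier ∧ ∫ x in R.carrier, |g x| ≤ Real.sqrt R.area * M := by
  have hfin : volume (interior R.carrier) ≠ ∞ := by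
    rw [R.volume_interior]; exact R.isCompact_carrier.measure_lt_top.ne
  have : IsFiniteMeasure (volume.restrict (interior R.carrier)) := ⟨by simpa using hfin.lt_top⟩
  have h2 : MemLp g 2 (volume.restrict (interior R.carrier)) :=
    h.1.mono_measure (Measure.restrict_mono hR le_rfl)
  have i1 : IntegrableOn g (interior R.carrier) := h2.integrable one_le_two
  have i2 : IntegrableOn (fun x => g x ^ 2) (interior R.carrier) := h2.integrable_sq
  refine ⟨i1.congr_set_ae R.interior_ae_eq.symm, ?_⟩
  rw [← setIntegral_congr_set R.interior_ae_eq]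
  have h3 := sq_setIntegral_le hfin i1.abs (by simpa only [sq_abs] using i2)
  simp only [sq_abs] at h3
  have h4 : ∫ x in interior R.carrier, g x ^ 2 ≤ M ^ 2 :=
    (setIntegral_mono_set h.1.integrable_sq (Filter.Eventually.of_forall fun x => sq_nonneg _)
      hR.eventuallyLE).trans h.2
  have h5 : volume.real (interior R.carrier) = R.area := by
    rw [Measure.real, R.volume_interior]; exact R.volume_real_carrier
  rw [h5] at h3
  have ha := R.area_pos.le
  refine abs_le_of_sq_le_sq' ?_ (by positivity) |>.2
  rw [mul_pow, Real.sq_sqrt ha]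
  exact h3.trans (mul_le_mul_of_nonneg_left h4 ha)

/-- The orders (0,0), (1,0), (0,1) and (1,1) are all that is needed. Their total order is at most
two, which is why two derivatives in L² bound the values. -/
theorem exists_sup_le_of_L2Bound (R : Rect) : ∃ K : ℝ, 0 ≤ K ∧
    ∀ (ω : Set Plane) (U : Plane → ℝ) (M : ℝ), interior R.carrier ⊆ ω → ContinuousOn U R.carrier →
      0 ≤ M → (∀ m n : ℕ, m ≤ 1 → n ≤ 1 → ∃ g, L2Bound ω M g ∧ IsTensorDeriv R m n U g) →
      ∀ p ∈ R.carrier, |U p| ≤ K * M := by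
  obtain ⟨K, hK, h⟩ := exists_sup_le_of_tensorDeriv R
  refine ⟨K * (4 * Real.sqrt R.area), by positivity, fun ω U M hR hU hM hg p hp => ?_⟩
  obtain ⟨g00, a00, b00⟩ := hg 0 0 zero_le_one zero_le_one
  obtain ⟨g10, a10, b10⟩ := hg 1 0 le_rfl zero_le_one
  obtain ⟨g01, a01, b01⟩ := hg 0 1 zero_le_one le_rfl
  obtain ⟨g11, a11, b11⟩ := hg 1 1 le_rfl le_rfl
  have c00 := a00.integrableOn_rect hM hR
  have c10 := a10.integrableOn_rect hM hR
  have c01 := a01.integrableOn_rect hM hR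
  have c11 := a11.integrableOn_rect hM hR
  refine (h U g00 g10 g01 g11 hU c00.1 c10.1 c01.1 c11.1 b00 b10 b01 b11 p hp).trans ?_
  rw [mul_assoc]
  refine mul_le_mul_of_nonneg_left ?_ hK
  linarith [c00.2, c10.2, c01.2, c11.2]

/-- Integration by parts on horizontal lines; the boundary terms vanish with the test function. -/
theorem setIntegral_pdOn_zero_mul_tensor {R : Rect} {u : Plane → ℝ} (hu : ContDiffOn ℝ 1 u R.carrier)
    {α β : ℝ → ℝ} (hα : IsTest R.x0 R.x1 α) (hβ : IsTest R.y0 R.y1 β) :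
    ∫ x in R.carrier, pdOn 0 R u x * tensor α β x =
      -∫ x in R.carrier, u x * tensor (deriv α) β x := by
  have i1 : IntegrableOn (fun x => pdOn 0 R u x * tensor α β x) R.carrier :=
    ((continuousOn_pdOn hu 0).mul (continuous_tensor hα.continuous
      hβ.continuous).continuousOn).integrableOn_compact R.isCompact_carrier
  have i2 : IntegrableOn (fun x => u x * tensor (deriv α) β x) R.carrier :=
    (hu.continuousOn.mul (continuous_tensor hα.deriv.continuous
      hβ.continuous).continuousOn).integrableOn_compact R.isCompact_carrier
  have i3 : IntegrableOn (fun x => pdOn 0 R u x * tensor α β x + u x * tensor (deriv α) β x)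
      R.carrier := i1.add i2
  rw [eq_neg_iff_add_eq_zero, ← integral_add i1 i2]
  rw [Rect.carrier, setIntegral_prod_symm i3]
  refine (setIntegral_congr_fun measurableSet_Icc fun t ht => ?_).trans (integral_zero _ _)
  have hc1 : ContinuousOn (fun s => pdOn 0 R u (s, t)) (Icc R.x0 R.x1) :=
    (continuousOn_pdOn hu 0).comp (by fun_prop) fun s hs => ⟨hs, ht⟩
  have hc2 : ContinuousOn (fun s => u (s, t)) (Icc R.x0 R.x1) :=
    hu.continuousOn.comp (by fun_prop) fun s hs => ⟨hs, ht⟩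
  have hc3 : ContinuousOn (fun s => pdOn 0 R u (s, t) * tensor α β (s, t) +
      u (s, t) * tensor (deriv α) β (s, t)) (Icc R.x0 R.x1) :=
    (hc1.mul ((continuous_tensor hα.continuous hβ.continuous).comp
      (Continuous.prodMk_left t)).continuousOn).add (hc2.mul ((continuous_tensor
      hα.deriv.continuous hβ.continuous).comp (Continuous.prodMk_left t)).continuousOn)
  have := intervalIntegral.integral_eq_sub_of_hasDerivAt_of_le R.hx.le
    (f := fun s => u (s, t) * (α s * β t))
    (hc2.mul ((hα.continuous.mul continuous_const).continuousOn))
    (f' := fun s => pdOn 0 R u (s, t) * tensor α β (s, t) +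
      u (s, t) * tensor (deriv α) β (s, t)) (fun s hs => ?_)
    ((intervalIntegrable_iff_integrableOn_Icc_of_le R.hx.le).2
      (hc3.integrableOn_compact isCompact_Icc))
  · rw [intervalIntegral.integral_of_le R.hx.le, ← integral_Icc_eq_integral_Ioc,
      hα.eq_zero (x := R.x0) (by simp), hα.eq_zero (x := R.x1) (by simp)] at this
    simpa using this
  · have hsm : ((s, t) : Plane) ∈ R.carrier := ⟨Ioo_subset_Icc_self hs, ht⟩
    have h1 := (hasDerivWithinAt_fst hsm
      (hu.differentiableOn one_ne_zero _ hsm)).hasDerivAt (Icc_mem_nhds hs.1 hs.2)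
    exact h1.mul ((hα.differentiable s).hasDerivAt.mul_const (β t))

theorem setIntegral_pdOn_one_mul_tensor {R : Rect} {u : Plane → ℝ} (hu : ContDiffOn ℝ 1 u R.carrier)
    {α β : ℝ → ℝ} (hα : IsTest R.x0 R.x1 α) (hβ : IsTest R.y0 R.y1 β) :
    ∫ x in R.carrier, pdOn 1 R u x * tensor α β x =
      -∫ x in R.carrier, u x * tensor α (deriv β) x := by
  have i1 : IntegrableOn (fun x => pdOn 1 R u x * tensor α β x) R.carrier :=
    ((continuousOn_pdOn hu 1).mul (continuous_tensor hα.continuous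
      hβ.continuous).continuousOn).integrableOn_compact R.isCompact_carrier
  have i2 : IntegrableOn (fun x => u x * tensor α (deriv β) x) R.carrier :=
    (hu.continuousOn.mul (continuous_tensor hα.continuous
      hβ.deriv.continuous).continuousOn).integrableOn_compact R.isCompact_carrier
  have i3 : IntegrableOn (fun x => pdOn 1 R u x * tensor α β x + u x * tensor α (deriv β) x)
      R.carrier := i1.add i2
  rw [eq_neg_iff_add_eq_zero, ← integral_add i1 i2]
  rw [Rect.carrier, Measure.volume_eq_prod, setIntegral_prod _ i3]
  refine (setIntegral_congr_fun measurableSet_Icc fun t ht => ?_).trans (integral_zero _ _)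
  have hc1 : ContinuousOn (fun s => pdOn 1 R u (t, s)) (Icc R.y0 R.y1) :=
    (continuousOn_pdOn hu 1).comp (by fun_prop) fun s hs => ⟨ht, hs⟩
  have hc2 : ContinuousOn (fun s => u (t, s)) (Icc R.y0 R.y1) :=
    hu.continuousOn.comp (by fun_prop) fun s hs => ⟨ht, hs⟩
  have hc3 : ContinuousOn (fun s => pdOn 1 R u (t, s) * tensor α β (t, s) +
      u (t, s) * tensor α (deriv β) (t, s)) (Icc R.y0 R.y1) :=
    (hc1.mul ((continuous_tensor hα.continuous hβ.continuous).comp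
      (Continuous.prodMk_right t)).continuousOn).add (hc2.mul ((continuous_tensor
      hα.continuous hβ.deriv.continuous).comp (Continuous.prodMk_right t)).continuousOn)
  have := intervalIntegral.integral_eq_sub_of_hasDerivAt_of_le R.hy.le
    (f := fun s => u (t, s) * (α t * β s))
    (hc2.mul ((continuous_const.mul hβ.continuous).continuousOn))
    (f' := fun s => pdOn 1 R u (t, s) * tensor α β (t, s) +
      u (t, s) * tensor α (deriv β) (t, s)) (fun s hs => ?_)
    ((intervalIntegrable_iff_integrableOn_Icc_of_le R.hy.le).2
      (hc3.integrableOn_compact isCompact_Icc))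
  · rw [intervalIntegral.integral_of_le R.hy.le, ← integral_Icc_eq_integral_Ioc,
      hβ.eq_zero (x := R.y0) (by simp), hβ.eq_zero (x := R.y1) (by simp)] at this
    simpa using this
  · have hsm : ((t, s) : Plane) ∈ R.carrier := ⟨ht, Ioo_subset_Icc_self hs⟩
    have h1 := (hasDerivWithinAt_snd hsm
      (hu.differentiableOn one_ne_zero _ hsm)).hasDerivAt (Icc_mem_nhds hs.1 hs.2)
    exact h1.mul ((hβ.differentiable s).hasDerivAt.const_mul (α t))

/-- Trades one order of differentiation of the function for its elementwise partial derivative, so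
the sup bound applies to gradients. The sign of the integration by parts matches the change of
order. -/
theorem IsTensorDeriv.pdOn_zero {R : Rect} {u g : Plane → ℝ} (hu : ContDiffOn ℝ 1 u R.carrier)
    {m n : ℕ} (h : IsTensorDeriv R (m + 1) n u g) : IsTensorDeriv R m n (pdOn 0 R u) g := by
  intro α β hα hβ
  have h1 := h α β hα hβ
  rw [Function.iterate_succ_apply'] at h1
  rw [setIntegral_pdOn_zero_mul_tensor hu (hα.iterate m) (hβ.iterate n), h1]
  ring

theorem IsTensorDeriv.pdOn_one {R : Rect} {u g : Plane → ℝ} (hu : ContDiffOn ℝ 1 u R.carrier)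
    {m n : ℕ} (h : IsTensorDeriv R m (n + 1) u g) : IsTensorDeriv R m n (pdOn 1 R u) g := by
  intro α β hα hβ
  have h1 := h α β hα hβ
  rw [Function.iterate_succ_apply'] at h1
  rw [setIntegral_pdOn_one_mul_tensor hu (hα.iterate m) (hβ.iterate n), h1]
  ring

/-- The embedding constant depends on the rectangle. Summing over a finite partition gives a single
constant for all of its elements. -/
theorem IsConformingMesh.exists_const_rect {ω : Set Plane} {𝒯 : Finset Rect}
    (h : IsConformingMesh ω 𝒯) (hω : interior (closure ω) = ω) : ∃ K : ℝ, 0 ≤ K ∧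
      ∀ R ∈ 𝒯, ∀ (U : Plane → ℝ) (M : ℝ), ContinuousOn U R.carrier → 0 ≤ M →
        (∀ m n : ℕ, m ≤ 1 → n ≤ 1 → ∃ g, L2Bound ω M g ∧ IsTensorDeriv R m n U g) →
        ∀ p ∈ R.carrier, |U p| ≤ K * M := by
  choose K hK hsup using exists_sup_le_of_L2Bound
  refine ⟨∑ R ∈ 𝒯, K R, Finset.sum_nonneg fun R _ => hK R, ?_⟩
  intro R hR U M hU hM hg p hp
  refine (hsup R ω U M (h.interior_carrier_subset hω hR) hU hM hg p hp).trans
    (mul_le_mul_of_nonneg_right ?_ hM)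
  exact Finset.single_le_sum (f := K) (fun R _ => hK R) hR

/-- Functions with two weak derivatives in `L²` are bounded. -/
theorem IsConformingMesh.exists_sup_bound {ω : Set Plane} {𝒯 : Finset Rect}
    (h : IsConformingMesh ω 𝒯) (hω : interior (closure ω) = ω) : ∃ K : ℝ, 0 ≤ K ∧
      ∀ (U u : Plane → ℝ) (M : ℝ), ContinuousOn U (closure ω) → U =ᵐ[volume.restrict ω] u →
        0 ≤ M → (∀ m n : ℕ, m + n ≤ 2 → ∃ g, L2Bound ω M g ∧ IsWeakDeriv ω m n u g) →
        ∀ p ∈ closure ω, |U p| ≤ K * M := by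
  obtain ⟨K, hK, hsup⟩ := h.exists_const_rect hω
  refine ⟨K, hK, fun U u M hU hae hM hg p hp => ?_⟩
  obtain ⟨R, hR, hpR⟩ := h.exists_mem hp
  refine hsup R hR U M (hU.mono (h.carrier_subset hR)) hM (fun m n hm hn => ?_) p hpR
  obtain ⟨g, hg1, hg2⟩ := hg m n (by omega)
  exact ⟨g, hg1, hg2.isTensorDeriv (h.interior_carrier_subset hω hR) hae⟩

/-- Functions with three weak derivatives in `L²` have bounded gradients. -/
theorem IsConformingMesh.exists_grad_bound {ω : Set Plane} {𝒯 : Finset Rect}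
    (h : IsConformingMesh ω 𝒯) (hω : interior (closure ω) = ω) : ∃ K : ℝ, 0 ≤ K ∧
      ∀ (U u : Plane → ℝ) (M : ℝ), ContDiffOn ℝ 1 U (closure ω) → U =ᵐ[volume.restrict ω] u →
        0 ≤ M → (∀ m n : ℕ, m + n ≤ 3 → ∃ g, L2Bound ω M g ∧ IsWeakDeriv ω m n u g) →
        ∀ (i : Fin 2) (T : Rect), T.carrier ⊆ closure ω → ∀ p ∈ T.carrier,
          |pdOn i T U p| ≤ K * M := by
  obtain ⟨K, hK, hsup⟩ := h.exists_const_rect hω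
  refine ⟨K, hK, fun U u M hU hae hM hg i T hT => ?_⟩
  have hopen : IsOpen ω := hω ▸ isOpen_interior
  -- The bound is first obtained on the elements of the reference partition, where the constant is
  -- available.
  have href : ∀ R ∈ 𝒯, ∀ p ∈ R.carrier, |pdOn i R U p| ≤ K * M := by
    intro R hR
    have hUR := hU.mono (h.carrier_subset hR)
    refine hsup R hR _ M (continuousOn_pdOn hUR i) hM fun m n hm hn => ?_
    fin_cases i
    · obtain ⟨g, hg1, hg2⟩ := hg (m + 1) n (by omega)
      exact ⟨g, hg1, (hg2.isTensorDeriv (h.interior_carrier_subset hω hR) hae).pdOn_zero hUR⟩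
    · obtain ⟨g, hg1, hg2⟩ := hg m (n + 1) (by omega)
      exact ⟨g, hg1, (hg2.isTensorDeriv (h.interior_carrier_subset hω hR) hae).pdOn_one hUR⟩
  -- At points of the open domain the one-sided derivative is the ordinary one and does not depend
  -- on the rectangle. This transfers the bound to interior points of an arbitrary `T`; continuity
  -- reaches the boundary of `T`.
  have hfd : ∀ (R : Rect) (p : Plane), p ∈ R.carrier → p ∈ ω →
      pdOn i R U p = fderiv ℝ U p (dir i) := by
    intro R p hpR hpω
    have hd : DifferentiableAt ℝ U p := ((hU.mono subset_closure).differentiableOn one_ne_zero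
      p hpω).differentiableAt (hopen.mem_nhds hpω)
    rw [pdOn, hd.fderivWithin (R.uniqueDiffOn p hpR)]
  have hTi : interior T.carrier ⊆ ω := by
    conv_rhs => rw [← hω]
    exact interior_mono hT
  have hcl := (continuousOn_pdOn (ContDiffOn.mono hU hT) i).abs.preimage_isClosed_of_isClosed
    T.isClosed_carrier (isClosed_Iic (a := K * M))
  intro p hp
  rw [← T.closure_interior] at hp
  refine (closure_minimal (fun x hx => Set.mem_inter (interior_subset hx) ?_) hcl hp).2
  have hxω := hTi hx
  obtain ⟨R, hR, hxR⟩ := h.exists_mem (subset_closure hxω)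
  rw [mem_preimage, mem_Iic, hfd T x (interior_subset hx) hxω, ← hfd R x hxR hxω]
  exact href R hR x hxR

/-! ### Inverse estimates -/

/-- Quadratic polynomials in one variable as functions. -/
def quadFun : Submodule ℝ (ℝ → ℝ) where
  carrier := {p | ∃ A B C : ℝ, ∀ s, p s = A + B * s + C * s ^ 2}
  add_mem' := by
    rintro p q ⟨A, B, C, h⟩ ⟨A', B', C', h'⟩
    exact ⟨A + A', B + B', C + C', fun s => by rw [Pi.add_apply, h, h']; ring⟩
  zero_mem' := ⟨0, 0, 0, fun s => by simp⟩
  smul_mem' := by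
    rintro c p ⟨A, B, C, h⟩
    exact ⟨c * A, c * B, c * C, fun s => by rw [Pi.smul_apply, smul_eq_mul, h]; ring⟩

theorem quadFun_comp_affine {p : ℝ → ℝ} (hp : p ∈ quadFun) (c l : ℝ) :
    (fun s => p ((s - c) / l)) ∈ quadFun := by
  obtain ⟨A, B, C, h⟩ := hp
  refine ⟨A - B * c / l + C * c ^ 2 / l ^ 2, B / l - 2 * C * c / l ^ 2, C / l ^ 2, fun s => ?_⟩
  simp only [h, div_pow]
  ring

theorem quadFun_lagrange {p : ℝ → ℝ} (hp : p ∈ quadFun) (c l s : ℝ) :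
    p (c + s * l) = ∑ a : Fin 3, quadShape a s * p (c + ((a : ℕ) : ℝ) / 2 * l) := by
  obtain ⟨A, B, C, h⟩ := hp
  have h0 : quadShape 0 s = (1 - s) * (1 - 2 * s) := by simp [quadShape]
  have h1 : quadShape 1 s = 4 * s * (1 - s) := by simp [quadShape]
  have h2 : quadShape 2 s = s * (2 * s - 1) := by simp [quadShape]
  simp only [Fin.sum_univ_three, h0, h1, h2, h]
  norm_num
  ring

theorem setIntegral_quadratic_sq {c d : ℝ} (hcd : c ≤ d) (A B C : ℝ) :
    ∫ s in Icc c d, (A + B * s + C * s ^ 2) ^ 2 =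
      A ^ 2 * (d - c) + A * B * (d ^ 2 - c ^ 2) + (B ^ 2 + 2 * A * C) * (d ^ 3 - c ^ 3) / 3
        + B * C * (d ^ 4 - c ^ 4) / 2 + C ^ 2 * (d ^ 5 - c ^ 5) / 5 := by
  rw [integral_Icc_eq_integral_Ioc, ← intervalIntegral.integral_of_le hcd]
  have hd : ∀ s ∈ uIcc c d, HasDerivAt (fun s : ℝ => A ^ 2 * s + A * B * s ^ 2
      + (B ^ 2 + 2 * A * C) * s ^ 3 / 3 + B * C * s ^ 4 / 2 + C ^ 2 * s ^ 5 / 5)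
      ((A + B * s + C * s ^ 2) ^ 2) s := by
    intro s _
    have h1 := (hasDerivAt_id s).const_mul (A ^ 2)
    have h2 := (hasDerivAt_pow 2 s).const_mul (A * B)
    have h3 := ((hasDerivAt_pow 3 s).const_mul (B ^ 2 + 2 * A * C)).div_const 3
    have h4 := ((hasDerivAt_pow 4 s).const_mul (B * C)).div_const 2
    have h5 := ((hasDerivAt_pow 5 s).const_mul (C ^ 2)).div_const 5
    refine ((((h1.add h2).add h3).add h4).add h5).congr_deriv ?_
    norm_num
    ring
  rw [intervalIntegral.integral_eq_sub_of_hasDerivAt hd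
    (Continuous.intervalIntegrable (by fun_prop) _ _)]
  ring

/-- Expansion in Legendre polynomials on the interval: they are bounded by one and orthogonal, with
mean squares 1, 1/3 and 1/5. Cauchy–Schwarz gives the constant 1 + 3 + 5 = 9. -/
theorem sq_le_of_mem_quadFun {p : ℝ → ℝ} (hp : p ∈ quadFun) {c d t : ℝ} (hcd : c < d)
    (ht : t ∈ Icc c d) : (d - c) * p t ^ 2 ≤ 9 * ∫ s in Icc c d, p s ^ 2 := by
  obtain ⟨A, B, C, h⟩ := hp
  simp only [h]
  rw [setIntegral_quadratic_sq hcd.le]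
  obtain ⟨l, rfl⟩ : ∃ l, d = c + l := ⟨d - c, by ring⟩
  obtain ⟨r', rfl⟩ : ∃ r', t = c + r' := ⟨t - c, by ring⟩
  have hl : 0 < l := by linarith
  obtain ⟨r, rfl⟩ : ∃ r, r' = l * r := ⟨r' / l, by field_simp⟩
  have hr0 : 0 ≤ r := nonneg_of_mul_nonneg_right (by linarith [ht.1]) hl
  have hr1 : r ≤ 1 := le_of_mul_le_mul_left (by linarith [ht.2]) hl
  -- Coefficients for the shifted Legendre polynomials 1, 2r - 1 and 6r² - 6r + 1 on the unit
  -- interval.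
  obtain ⟨a2, ha2⟩ : ∃ a2, a2 = C * l ^ 2 / 6 := ⟨_, rfl⟩
  obtain ⟨a1, ha1⟩ : ∃ a1, a1 = ((B + 2 * C * c) * l + C * l ^ 2) / 2 := ⟨_, rfl⟩
  obtain ⟨a0, ha0⟩ : ∃ a0, a0 = (A + B * c + C * c ^ 2) + (B + 2 * C * c) * l / 2
    + C * l ^ 2 / 3 := ⟨_, rfl⟩
  have hp : A + B * (c + l * r) + C * (c + l * r) ^ 2 = a0 + a1 * (2 * r - 1) + a2 * (6 * r ^ 2 - 6 * r + 1) := by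
    rw [ha0, ha1, ha2]; ring
  have hint : A ^ 2 * (c + l - c) + A * B * ((c + l) ^ 2 - c ^ 2)
        + (B ^ 2 + 2 * A * C) * ((c + l) ^ 3 - c ^ 3) / 3
        + B * C * ((c + l) ^ 4 - c ^ 4) / 2 + C ^ 2 * ((c + l) ^ 5 - c ^ 5) / 5
      = l * (a0 ^ 2 + a1 ^ 2 / 3 + a2 ^ 2 / 5) := by
    rw [ha0, ha1, ha2]; ring
  rw [hp, hint, add_sub_cancel_left]
  have habs : |a0 + a1 * (2 * r - 1) + a2 * (6 * r ^ 2 - 6 * r + 1)| ≤ |a0| + |a1| + |a2| := by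
    refine (abs_add_three _ _ _).trans ?_
    rw [abs_mul, abs_mul]
    have e1 : |2 * r - 1| ≤ 1 := abs_le.2 ⟨by linarith, by linarith⟩
    have e2 : |6 * r ^ 2 - 6 * r + 1| ≤ 1 := abs_le.2 ⟨by nlinarith [sq_nonneg (2 * r - 1)],
      by nlinarith⟩
    have := mul_le_mul_of_nonneg_left e1 (abs_nonneg a1)
    have := mul_le_mul_of_nonneg_left e2 (abs_nonneg a2)
    linarith
  have hsq : (a0 + a1 * (2 * r - 1) + a2 * (6 * r ^ 2 - 6 * r + 1)) ^ 2 ≤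
      9 * (a0 ^ 2 + a1 ^ 2 / 3 + a2 ^ 2 / 5) := by
    rw [← sq_abs]
    refine (pow_le_pow_left₀ (abs_nonneg _) habs 2).trans ?_
    rw [← sq_abs a0, ← sq_abs a1, ← sq_abs a2]
    -- With weights 1/3, 1/5 and 1/15 these squares add up exactly to the Cauchy–Schwarz defect.
    nlinarith [sq_nonneg (3 * |a0| - |a1|), sq_nonneg (5 * |a0| - |a2|),
      sq_nonneg (5 * |a1| - 3 * |a2|)]
  have := mul_le_mul_of_nonneg_left hsq hl.le
  linarith

/-- On the rectangle `T` the function is continuous and quadratic in each variable. -/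
structure IsBiquad (T : Rect) (g : Plane → ℝ) : Prop where
  cont : ContinuousOn g T.carrier
  fst : ∀ t ∈ Icc T.y0 T.y1, ∃ p ∈ quadFun, ∀ s ∈ Icc T.x0 T.x1, g (s, t) = p s
  snd : ∀ s ∈ Icc T.x0 T.x1, ∃ p ∈ quadFun, ∀ t ∈ Icc T.y0 T.y1, g (s, t) = p t

/-- The one-dimensional estimate is used once in each variable, whence 81 = 9². -/
theorem IsBiquad.area_mul_sq_le {T : Rect} {g : Plane → ℝ} (h : IsBiquad T g) {x : Plane}
    (hx : x ∈ T.carrier) : T.area * g x ^ 2 ≤ 81 * ∫ z in T.carrier, g z ^ 2 := by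
  have i2 : IntegrableOn (fun z => g z ^ 2) (Icc T.x0 T.x1 ×ˢ Icc T.y0 T.y1) :=
    (h.cont.pow 2).integrableOn_compact T.isCompact_carrier
  have e1 : ∫ z in T.carrier, g z ^ 2 =
      ∫ s in Icc T.x0 T.x1, ∫ t in Icc T.y0 T.y1, g (s, t) ^ 2 := by
    rw [Rect.carrier, Measure.volume_eq_prod]
    exact setIntegral_prod _ (by rwa [← Measure.volume_eq_prod])
  have i3 : IntegrableOn (fun s => ∫ t in Icc T.y0 T.y1, g (s, t) ^ 2) (Icc T.x0 T.x1) := by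
    rw [IntegrableOn, Measure.volume_eq_prod, ← Measure.prod_restrict] at i2
    exact i2.integral_prod_left
  have hl := sub_pos.2 T.hx
  have hm := sub_pos.2 T.hy
  have hcol : ∀ s ∈ Icc T.x0 T.x1, (T.y1 - T.y0) * g (s, x.2) ^ 2 ≤
      9 * ∫ t in Icc T.y0 T.y1, g (s, t) ^ 2 := by
    intro s hs
    obtain ⟨p, hp, hgp⟩ := h.snd s hs
    rw [hgp x.2 hx.2, setIntegral_congr_fun (g := fun t => p t ^ 2) measurableSet_Icc
      fun t ht => by simp only [hgp t ht]]
    exact sq_le_of_mem_quadFun hp T.hy hx.2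
  have hrow : (T.x1 - T.x0) * g x ^ 2 ≤ 9 * ∫ s in Icc T.x0 T.x1, g (s, x.2) ^ 2 := by
    obtain ⟨p, hp, hgp⟩ := h.fst x.2 hx.2
    rw [show g x = p x.1 from hgp x.1 hx.1, setIntegral_congr_fun (g := fun s => p s ^ 2)
      measurableSet_Icc fun s hs => by simp only [hgp s hs]]
    exact sq_le_of_mem_quadFun hp T.hx hx.1
  have i4 : IntegrableOn (fun s => g (s, x.2) ^ 2) (Icc T.x0 T.x1) :=
    ((h.cont.comp (f := fun s : ℝ => ((s, x.2) : Plane)) (s := Icc T.x0 T.x1) (by fun_prop)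
      fun s hs => ⟨hs, hx.2⟩).pow 2).integrableOn_compact isCompact_Icc
  have hmono := setIntegral_mono_on (i4.const_mul (T.y1 - T.y0)) (i3.const_mul 9)
    measurableSet_Icc hcol
  rw [integral_const_mul, integral_const_mul, ← e1] at hmono
  rw [Rect.area]
  nlinarith

theorem isBiquad_of_sum {ι κ : Type} [Fintype ι] [Fintype κ] (T : Rect) (f : ι → ℝ → ℝ)
    (g : κ → ℝ → ℝ) (N : ι → κ → ℝ) (hf : ∀ a, f a ∈ quadFun) (hg : ∀ b, g b ∈ quadFun)
    {F : Plane → ℝ} (hF : ∀ x ∈ T.carrier,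
      F x = ∑ a, ∑ b, (f a (T.relx x) * g b (T.rely x)) * N a b) : IsBiquad T F := by
  have hcont : ∀ {p : ℝ → ℝ}, p ∈ quadFun → Continuous p := by
    rintro p ⟨A, B, C, h⟩
    rw [funext h]; fun_prop
  refine ⟨?_, fun t ht => ?_, fun s hs => ?_⟩
  · have hx : Continuous T.relx := by unfold Rect.relx; fun_prop
    have hy : Continuous T.rely := by unfold Rect.rely; fun_prop
    refine ContinuousOn.congr (Continuous.continuousOn ?_) hF
    exact continuous_finsetSum _ fun a _ => continuous_finsetSum _ fun b _ =>
      (((hcont (hf a)).comp hx).mul ((hcont (hg b)).comp hy)).mul continuous_const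
  · refine ⟨∑ a, ∑ b, (g b (T.rely (T.x0, t)) * N a b) • fun s => f a ((s - T.x0) / (T.x1 - T.x0)),
      Submodule.sum_mem _ fun a _ => Submodule.sum_mem _ fun b _ =>
        Submodule.smul_mem _ _ (quadFun_comp_affine (hf a) _ _), fun s hs => ?_⟩
    rw [hF (s, t) ⟨hs, ht⟩]
    simp only [Finset.sum_apply, Pi.smul_apply, smul_eq_mul, Rect.relx, Rect.rely]
    exact Finset.sum_congr rfl fun a _ => Finset.sum_congr rfl fun b _ => by ring
  · refine ⟨∑ a, ∑ b, (f a (T.relx (s, T.y0)) * N a b) • fun t => g b ((t - T.y0) / (T.y1 - T.y0)),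
      Submodule.sum_mem _ fun a _ => Submodule.sum_mem _ fun b _ =>
        Submodule.smul_mem _ _ (quadFun_comp_affine (hg b) _ _), fun t ht => ?_⟩
    rw [hF (s, t) ⟨hs, ht⟩]
    simp only [Finset.sum_apply, Pi.smul_apply, smul_eq_mul, Rect.relx, Rect.rely]
    exact Finset.sum_congr rfl fun a _ => Finset.sum_congr rfl fun b _ => by ring

/-! ### Interpolants on one element -/

/-- Derivatives of the quadratic shape functions. -/
def quadShapeDeriv (a : Fin 3) (s : ℝ) : ℝ :=
  if a = 0 then 4 * s - 3 else if a = 1 then 4 - 8 * s else 4 * s - 1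

/-- Derivatives of the linear shape functions. -/
def linShapeDeriv (a : Fin 2) (_ : ℝ) : ℝ := if a = 0 then -1 else 1

theorem hasDerivAt_quadShape (a : Fin 3) (s : ℝ) :
    HasDerivAt (quadShape a) (quadShapeDeriv a s) s := by
  have h : ∀ A B C : ℝ, HasDerivAt (fun s : ℝ => A + B * s + C * s ^ 2) (B + 2 * C * s) s := by
    intro A B C
    refine (((hasDerivAt_id s).const_mul B).const_add A |>.add
      ((hasDerivAt_pow 2 s).const_mul C)).congr_deriv ?_
    norm_num
    ring
  fin_cases a
  · refine (h 1 (-3) 2).congr_deriv ?_ |>.congr_of_eventuallyEq (.of_forall fun t => ?_) <;>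
      simp [quadShape, quadShapeDeriv] <;> ring
  · refine (h 0 4 (-4)).congr_deriv ?_ |>.congr_of_eventuallyEq (.of_forall fun t => ?_) <;>
      simp [quadShape, quadShapeDeriv] <;> ring
  · refine (h 0 (-1) 2).congr_deriv ?_ |>.congr_of_eventuallyEq (.of_forall fun t => ?_) <;>
      simp [quadShape, quadShapeDeriv] <;> ring

theorem hasDerivAt_linShape (a : Fin 2) (s : ℝ) :
    HasDerivAt (linShape a) (linShapeDeriv a s) s := by
  fin_cases a
  · exact (hasDerivAt_id s).const_sub 1
  · exact hasDerivAt_id s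

theorem quadShape_mem (a : Fin 3) : quadShape a ∈ quadFun := by
  fin_cases a
  · exact ⟨1, -3, 2, fun s => by simp [quadShape]; ring⟩
  · exact ⟨0, 4, -4, fun s => by simp [quadShape]; ring⟩
  · exact ⟨0, -1, 2, fun s => by simp [quadShape]; ring⟩

theorem quadShapeDeriv_mem (a : Fin 3) : quadShapeDeriv a ∈ quadFun := by
  fin_cases a
  · exact ⟨-3, 4, 0, fun s => by simp [quadShapeDeriv]; ring⟩
  · exact ⟨4, -8, 0, fun s => by simp [quadShapeDeriv]; ring⟩
  · exact ⟨-1, 4, 0, fun s => by simp [quadShapeDeriv]; ring⟩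

theorem linShape_mem (a : Fin 2) : linShape a ∈ quadFun := by
  fin_cases a
  · exact ⟨1, -1, 0, fun s => by simp [linShape]; ring⟩
  · exact ⟨0, 1, 0, fun s => by simp [linShape]⟩

theorem smul_mem_quadFun {p : ℝ → ℝ} (hp : p ∈ quadFun) (c : ℝ) :
    (fun s => p s / c) ∈ quadFun := by
  have := quadFun.smul_mem c⁻¹ hp
  convert this using 1
  funext s
  simp [div_eq_inv_mul]

theorem contDiff_quadShape (a : Fin 3) : ContDiff ℝ 1 (quadShape a) := by
  obtain ⟨A, B, C, h⟩ := quadShape_mem a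
  rw [funext h]; fun_prop

theorem contDiff_linShape (a : Fin 2) : ContDiff ℝ 1 (linShape a) := by
  obtain ⟨A, B, C, h⟩ := linShape_mem a
  rw [funext h]; fun_prop

theorem contDiff_relx (T : Rect) : ContDiff ℝ 1 T.relx := by
  unfold Rect.relx; fun_prop

theorem contDiff_rely (T : Rect) : ContDiff ℝ 1 T.rely := by
  unfold Rect.rely; fun_prop

section Interpolants

variable {V : Type} [NormedAddCommGroup V] [NormedSpace ℝ V]

theorem contDiff_quadInterp (T : Rect) (ψ : Plane → V) : ContDiff ℝ 1 (quadInterp T ψ) := by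
  unfold quadInterp
  exact ContDiff.sum fun a _ => ContDiff.sum fun b _ =>
    (((contDiff_quadShape a).comp (contDiff_relx T)).mul
      ((contDiff_quadShape b).comp (contDiff_rely T))).smul contDiff_const

theorem contDiff_bilinInterp (T : Rect) (ψ : Plane → V) : ContDiff ℝ 1 (bilinInterp T ψ) := by
  unfold bilinInterp
  exact ContDiff.sum fun a _ => ContDiff.sum fun b _ =>
    (((contDiff_linShape a).comp (contDiff_relx T)).mul
      ((contDiff_linShape b).comp (contDiff_rely T))).smul contDiff_const

end Interpolants

theorem pdOn_sum_zero {ι κ : Type} [Fintype ι] [Fintype κ] {T : Rect} {f f' : ι → ℝ → ℝ}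
    {g : κ → ℝ → ℝ} (N : ι → κ → ℝ) (hf : ∀ a s, HasDerivAt (f a) (f' a s) s) {F : Plane → ℝ}
    (hF : ∀ x, F x = ∑ a, ∑ b, (f a (T.relx x) * g b (T.rely x)) * N a b)
    (hd : DifferentiableOn ℝ F T.carrier) {x : Plane} (hx : x ∈ T.carrier) :
    pdOn 0 T F x = ∑ a, ∑ b, (f' a (T.relx x) / (T.x1 - T.x0) * g b (T.rely x)) * N a b := by
  refine pdOn_zero_eq hx (hd x hx) (HasDerivAt.hasDerivWithinAt ?_)
  have h1 : HasDerivAt (fun s => T.relx (s, x.2)) (1 / (T.x1 - T.x0)) x.1 :=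
    ((hasDerivAt_id x.1).sub_const T.x0).div_const _
  have h2 : HasDerivAt (fun s => ∑ a, ∑ b, (f a (T.relx (s, x.2)) * g b (T.rely x)) * N a b)
      (∑ a, ∑ b, (f' a (T.relx x) / (T.x1 - T.x0) * g b (T.rely x)) * N a b) x.1 := by
    refine HasDerivAt.fun_sum fun a _ => HasDerivAt.fun_sum fun b _ => ?_
    have h3 : HasDerivAt (fun s => f a (T.relx (s, x.2))) _ x.1 :=
      HasDerivAt.comp x.1 (hf a _) h1
    refine ((h3.mul_const _).mul_const _).congr_deriv ?_
    rw [Prod.mk.eta]; ring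
  exact h2.congr_of_eventuallyEq (.of_forall fun s => hF (s, x.2))

theorem pdOn_sum_one {ι κ : Type} [Fintype ι] [Fintype κ] {T : Rect} {f : ι → ℝ → ℝ}
    {g g' : κ → ℝ → ℝ} (N : ι → κ → ℝ) (hg : ∀ a s, HasDerivAt (g a) (g' a s) s) {F : Plane → ℝ}
    (hF : ∀ x, F x = ∑ a, ∑ b, (f a (T.relx x) * g b (T.rely x)) * N a b)
    (hd : DifferentiableOn ℝ F T.carrier) {x : Plane} (hx : x ∈ T.carrier) :
    pdOn 1 T F x = ∑ a, ∑ b, (f a (T.relx x) * (g' b (T.rely x) / (T.y1 - T.y0))) * N a b := by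
  refine pdOn_one_eq hx (hd x hx) (HasDerivAt.hasDerivWithinAt ?_)
  have h1 : HasDerivAt (fun s => T.rely (x.1, s)) (1 / (T.y1 - T.y0)) x.2 :=
    ((hasDerivAt_id x.2).sub_const T.y0).div_const _
  have h2 : HasDerivAt (fun s => ∑ a, ∑ b, (f a (T.relx x) * g b (T.rely (x.1, s))) * N a b)
      (∑ a, ∑ b, (f a (T.relx x) * (g' b (T.rely x) / (T.y1 - T.y0))) * N a b) x.2 := by
    refine HasDerivAt.fun_sum fun a _ => HasDerivAt.fun_sum fun b _ => ?_
    have h3 : HasDerivAt (fun s => g b (T.rely (x.1, s))) _ x.2 :=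
      HasDerivAt.comp x.2 (hg b _) h1
    refine ((h3.const_mul _).mul_const _).congr_deriv ?_
    rw [Prod.mk.eta]; ring
  exact h2.congr_of_eventuallyEq (.of_forall fun s => hF (x.1, s))

section ScalarInterp

variable (T : Rect) (ψ : Plane → ℝ)

theorem isBiquad_quadInterp : IsBiquad T (quadInterp T ψ) :=
  isBiquad_of_sum T quadShape quadShape (quadNodal T ψ) quadShape_mem quadShape_mem
    fun _ _ => rfl

theorem isBiquad_bilinInterp : IsBiquad T (bilinInterp T ψ) :=
  isBiquad_of_sum T linShape linShape (fun a b => ψ (T.vertex a b)) linShape_mem linShape_mem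
    fun _ _ => rfl

theorem isBiquad_pdOn_quadInterp (i : Fin 2) : IsBiquad T (pdOn i T (quadInterp T ψ)) := by
  have hd : DifferentiableOn ℝ (quadInterp T ψ) T.carrier :=
    ((contDiff_quadInterp T ψ).differentiable one_ne_zero).differentiableOn
  fin_cases i
  · exact isBiquad_of_sum T (fun a s => quadShapeDeriv a s / (T.x1 - T.x0)) quadShape
      (quadNodal T ψ) (fun a => smul_mem_quadFun (quadShapeDeriv_mem a) _) quadShape_mem
      fun x hx => pdOn_sum_zero (quadNodal T ψ) hasDerivAt_quadShape (fun _ => rfl) hd hx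
  · exact isBiquad_of_sum T quadShape (fun a s => quadShapeDeriv a s / (T.y1 - T.y0))
      (quadNodal T ψ) quadShape_mem (fun a => smul_mem_quadFun (quadShapeDeriv_mem a) _)
      fun x hx => pdOn_sum_one (quadNodal T ψ) hasDerivAt_quadShape (fun _ => rfl) hd hx

/-- The derivative is a convex combination of the difference quotients along the two horizontal
edges. -/
theorem abs_pdOn_zero_bilinInterp_le {B : ℝ}
    (hB : ∀ b, |ψ (T.vertex 1 b) - ψ (T.vertex 0 b)| ≤ B * (T.x1 - T.x0)) {x : Plane}
    (hx : x ∈ T.carrier) : |pdOn 0 T (bilinInterp T ψ) x| ≤ B := by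
  have hl := sub_pos.2 T.hx
  rw [pdOn_sum_zero (F := bilinInterp T ψ) (f := linShape) (g := linShape) (fun a b => ψ (T.vertex a b))
    hasDerivAt_linShape
    (fun _ => rfl) ((contDiff_bilinInterp T ψ).differentiable one_ne_zero).differentiableOn hx]
  have ht := Rect.rely_mem hx
  have e : ∑ a : Fin 2, ∑ b : Fin 2, linShapeDeriv a (T.relx x) / (T.x1 - T.x0) *
      linShape b (T.rely x) * ψ (T.vertex a b) =
      ((1 - T.rely x) * (ψ (T.vertex 1 0) - ψ (T.vertex 0 0)) +
        T.rely x * (ψ (T.vertex 1 1) - ψ (T.vertex 0 1))) / (T.x1 - T.x0) := by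
    simp [Fin.sum_univ_two, linShapeDeriv, linShape]
    field_simp
    ring
  rw [e, abs_div, abs_of_pos hl, div_le_iff₀ hl]
  have h0 := hB 0
  have h1 := hB 1
  rw [abs_le] at *
  constructor <;> nlinarith [ht.1, ht.2, h0.1, h0.2, h1.1, h1.2]

theorem abs_pdOn_one_bilinInterp_le {B : ℝ}
    (hB : ∀ a, |ψ (T.vertex a 1) - ψ (T.vertex a 0)| ≤ B * (T.y1 - T.y0)) {x : Plane}
    (hx : x ∈ T.carrier) : |pdOn 1 T (bilinInterp T ψ) x| ≤ B := by
  have hl := sub_pos.2 T.hy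
  rw [pdOn_sum_one (F := bilinInterp T ψ) (f := linShape) (g := linShape) (fun a b => ψ (T.vertex a b))
    hasDerivAt_linShape
    (fun _ => rfl) ((contDiff_bilinInterp T ψ).differentiable one_ne_zero).differentiableOn hx]
  have ht := Rect.relx_mem hx
  have e : ∑ a : Fin 2, ∑ b : Fin 2, linShape a (T.relx x) * (linShapeDeriv b (T.rely x) /
      (T.y1 - T.y0)) * ψ (T.vertex a b) =
      ((1 - T.relx x) * (ψ (T.vertex 0 1) - ψ (T.vertex 0 0)) +
        T.relx x * (ψ (T.vertex 1 1) - ψ (T.vertex 1 0))) / (T.y1 - T.y0) := by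
    simp [Fin.sum_univ_two, linShapeDeriv, linShape]
    field_simp
    ring
  rw [e, abs_div, abs_of_pos hl, div_le_iff₀ hl]
  have h0 := hB 0
  have h1 := hB 1
  rw [abs_le] at *
  constructor <;> nlinarith [ht.1, ht.2, h0.1, h0.2, h1.1, h1.2]

end ScalarInterp

theorem quadInterp_apply {ι : Type} [Fintype ι] (T : Rect) (ψ : Plane → ι → ℝ) (x : Plane) (k : ι) :
    quadInterp T ψ x k = quadInterp T (fun x => ψ x k) x := by
  have h : ∀ a b, quadNodal T ψ a b k = quadNodal T (fun x => ψ x k) a b := by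
    intro a b
    unfold quadNodal
    split_ifs <;> simp
  simp [quadInterp, h]

theorem bilinInterp_apply {ι : Type} [Fintype ι] (T : Rect) (ψ : Plane → ι → ℝ) (x : Plane)
    (k : ι) : bilinInterp T ψ x k = bilinInterp T (fun x => ψ x k) x := by
  simp [bilinInterp]

theorem quadInterp_congr {T : Rect} {V : Type} [AddCommGroup V] [Module ℝ V] {ψ ψ' : Plane → V}
    (h : ∀ x ∈ T.carrier, ψ x = ψ' x) (x : Plane) : quadInterp T ψ x = quadInterp T ψ' x := by
  have : ∀ a b, quadNodal T ψ a b = quadNodal T ψ' a b := by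
    intro a b
    unfold quadNodal
    rw [h _ (Rect.pt_mem (Rect.half_mem_unit a) (Rect.half_mem_unit b))]
    simp only [h _ (T.vertex_mem _ _)]
  simp [quadInterp, this]

/-! ### Kirchhoff functions on edges -/

theorem IsQ.contDiffOn {r : ℕ} {T : Rect} {w : Plane → ℝ} (h : IsQ r T w) :
    ContDiffOn ℝ 1 w T.carrier := by
  obtain ⟨c, hc⟩ := h
  refine ContDiffOn.congr (ContDiff.contDiffOn ?_) hc
  exact ContDiff.sum fun i _ => ContDiff.sum fun j _ => by fun_prop

theorem hasDerivAt_cubic (A B C E s : ℝ) :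
    HasDerivAt (fun s : ℝ => A + B * s + C * s ^ 2 + E * s ^ 3) (B + 2 * C * s + 3 * E * s ^ 2)
      s := by
  refine ((((hasDerivAt_id s).const_mul B).const_add A |>.add
    ((hasDerivAt_pow 2 s).const_mul C)).add ((hasDerivAt_pow 3 s).const_mul E)).congr_deriv ?_
  norm_num
  ring

theorem IsQ.line_fst {T : Rect} {w : Plane → ℝ} (h : IsQ 3 T w) {t : ℝ}
    (ht : t ∈ Icc T.y0 T.y1) : ∃ A B C E : ℝ, ∀ s ∈ Icc T.x0 T.x1,
      w (s, t) = A + B * s + C * s ^ 2 + E * s ^ 3 ∧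
        pdOn 0 T w (s, t) = B + 2 * C * s + 3 * E * s ^ 2 := by
  have hd := h.contDiffOn.differentiableOn one_ne_zero
  obtain ⟨c, hc⟩ := h
  obtain ⟨A, B, C, E, hw⟩ : ∃ A B C E : ℝ, ∀ s ∈ Icc T.x0 T.x1,
      w (s, t) = A + B * s + C * s ^ 2 + E * s ^ 3 := by
    refine ⟨∑ j, c 0 j * t ^ (j : ℕ), ∑ j, c 1 j * t ^ (j : ℕ), ∑ j, c 2 j * t ^ (j : ℕ),
      ∑ j, c 3 j * t ^ (j : ℕ), fun s hs => ?_⟩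
    rw [hc (s, t) ⟨hs, ht⟩]
    simp only [Fin.sum_univ_four, Nat.reduceAdd]
    norm_num
    ring
  refine ⟨A, B, C, E, fun s hs => ⟨hw s hs, ?_⟩⟩
  exact pdOn_zero_eq (x := (s, t)) ⟨hs, ht⟩ (hd _ ⟨hs, ht⟩)
    ((hasDerivAt_cubic A B C E s).hasDerivWithinAt.congr hw (hw s hs))

theorem IsQ.line_snd {T : Rect} {w : Plane → ℝ} (h : IsQ 3 T w) {s : ℝ}
    (hs : s ∈ Icc T.x0 T.x1) : ∃ A B C E : ℝ, ∀ t ∈ Icc T.y0 T.y1,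
      w (s, t) = A + B * t + C * t ^ 2 + E * t ^ 3 ∧
        pdOn 1 T w (s, t) = B + 2 * C * t + 3 * E * t ^ 2 := by
  have hd := h.contDiffOn.differentiableOn one_ne_zero
  obtain ⟨c, hc⟩ := h
  obtain ⟨A, B, C, E, hw⟩ : ∃ A B C E : ℝ, ∀ t ∈ Icc T.y0 T.y1,
      w (s, t) = A + B * t + C * t ^ 2 + E * t ^ 3 := by
    refine ⟨∑ i, c i 0 * s ^ (i : ℕ), ∑ i, c i 1 * s ^ (i : ℕ), ∑ i, c i 2 * s ^ (i : ℕ),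
      ∑ i, c i 3 * s ^ (i : ℕ), fun t ht => ?_⟩
    rw [hc (s, t) ⟨hs, ht⟩]
    simp only [Fin.sum_univ_four, Nat.reduceAdd]
    norm_num
    ring
  refine ⟨A, B, C, E, fun t ht => ⟨hw t ht, ?_⟩⟩
  exact pdOn_one_eq (x := (s, t)) ⟨hs, ht⟩ (hd _ ⟨hs, ht⟩)
    ((hasDerivAt_cubic A B C E t).hasDerivWithinAt.congr hw (hw t ht))

section EdgeFormulas

variable {V : Type} [AddCommGroup V] [Module ℝ V] (T : Rect) (ψ : Plane → V)

theorem quadShape_endpoint (b : Fin 2) :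
    quadShape 0 ((b : ℕ) : ℝ) = 1 - ((b : ℕ) : ℝ) ∧ quadShape 1 ((b : ℕ) : ℝ) = 0 ∧
      quadShape 2 ((b : ℕ) : ℝ) = ((b : ℕ) : ℝ) := by
  fin_cases b <;> refine ⟨?_, ?_, ?_⟩ <;> (simp [quadShape]; try norm_num)

theorem quadInterp_horizontal (s : ℝ) (b : Fin 2) :
    quadInterp T ψ (T.pt s ((b : ℕ) : ℝ)) =
      ∑ a : Fin 3, quadShape a s • ψ (T.pt (((a : ℕ) : ℝ) / 2) ((b : ℕ) : ℝ)) := by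
  rw [quadInterp]
  simp only [relx_pt, rely_pt]
  refine Finset.sum_congr rfl fun a _ => ?_
  obtain ⟨h0, h1, h2⟩ := quadShape_endpoint b
  rw [Fin.sum_univ_three, h0, h1, h2]
  fin_cases b <;> simp [quadNodal]

theorem quadInterp_vertical (a : Fin 2) (t : ℝ) :
    quadInterp T ψ (T.pt ((a : ℕ) : ℝ) t) =
      ∑ b : Fin 3, quadShape b t • ψ (T.pt ((a : ℕ) : ℝ) (((b : ℕ) : ℝ) / 2)) := by
  rw [quadInterp, Finset.sum_comm]
  simp only [relx_pt, rely_pt]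
  refine Finset.sum_congr rfl fun b _ => ?_
  obtain ⟨h0, h1, h2⟩ := quadShape_endpoint a
  rw [Fin.sum_univ_three, h0, h1, h2]
  fin_cases a <;> simp [quadNodal]

theorem bilinInterp_horizontal (s : ℝ) (b : Fin 2) :
    bilinInterp T ψ (T.pt s ((b : ℕ) : ℝ)) = ∑ a : Fin 2, linShape a s • ψ (T.vertex a b) := by
  rw [bilinInterp]
  simp only [relx_pt, rely_pt]
  fin_cases b <;> simp [linShape]

theorem bilinInterp_vertical (a : Fin 2) (t : ℝ) :
    bilinInterp T ψ (T.pt ((a : ℕ) : ℝ) t) = ∑ b : Fin 2, linShape b t • ψ (T.vertex a b) := by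
  rw [bilinInterp]
  simp only [relx_pt, rely_pt]
  fin_cases a <;> simp [linShape]

theorem quadInterp_vertex {z : Plane} (hz : z ∈ T.vertices) : quadInterp T ψ z = ψ z := by
  obtain ⟨a, b, rfl⟩ := hz
  have h := quadInterp_horizontal T ψ ((a : ℕ) : ℝ) b
  obtain ⟨h0, h1, h2⟩ := quadShape_endpoint a
  rw [Fin.sum_univ_three, h0, h1, h2] at h
  rw [Rect.vertex, h]
  fin_cases a <;> simp

end EdgeFormulas

theorem Rect.exists_pt_fst {T : Rect} {x : Plane} (h : x.1 = T.x0 ∨ x.1 = T.x1) :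
    ∃ a : Fin 2, x = T.pt ((a : ℕ) : ℝ) (T.rely x) := by
  have h2 : T.y1 - T.y0 ≠ 0 := (sub_pos.2 T.hy).ne'
  rcases h with h | h
  · exact ⟨0, Prod.ext (by simp [Rect.pt, h]) (by simp only [Rect.pt, Rect.rely]; field_simp; ring)⟩
  · exact ⟨1, Prod.ext (by simp [Rect.pt, h]) (by simp only [Rect.pt, Rect.rely]; field_simp; ring)⟩

theorem Rect.exists_pt_snd {T : Rect} {x : Plane} (h : x.2 = T.y0 ∨ x.2 = T.y1) :
    ∃ b : Fin 2, x = T.pt (T.relx x) ((b : ℕ) : ℝ) := by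
  have h2 : T.x1 - T.x0 ≠ 0 := (sub_pos.2 T.hx).ne'
  rcases h with h | h
  · exact ⟨0, Prod.ext (by simp only [Rect.pt, Rect.relx]; field_simp; ring) (by simp [Rect.pt, h])⟩
  · exact ⟨1, Prod.ext (by simp only [Rect.pt, Rect.relx]; field_simp; ring) (by simp [Rect.pt, h])⟩

/-- Along the edge the function is cubic, so its tangential derivative is quadratic and is
reproduced by three-point interpolation. The averaged centre value plays no role on edges. -/
theorem IsQ.quadInterp_pdOn_horizontal {T : Rect} {w : Plane → ℝ} (h : IsQ 3 T w) {s : ℝ}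
    (hs : s ∈ Icc (0 : ℝ) 1) (b : Fin 2) :
    quadInterp T (pdOn 0 T w) (T.pt s ((b : ℕ) : ℝ)) = pdOn 0 T w (T.pt s ((b : ℕ) : ℝ)) := by
  have hb := Rect.fin_mem_unit b
  obtain ⟨A, B, C, E, hl⟩ := h.line_fst (Rect.pt_mem (T := T) hs hb).2
  obtain ⟨p, hp, hpe⟩ : ∃ p ∈ quadFun, ∀ s, p s = B + 2 * C * s + 3 * E * s ^ 2 :=
    ⟨_, ⟨B, 2 * C, 3 * E, fun _ => rfl⟩, fun _ => rfl⟩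
  rw [quadInterp_horizontal]
  have h1 : ∀ r ∈ Icc (0 : ℝ) 1, pdOn 0 T w (T.pt r ((b : ℕ) : ℝ)) =
      p (T.x0 + r * (T.x1 - T.x0)) := fun r hr =>
    (hpe _).symm ▸ (hl _ (Rect.pt_mem (T := T) hr hb).1).2
  rw [h1 s hs, quadFun_lagrange hp]
  exact Finset.sum_congr rfl fun a _ => by rw [h1 _ (Rect.half_mem_unit a), smul_eq_mul]

theorem IsQ.quadInterp_pdOn_vertical {T : Rect} {w : Plane → ℝ} (h : IsQ 3 T w) (a : Fin 2) {t : ℝ}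
    (ht : t ∈ Icc (0 : ℝ) 1) :
    quadInterp T (pdOn 1 T w) (T.pt ((a : ℕ) : ℝ) t) = pdOn 1 T w (T.pt ((a : ℕ) : ℝ) t) := by
  have ha := Rect.fin_mem_unit a
  obtain ⟨A, B, C, E, hl⟩ := h.line_snd (Rect.pt_mem (T := T) ha ht).1
  obtain ⟨p, hp, hpe⟩ : ∃ p ∈ quadFun, ∀ s, p s = B + 2 * C * s + 3 * E * s ^ 2 :=
    ⟨_, ⟨B, 2 * C, 3 * E, fun _ => rfl⟩, fun _ => rfl⟩
  rw [quadInterp_vertical]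
  have h1 : ∀ r ∈ Icc (0 : ℝ) 1, pdOn 1 T w (T.pt ((a : ℕ) : ℝ) r) =
      p (T.y0 + r * (T.y1 - T.y0)) := fun r hr =>
    (hpe _).symm ▸ (hl _ (Rect.pt_mem (T := T) ha hr).2).2
  rw [h1 t ht, quadFun_lagrange hp]
  exact Finset.sum_congr rfl fun b _ => by rw [h1 _ (Rect.half_mem_unit b), smul_eq_mul]

/-! ### Continuity across elements -/

section Continuity

variable {ω : Set Plane} {𝒯 : Finset Rect}

/-- On a common edge both interpolants are the linear interpolant of the same two vertex values. -/
theorem bilinInterp_consistent (h : IsConformingMesh ω 𝒯) (w : Plane → ℝ) {T T' : Rect}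
    (hT : T ∈ 𝒯) (hT' : T' ∈ 𝒯) {x : Plane} (hx : x ∈ T.carrier) (hx' : x ∈ T'.carrier) :
    bilinInterp T w x = bilinInterp T' w x := by
  by_cases hne : T = T'
  · rw [hne]
  rcases h.mem_inter hT hT' hne hx hx' with ⟨⟨a, b, h1⟩, a', b', h2⟩ | ⟨⟨e0, e1⟩, h1, h2⟩ |
    ⟨⟨e0, e1⟩, h1, h2⟩
  · rw [h1, bilinInterp_vertex, ← h1, h2, bilinInterp_vertex]
  · obtain ⟨a, ha⟩ := Rect.exists_pt_fst h1
    obtain ⟨a', ha'⟩ := Rect.exists_pt_fst h2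
    have er : T.rely x = T'.rely x := by simp only [Rect.rely, e0, e1]
    have ev : ∀ b, T.vertex a b = T'.vertex a' b := fun b => by
      have h3 := congrArg Prod.fst ha
      have h4 := congrArg Prod.fst ha'
      exact Prod.ext (h3.symm.trans h4) (by simp only [Rect.vertex, Rect.pt, e0, e1])
    have l1 := bilinInterp_vertical T w a (T.rely x)
    have l2 := bilinInterp_vertical T' w a' (T'.rely x)
    rw [← ha] at l1
    rw [← ha'] at l2
    rw [l1, l2, er]
    simp only [ev]
  · obtain ⟨b, hb⟩ := Rect.exists_pt_snd h1
    obtain ⟨b', hb'⟩ := Rect.exists_pt_snd h2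
    have er : T.relx x = T'.relx x := by simp only [Rect.relx, e0, e1]
    have ev : ∀ a, T.vertex a b = T'.vertex a b' := fun a => by
      have h3 := congrArg Prod.snd hb
      have h4 := congrArg Prod.snd hb'
      exact Prod.ext (by simp only [Rect.vertex, Rect.pt, e0, e1]) (h3.symm.trans h4)
    have l1 := bilinInterp_horizontal T w (T.relx x) b
    have l2 := bilinInterp_horizontal T' w (T'.relx x) b'
    rw [← hb] at l1
    rw [← hb'] at l2
    rw [l1, l2, er]
    simp only [ev]

/-- On a common edge each side is a quadratic with three nodal values, so it suffices that these
agree. At the vertices this is continuity of the gradient. -/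
theorem quadInterp_pdOn_consistent (h : IsConformingMesh ω 𝒯) {w : Plane → ℝ} (hw : InW ω 𝒯 w)
    {T T' : Rect} (hT : T ∈ 𝒯) (hT' : T' ∈ 𝒯) {x : Plane} (hx : x ∈ T.carrier)
    (hx' : x ∈ T'.carrier) (j : Fin 2) :
    quadInterp T (pdOn j T w) x = quadInterp T' (pdOn j T' w) x := by
  by_cases hne : T = T'
  · rw [hne]
  have hd : ∀ T ∈ 𝒯, DifferentiableOn ℝ w T.carrier := fun T hT =>
    (hw.poly T hT).contDiffOn.differentiableOn one_ne_zero
  rcases h.mem_inter hT hT' hne hx hx' with hz | ⟨⟨e0, e1⟩, h1, h2⟩ | ⟨⟨e0, e1⟩, h1, h2⟩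
  · rw [quadInterp_vertex _ _ hz.1, quadInterp_vertex _ _ hz.2]
    exact hw.grad_cont T hT T' hT' x hz j
  · obtain ⟨a, ha⟩ := Rect.exists_pt_fst h1
    obtain ⟨a', ha'⟩ := Rect.exists_pt_fst h2
    have er : T.rely x = T'.rely x := by simp only [Rect.rely, e0, e1]
    have ep : ∀ t, T.pt ((a : ℕ) : ℝ) t = T'.pt ((a' : ℕ) : ℝ) t := fun t => by
      have h3 := congrArg Prod.fst ha
      have h4 := congrArg Prod.fst ha'
      exact Prod.ext (h3.symm.trans h4) (by simp only [Rect.pt, e0, e1])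
    have ev : ∀ b, pdOn j T w (T.vertex a b) = pdOn j T' w (T'.vertex a' b) := fun b => by
      have e : T.vertex a b = T'.vertex a' b := ep _
      rw [hw.grad_cont T hT T' hT' _ ⟨T.vertex_mem_vertices a b, e ▸ T'.vertex_mem_vertices a' b⟩ j,
        e]
    -- At the midpoint, the normal derivative is the average of vertex values on either side. The
    -- tangential derivative is determined by the trace on the common edge.
    have en : ∀ b : Fin 3, pdOn j T w (T.pt ((a : ℕ) : ℝ) (((b : ℕ) : ℝ) / 2)) =
        pdOn j T' w (T'.pt ((a' : ℕ) : ℝ) (((b : ℕ) : ℝ) / 2)) := by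
      fin_cases j
      · intro b
        fin_cases b
        · have := ev 0
          simpa [Rect.vertex] using this
        · have n1 := hw.normal_fst T hT a
          have n2 := hw.normal_fst T' hT' a'
          have v0 := ev 0
          have v1 := ev 1
          simp only [Fin.zero_eta] at v0 v1
          rw [v0, v1] at n1
          simpa using n1.trans n2.symm
        · have := ev 1
          simpa [Rect.vertex] using this
      · intro b
        have m1 : T.pt ((a : ℕ) : ℝ) (((b : ℕ) : ℝ) / 2) ∈ T.carrier :=
          Rect.pt_mem (Rect.fin_mem_unit a) (Rect.half_mem_unit b)
        have m2 : T'.pt ((a' : ℕ) : ℝ) (((b : ℕ) : ℝ) / 2) ∈ T'.carrier :=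
          Rect.pt_mem (Rect.fin_mem_unit a') (Rect.half_mem_unit b)
        refine pdOn_one_eq m1 (hd T hT _ m1) ?_
        have := hasDerivWithinAt_snd m2 (hd T' hT' _ m2)
        rw [← ep] at this ⊢
        rwa [← e0, ← e1] at this
    have l1 := quadInterp_vertical T (pdOn j T w) a (T.rely x)
    have l2 := quadInterp_vertical T' (pdOn j T' w) a' (T'.rely x)
    rw [← ha] at l1
    rw [← ha'] at l2
    rw [l1, l2, er]
    simp only [en]
  · obtain ⟨b, hb⟩ := Rect.exists_pt_snd h1
    obtain ⟨b', hb'⟩ := Rect.exists_pt_snd h2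
    have er : T.relx x = T'.relx x := by simp only [Rect.relx, e0, e1]
    have ep : ∀ s, T.pt s ((b : ℕ) : ℝ) = T'.pt s ((b' : ℕ) : ℝ) := fun s => by
      have h3 := congrArg Prod.snd hb
      have h4 := congrArg Prod.snd hb'
      exact Prod.ext (by simp only [Rect.pt, e0, e1]) (h3.symm.trans h4)
    have ev : ∀ a, pdOn j T w (T.vertex a b) = pdOn j T' w (T'.vertex a b') := fun a => by
      have e : T.vertex a b = T'.vertex a b' := ep _
      rw [hw.grad_cont T hT T' hT' _ ⟨T.vertex_mem_vertices a b, e ▸ T'.vertex_mem_vertices a b'⟩ j,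
        e]
    have en : ∀ a : Fin 3, pdOn j T w (T.pt (((a : ℕ) : ℝ) / 2) ((b : ℕ) : ℝ)) =
        pdOn j T' w (T'.pt (((a : ℕ) : ℝ) / 2) ((b' : ℕ) : ℝ)) := by
      fin_cases j
      · intro a
        have m1 : T.pt (((a : ℕ) : ℝ) / 2) ((b : ℕ) : ℝ) ∈ T.carrier :=
          Rect.pt_mem (Rect.half_mem_unit a) (Rect.fin_mem_unit b)
        have m2 : T'.pt (((a : ℕ) : ℝ) / 2) ((b' : ℕ) : ℝ) ∈ T'.carrier :=
          Rect.pt_mem (Rect.half_mem_unit a) (Rect.fin_mem_unit b')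
        refine pdOn_zero_eq m1 (hd T hT _ m1) ?_
        have := hasDerivWithinAt_fst m2 (hd T' hT' _ m2)
        rw [← ep] at this ⊢
        rwa [← e0, ← e1] at this
      · intro a
        fin_cases a
        · have := ev 0
          simpa [Rect.vertex] using this
        · have n1 := hw.normal_snd T hT b
          have n2 := hw.normal_snd T' hT' b'
          have v0 := ev 0
          have v1 := ev 1
          simp only [Fin.mk_one] at v0 v1
          rw [v0, v1] at n1
          simpa using n1.trans n2.symm
        · have := ev 1
          simpa [Rect.vertex] using this
    have l1 := quadInterp_horizontal T (pdOn j T w) (T.relx x) b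
    have l2 := quadInterp_horizontal T' (pdOn j T' w) (T'.relx x) b'
    rw [← hb] at l1
    rw [← hb'] at l2
    rw [l1, l2, er]
    simp only [en]

theorem exists_glue {V : Type} [Inhabited V] {g : Rect → Plane → V}
    (hg : ∀ T ∈ 𝒯, ∀ T' ∈ 𝒯, ∀ x ∈ T.carrier, x ∈ T'.carrier → g T x = g T' x) :
    ∃ v : Plane → V, ∀ T ∈ 𝒯, ∀ x ∈ T.carrier, v x = g T x := by
  classical
  refine ⟨fun x => if h : ∃ T ∈ 𝒯, x ∈ T.carrier then g h.choose x else default,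
    fun T hT x hx => ?_⟩
  have h : ∃ T ∈ 𝒯, x ∈ T.carrier := ⟨T, hT, hx⟩
  simp only [dif_pos h]
  exact hg _ h.choose_spec.1 T hT x h.choose_spec.2 hx

end Continuity

/-- Friedrichs' inequality for consistent families of smooth functions on the elements. -/
theorem exists_friedrichs_family {ω ΓD : Set Plane} (hω : interior (closure ω) = ω)
    (hconn : IsConnected ω) (hΓ : ΓD ⊆ frontier ω)
    (hΓpos : 0 < Measure.hausdorffMeasure 1 ΓD) :
    ∃ κ : ℝ, 0 ≤ κ ∧ ∀ 𝒯 : Finset Rect, IsConformingMesh ω 𝒯 → ∀ g : Rect → Plane → ℝ,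
      (∀ T ∈ 𝒯, ∀ T' ∈ 𝒯, ∀ x ∈ T.carrier, x ∈ T'.carrier → g T x = g T' x) →
      (∀ T ∈ 𝒯, ContDiffOn ℝ 1 (g T) T.carrier) → ∀ M : ℝ,
      (∀ T ∈ 𝒯, ∀ x ∈ ΓD ∩ T.carrier, |g T x| ≤ M) →
      ∑ T ∈ 𝒯, ∫ x in T.carrier, g T x ^ 2 ≤ κ * (M ^ 2 +
        (∑ T ∈ 𝒯, ∫ x in T.carrier, pdOn 0 T (g T) x ^ 2) +
        ∑ T ∈ 𝒯, ∫ x in T.carrier, pdOn 1 T (g T) x ^ 2) := by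
  obtain ⟨κ, hκ, hF⟩ := exists_friedrichs hω hconn hΓ hΓpos
  refine ⟨κ, hκ, fun 𝒯 h g hg hsm M hM => ?_⟩
  obtain ⟨v, hv⟩ := exists_glue hg
  have h1 := hF 𝒯 h v (fun T hT => (hsm T hT).congr (hv T hT)) M fun x hx => by
    obtain ⟨T, hT, hxT⟩ := h.exists_mem (frontier_subset_closure (hΓ hx))
    rw [hv T hT x hxT]
    exact hM T hT x ⟨hx, hxT⟩
  have e1 : ∑ T ∈ 𝒯, ∫ x in T.carrier, v x ^ 2 = ∑ T ∈ 𝒯, ∫ x in T.carrier, g T x ^ 2 :=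
    Finset.sum_congr rfl fun T hT => setIntegral_congr_fun T.measurableSet_carrier fun x hx => by
      simp only [hv T hT x hx]
  have e2 : ∀ i, ∑ T ∈ 𝒯, ∫ x in T.carrier, pdOn i T v x ^ 2 =
      ∑ T ∈ 𝒯, ∫ x in T.carrier, pdOn i T (g T) x ^ 2 := fun i =>
    Finset.sum_congr rfl fun T hT => setIntegral_congr_fun T.measurableSet_carrier fun x hx => by
      simp only [pdOn_congr (hv T hT) hx i]
  rwa [e1, e2, e2] at h1

/-! ### Stability of the bilinear interpolant -/

theorem IsBiquad.abs_le {T : Rect} {g : Plane → ℝ} (h : IsBiquad T g) {x : Plane}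
    (hx : x ∈ T.carrier) : |g x| ≤ Real.sqrt (81 * (∫ z in T.carrier, g z ^ 2) / T.area) := by
  rw [← Real.sqrt_sq_eq_abs]
  refine Real.sqrt_le_sqrt ?_
  rw [le_div_iff₀ T.area_pos, mul_comm]
  exact h.area_mul_sq_le hx

theorem IsBiquad.sq_sqrt {T : Rect} (g : Plane → ℝ) :
    T.area * Real.sqrt (81 * (∫ z in T.carrier, g z ^ 2) / T.area) ^ 2 =
      81 * ∫ z in T.carrier, g z ^ 2 := by
  have h0 : 0 ≤ ∫ z in T.carrier, g z ^ 2 := integral_nonneg fun x => sq_nonneg _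
  have ha := T.area_pos
  rw [Real.sq_sqrt (by positivity)]
  field_simp

section Elementwise

variable {T : Rect} {w : Plane → ℝ} {S : ℝ}

/-- Mean value inequality along an edge, where the true tangential derivative equals the discrete
gradient. -/
theorem IsQ.abs_sub_le_fst (h : IsQ 3 T w)
    (hS : ∀ x ∈ T.carrier, |quadInterp T (pdOn 0 T w) x| ≤ S) {s : ℝ} (hs : s ∈ Icc (0 : ℝ) 1)
    (b : Fin 2) : |w (T.pt s ((b : ℕ) : ℝ)) - w (T.vertex 0 b)| ≤ S * (T.x1 - T.x0) := by
  have hl := sub_pos.2 T.hx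
  have hb := Rect.fin_mem_unit b
  have hS0 : 0 ≤ S := (abs_nonneg _).trans (hS _ (T.vertex_mem 0 0))
  have h0 := T.vertex_mem 0 b
  have h1 := Rect.pt_mem (T := T) hs hb
  have key : ∀ s ∈ Icc T.x0 T.x1, ‖pdOn 0 T w (s, (T.vertex 0 b).2)‖ ≤ S := by
    intro s hs
    have hm : (s, (T.vertex 0 b).2) ∈ T.carrier := ⟨hs, h0.2⟩
    have hr := Rect.relx_mem hm
    have hpt : (s, (T.vertex 0 b).2) = T.pt (T.relx (s, (T.vertex 0 b).2)) ((b : ℕ) : ℝ) :=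
      Prod.ext (Prod.ext_iff.1 (T.pt_rel (s, (T.vertex 0 b).2))).1.symm rfl
    rw [hpt, ← h.quadInterp_pdOn_horizontal hr b]
    exact hS _ (Rect.pt_mem hr hb)
  have := norm_sub_le_fst (h.contDiffOn.differentiableOn one_ne_zero) h0.2 key h0.1 h1.1
  refine this.trans (mul_le_mul_of_nonneg_left ?_ hS0)
  have e : (T.pt s ((b : ℕ) : ℝ)).1 - (T.vertex 0 b).1 = s * (T.x1 - T.x0) := by
    simp [Rect.pt, Rect.vertex]
  rw [e, abs_of_nonneg (mul_nonneg hs.1 hl.le)]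
  nlinarith [hs.2]

theorem IsQ.abs_sub_le_snd (h : IsQ 3 T w)
    (hS : ∀ x ∈ T.carrier, |quadInterp T (pdOn 1 T w) x| ≤ S) (a : Fin 2) {t : ℝ}
    (ht : t ∈ Icc (0 : ℝ) 1) :
    |w (T.pt ((a : ℕ) : ℝ) t) - w (T.vertex a 0)| ≤ S * (T.y1 - T.y0) := by
  have hl := sub_pos.2 T.hy
  have ha := Rect.fin_mem_unit a
  have hS0 : 0 ≤ S := (abs_nonneg _).trans (hS _ (T.vertex_mem 0 0))
  have h0 := T.vertex_mem a 0
  have h1 := Rect.pt_mem (T := T) ha ht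
  have key : ∀ t ∈ Icc T.y0 T.y1, ‖pdOn 1 T w ((T.vertex a 0).1, t)‖ ≤ S := by
    intro t ht
    have hm : ((T.vertex a 0).1, t) ∈ T.carrier := ⟨h0.1, ht⟩
    have hr := Rect.rely_mem hm
    have hpt : ((T.vertex a 0).1, t) = T.pt ((a : ℕ) : ℝ) (T.rely ((T.vertex a 0).1, t)) :=
      Prod.ext rfl (Prod.ext_iff.1 (T.pt_rel ((T.vertex a 0).1, t))).2.symm
    rw [hpt, ← h.quadInterp_pdOn_vertical a hr]
    exact hS _ (Rect.pt_mem ha hr)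
  have := norm_sub_le_snd (h.contDiffOn.differentiableOn one_ne_zero) h0.1 key h0.2 h1.2
  refine this.trans (mul_le_mul_of_nonneg_left ?_ hS0)
  have e : (T.pt ((a : ℕ) : ℝ) t).2 - (T.vertex a 0).2 = t * (T.y1 - T.y0) := by
    simp [Rect.pt, Rect.vertex]
  rw [e, abs_of_nonneg (mul_nonneg ht.1 hl.le)]
  nlinarith [ht.2]

theorem Rect.pt_one_left (T : Rect) (b : Fin 2) : T.pt 1 ((b : ℕ) : ℝ) = T.vertex 1 b := by
  simp [Rect.vertex]

theorem Rect.pt_one_right (T : Rect) (a : Fin 2) : T.pt ((a : ℕ) : ℝ) 1 = T.vertex a 1 := by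
  simp [Rect.vertex]

theorem IsQ.abs_pdOn_bilinInterp_le (h : IsQ 3 T w) (i : Fin 2)
    (hS : ∀ x ∈ T.carrier, |quadInterp T (pdOn i T w) x| ≤ S) {x : Plane} (hx : x ∈ T.carrier) :
    |pdOn i T (bilinInterp T w) x| ≤ S := by
  have h1 : (1 : ℝ) ∈ Icc (0 : ℝ) 1 := ⟨zero_le_one, le_rfl⟩
  fin_cases i
  · exact abs_pdOn_zero_bilinInterp_le T w (fun b => by
      have := h.abs_sub_le_fst hS h1 b
      rwa [T.pt_one_left] at this) hx
  · exact abs_pdOn_one_bilinInterp_le T w (fun a => by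
      have := h.abs_sub_le_snd hS a h1
      rwa [T.pt_one_right] at this) hx

theorem setIntegral_sq_le_of_abs_le {g : Plane → ℝ} (hg : ContinuousOn g T.carrier)
    (hS : ∀ x ∈ T.carrier, |g x| ≤ S) : ∫ x in T.carrier, g x ^ 2 ≤ T.area * S ^ 2 := by
  have hfin := T.isCompact_carrier.measure_lt_top (μ := volume)
  have := setIntegral_mono_on ((hg.pow 2).integrableOn_compact (μ := volume) T.isCompact_carrier)
    (integrableOn_const hfin.ne) T.measurableSet_carrier
    (fun x hx => sq_le_sq' (abs_le.1 (hS x hx)).1 (abs_le.1 (hS x hx)).2)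
  rwa [setIntegral_const, T.volume_real_carrier, smul_eq_mul] at this

/-- The discrete gradient is biquadratic, so its maximum is bounded by its L² norm. This maximum
bounds the difference quotients between vertices. -/
theorem IsQ.setIntegral_pdOn_bilinInterp_sq_le (h : IsQ 3 T w) (i : Fin 2) :
    ∫ x in T.carrier, pdOn i T (bilinInterp T w) x ^ 2 ≤
      81 * ∫ x in T.carrier, quadInterp T (pdOn i T w) x ^ 2 := by
  rw [← IsBiquad.sq_sqrt]
  exact setIntegral_sq_le_of_abs_le
    (continuousOn_pdOn (contDiff_bilinInterp T w).contDiffOn i) fun x hx =>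
      h.abs_pdOn_bilinInterp_le i
        (fun x hx => (isBiquad_quadInterp T (pdOn i T w)).abs_le hx) hx

/-- Vertex differences of the biquadratic function are integrals of its derivative, which is again
biquadratic in the sense of `IsBiquad` and hence obeys the inverse estimate. -/
theorem area_mul_pdOn_bilinInterp_quadInterp_sq_le (T : Rect) (ψ : Plane → ℝ) (i : Fin 2)
    {x : Plane} (hx : x ∈ T.carrier) :
    T.area * pdOn i T (bilinInterp T (quadInterp T ψ)) x ^ 2 ≤
      81 * ∫ z in T.carrier, pdOn i T (quadInterp T ψ) z ^ 2 := by
  have hd : DifferentiableOn ℝ (quadInterp T ψ) T.carrier :=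
    ((contDiff_quadInterp T ψ).differentiable one_ne_zero).differentiableOn
  have hB := fun z (hz : z ∈ T.carrier) => (isBiquad_pdOn_quadInterp T ψ i).abs_le hz
  rw [← IsBiquad.sq_sqrt]
  refine mul_le_mul_of_nonneg_left ?_ T.area_pos.le
  have key : |pdOn i T (bilinInterp T (quadInterp T ψ)) x| ≤
      Real.sqrt (81 * (∫ z in T.carrier, pdOn i T (quadInterp T ψ) z ^ 2) / T.area) := by
    fin_cases i
    · refine abs_pdOn_zero_bilinInterp_le T _ (fun b => ?_) hx
      have h0 := T.vertex_mem 0 b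
      have h1 := T.vertex_mem 1 b
      have := norm_sub_le_fst hd h0.2 (fun s hs => hB _ ⟨hs, h0.2⟩) h0.1 h1.1
      rwa [show (T.vertex 1 b).1 - (T.vertex 0 b).1 = T.x1 - T.x0 by simp [Rect.vertex, Rect.pt],
        abs_of_pos (sub_pos.2 T.hx)] at this
    · refine abs_pdOn_one_bilinInterp_le T _ (fun a => ?_) hx
      have h0 := T.vertex_mem a 0
      have h1 := T.vertex_mem a 1
      have := norm_sub_le_snd hd h0.1 (fun s hs => hB _ ⟨h0.1, hs⟩) h0.2 h1.2
      rwa [show (T.vertex a 1).2 - (T.vertex a 0).2 = T.y1 - T.y0 by simp [Rect.vertex, Rect.pt],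
        abs_of_pos (sub_pos.2 T.hy)] at this
  exact sq_le_sq' (abs_le.1 key).1 (abs_le.1 key).2

/-- Either side is at most the diameter, which is at most a multiple of the other side. The absolute
value covers a parameter of unspecified sign. -/
theorem ShapeRegular.sq_le {σ : ℝ} {𝒯 : Finset Rect} (h : ShapeRegular σ 𝒯) {T : Rect}
    (hT : T ∈ 𝒯) : (T.x1 - T.x0) ^ 2 ≤ |σ| * T.area ∧ (T.y1 - T.y0) ^ 2 ≤ |σ| * T.area := by
  have h1 := h T hT
  have hx := sub_pos.2 T.hx
  have hy := sub_pos.2 T.hy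
  have hm : 0 < min (T.x1 - T.x0) (T.y1 - T.y0) := lt_min hx hy
  have h2 : T.diam ≤ |σ| * min (T.x1 - T.x0) (T.y1 - T.y0) :=
    h1.trans (mul_le_mul_of_nonneg_right (le_abs_self σ) hm.le)
  have dx : T.x1 - T.x0 ≤ T.diam := Real.le_sqrt_of_sq_le (by nlinarith)
  have dy : T.y1 - T.y0 ≤ T.diam := Real.le_sqrt_of_sq_le (by nlinarith)
  have hσ := abs_nonneg σ
  have mx : |σ| * min (T.x1 - T.x0) (T.y1 - T.y0) ≤ |σ| * (T.x1 - T.x0) :=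
    mul_le_mul_of_nonneg_left (min_le_left _ _) hσ
  have my : |σ| * min (T.x1 - T.x0) (T.y1 - T.y0) ≤ |σ| * (T.y1 - T.y0) :=
    mul_le_mul_of_nonneg_left (min_le_right _ _) hσ
  constructor
  · calc (T.x1 - T.x0) ^ 2 = (T.x1 - T.x0) * (T.x1 - T.x0) := sq _
      _ ≤ (T.x1 - T.x0) * (|σ| * (T.y1 - T.y0)) :=
        mul_le_mul_of_nonneg_left (dx.trans (h2.trans my)) hx.le
      _ = _ := by rw [Rect.area]; ring
  · calc (T.y1 - T.y0) ^ 2 = (T.y1 - T.y0) * (T.y1 - T.y0) := sq _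
      _ ≤ (T.y1 - T.y0) * (|σ| * (T.x1 - T.x0)) :=
        mul_le_mul_of_nonneg_left (dy.trans (h2.trans mx)) hy.le
      _ = _ := by rw [Rect.area]; ring

/-- On edges the bilinear interpolant is close to a Kirchhoff function. -/
theorem IsQ.bilinInterp_sub_sq_le (h : IsQ 3 T w) {τ : ℝ} (hτ : 0 ≤ τ)
    (hx2 : (T.x1 - T.x0) ^ 2 ≤ τ * T.area) (hy2 : (T.y1 - T.y0) ^ 2 ≤ τ * T.area) {x : Plane}
    (hx : x ∈ T.carrier)
    (hedge : (x.1 = T.x0 ∨ x.1 = T.x1) ∨ (x.2 = T.y0 ∨ x.2 = T.y1)) :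
    (bilinInterp T w x - w x) ^ 2 ≤ 324 * τ *
      ((∫ z in T.carrier, quadInterp T (pdOn 0 T w) z ^ 2) +
        ∫ z in T.carrier, quadInterp T (pdOn 1 T w) z ^ 2) := by
  have hnn : ∀ i, 0 ≤ ∫ z in T.carrier, quadInterp T (pdOn i T w) z ^ 2 :=
    fun i => integral_nonneg fun z => sq_nonneg _
  have hB := fun i z (hz : z ∈ T.carrier) => (isBiquad_quadInterp T (pdOn i T w)).abs_le hz
  -- A distance of at most 2rl, squared, is 4r²l². With l² bounded by τ times the area and the
  -- inverse estimate for r this gives 4 · 81 = 324.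
  have fin : ∀ (i : Fin 2) (l q : ℝ), l ^ 2 ≤ τ * T.area → |q| ≤ 2 *
      (Real.sqrt (81 * (∫ z in T.carrier, quadInterp T (pdOn i T w) z ^ 2) / T.area) * l) →
      q ^ 2 ≤ 324 * τ * ∫ z in T.carrier, quadInterp T (pdOn i T w) z ^ 2 := by
    intro i l q hl hq
    have hs := IsBiquad.sq_sqrt (T := T) (quadInterp T (pdOn i T w))
    set r := Real.sqrt (81 * (∫ z in T.carrier, quadInterp T (pdOn i T w) z ^ 2) / T.area)
    have h1 : q ^ 2 ≤ (2 * (r * l)) ^ 2 := by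
      rw [← sq_abs]; exact pow_le_pow_left₀ (abs_nonneg _) hq 2
    have h2 : (2 * (r * l)) ^ 2 ≤ 4 * r ^ 2 * (τ * T.area) := by
      have := mul_le_mul_of_nonneg_left hl (show 0 ≤ 4 * r ^ 2 by positivity)
      nlinarith
    have h3 : 4 * r ^ 2 * (τ * T.area) = 4 * τ * (T.area * r ^ 2) := by ring
    rw [hs] at h3
    linarith
  have one : (1 : ℝ) ∈ Icc (0 : ℝ) 1 := ⟨zero_le_one, le_rfl⟩
  rcases hedge with he | he
  · obtain ⟨a, ha⟩ := Rect.exists_pt_fst he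
    have ht := Rect.rely_mem hx
    set t := T.rely x
    have e1 := bilinInterp_vertical T w a t
    rw [← ha, Fin.sum_univ_two] at e1
    simp only [linShape, if_true, if_neg (one_ne_zero : (1 : Fin 2) ≠ 0), smul_eq_mul] at e1
    have b1 := h.abs_sub_le_snd (hB 1) a ht
    have b2 := h.abs_sub_le_snd (hB 1) a one
    rw [← ha] at b1
    rw [T.pt_one_right] at b2
    refine (fin 1 _ (bilinInterp T w x - w x) hy2 ?_).trans ?_
    · rw [e1]
      have : (1 - t) * w (T.vertex a 0) + t * w (T.vertex a 1) - w x =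
        t * (w (T.vertex a 1) - w (T.vertex a 0)) - (w x - w (T.vertex a 0)) := by ring
      rw [this]
      refine (abs_sub _ _).trans ?_
      rw [abs_mul, abs_of_nonneg ht.1]
      have : t * |w (T.vertex a 1) - w (T.vertex a 0)| ≤ |w (T.vertex a 1) - w (T.vertex a 0)| :=
        mul_le_of_le_one_left (abs_nonneg _) ht.2
      linarith
    · exact mul_le_mul_of_nonneg_left (le_add_of_nonneg_left (hnn 0)) (by positivity)
  · obtain ⟨b, hb⟩ := Rect.exists_pt_snd he
    have ht := Rect.relx_mem hx
    set t := T.relx x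
    have e1 := bilinInterp_horizontal T w t b
    rw [← hb, Fin.sum_univ_two] at e1
    simp only [linShape, if_true, if_neg (one_ne_zero : (1 : Fin 2) ≠ 0), smul_eq_mul] at e1
    have b1 := h.abs_sub_le_fst (hB 0) ht b
    have b2 := h.abs_sub_le_fst (hB 0) one b
    rw [← hb] at b1
    rw [T.pt_one_left] at b2
    refine (fin 0 _ (bilinInterp T w x - w x) hx2 ?_).trans ?_
    · rw [e1]
      have : (1 - t) * w (T.vertex 0 b) + t * w (T.vertex 1 b) - w x =
        t * (w (T.vertex 1 b) - w (T.vertex 0 b)) - (w x - w (T.vertex 0 b)) := by ring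
      rw [this]
      refine (abs_sub _ _).trans ?_
      rw [abs_mul, abs_of_nonneg ht.1]
      have : t * |w (T.vertex 1 b) - w (T.vertex 0 b)| ≤ |w (T.vertex 1 b) - w (T.vertex 0 b)| :=
        mul_le_of_le_one_left (abs_nonneg _) ht.2
      linarith
    · exact mul_le_mul_of_nonneg_left (le_add_of_nonneg_right (hnn 1)) (by positivity)

/-- Hermite interpolation: the two value functions are nonnegative with sum one, and each of the two
slope functions is bounded by the interval length. -/
theorem abs_cubic_le_hermite {c d s A B C E m n : ℝ} (hcd : c < d) (hs : s ∈ Icc c d)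
    (hc : |A + B * c + C * c ^ 2 + E * c ^ 3| ≤ m) (hd : |A + B * d + C * d ^ 2 + E * d ^ 3| ≤ m)
    (hc' : |B + 2 * C * c + 3 * E * c ^ 2| ≤ n) (hd' : |B + 2 * C * d + 3 * E * d ^ 2| ≤ n) :
    |A + B * s + C * s ^ 2 + E * s ^ 3| ≤ m + 2 * (d - c) * n := by
  obtain ⟨l, rfl⟩ : ∃ l, d = c + l := ⟨d - c, by ring⟩
  have hl : 0 < l := by linarith
  obtain ⟨r, rfl⟩ : ∃ r, s = c + l * r := ⟨(s - c) / l, by field_simp; ring⟩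
  have hr0 : 0 ≤ r := nonneg_of_mul_nonneg_right (by linarith [hs.1]) hl
  have hr1 : r ≤ 1 := le_of_mul_le_mul_left (by linarith [hs.2]) hl
  have hid : A + B * (c + l * r) + C * (c + l * r) ^ 2 + E * (c + l * r) ^ 3 =
      (1 + 2 * r) * (1 - r) ^ 2 * (A + B * c + C * c ^ 2 + E * c ^ 3) +
      r ^ 2 * (3 - 2 * r) * (A + B * (c + l) + C * (c + l) ^ 2 + E * (c + l) ^ 3) +
      r * (1 - r) ^ 2 * (l * (B + 2 * C * c + 3 * E * c ^ 2)) +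
      r ^ 2 * (r - 1) * (l * (B + 2 * C * (c + l) + 3 * E * (c + l) ^ 2)) := by ring
  rw [hid, add_sub_cancel_left]
  set p := A + B * c + C * c ^ 2 + E * c ^ 3
  set q := A + B * (c + l) + C * (c + l) ^ 2 + E * (c + l) ^ 3
  set p' := B + 2 * C * c + 3 * E * c ^ 2
  set q' := B + 2 * C * (c + l) + 3 * E * (c + l) ^ 2
  have hn : 0 ≤ n := (abs_nonneg _).trans hc'
  have k1 : 0 ≤ (1 + 2 * r) * (1 - r) ^ 2 := by positivity
  have k2 : 0 ≤ r ^ 2 * (3 - 2 * r) := mul_nonneg (sq_nonneg _) (by linarith)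
  have k3 : 0 ≤ r * (1 - r) ^ 2 := by positivity
  have k3' : r * (1 - r) ^ 2 ≤ 1 := by nlinarith [mul_nonneg hr0 (sub_nonneg.2 hr1)]
  have k4 : |r ^ 2 * (r - 1)| ≤ 1 := by
    rw [abs_le]; constructor <;> nlinarith [mul_nonneg hr0 (sub_nonneg.2 hr1), sq_nonneg r]
  have t1 : |(1 + 2 * r) * (1 - r) ^ 2 * p| ≤ (1 + 2 * r) * (1 - r) ^ 2 * m := by
    rw [abs_mul, abs_of_nonneg k1]; exact mul_le_mul_of_nonneg_left hc k1
  have t2 : |r ^ 2 * (3 - 2 * r) * q| ≤ r ^ 2 * (3 - 2 * r) * m := by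
    rw [abs_mul, abs_of_nonneg k2]; exact mul_le_mul_of_nonneg_left hd k2
  have t3 : |r * (1 - r) ^ 2 * (l * p')| ≤ l * n := by
    rw [abs_mul, abs_of_nonneg k3, abs_mul, abs_of_pos hl]
    have := mul_le_mul_of_nonneg_left hc' hl.le
    nlinarith [mul_nonneg hl.le (abs_nonneg p')]
  have t4 : |r ^ 2 * (r - 1) * (l * q')| ≤ l * n := by
    rw [abs_mul, abs_mul l, abs_of_pos hl]
    have := mul_le_mul_of_nonneg_left hd' hl.le
    nlinarith [mul_nonneg hl.le (abs_nonneg q')]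
  have hsum : (1 + 2 * r) * (1 - r) ^ 2 * m + r ^ 2 * (3 - 2 * r) * m = m := by ring
  refine (abs_add_le _ _).trans ?_
  have := abs_add_three ((1 + 2 * r) * (1 - r) ^ 2 * p) (r ^ 2 * (3 - 2 * r) * q)
    (r * (1 - r) ^ 2 * (l * p'))
  linarith

/-- Vertex values and vertex gradients bound a piecewise cubic function on edges. -/
theorem IsQ.abs_le_on_edge (h : IsQ 3 T w) {m n L : ℝ} (hLx : T.x1 - T.x0 ≤ L)
    (hLy : T.y1 - T.y0 ≤ L) (hm : ∀ a b, |w (T.vertex a b)| ≤ m)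
    (hn : ∀ i a b, |pdOn i T w (T.vertex a b)| ≤ n) {x : Plane} (hx : x ∈ T.carrier)
    (hedge : (x.1 = T.x0 ∨ x.1 = T.x1) ∨ (x.2 = T.y0 ∨ x.2 = T.y1)) :
    |w x| ≤ m + 2 * L * n := by
  have hn0 : 0 ≤ n := (abs_nonneg _).trans (hn 0 0 0)
  rcases hedge with he | he
  · obtain ⟨A, B, C, E, hl⟩ := h.line_snd hx.1
    obtain ⟨a, ha⟩ := Rect.exists_pt_fst he
    have hx1 : x.1 = (T.vertex a 0).1 := (Prod.ext_iff.1 ha).1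
    have v0 : T.vertex a 0 = (x.1, T.y0) := Prod.ext hx1.symm (by simp [Rect.vertex, Rect.pt])
    have v1 : T.vertex a 1 = (x.1, T.y1) := Prod.ext hx1.symm (by simp [Rect.vertex, Rect.pt])
    have l0 := hl T.y0 (left_mem_Icc.2 T.hy.le)
    have l1 := hl T.y1 (right_mem_Icc.2 T.hy.le)
    have m0 := hm a 0
    have m1 := hm a 1
    have n0 := hn 1 a 0
    have n1 := hn 1 a 1
    rw [v0, l0.1] at m0
    rw [v1, l1.1] at m1
    rw [v0, l0.2] at n0
    rw [v1, l1.2] at n1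
    have := abs_cubic_le_hermite T.hy hx.2 m0 m1 n0 n1
    rw [← (hl x.2 hx.2).1] at this
    refine this.trans ?_
    gcongr
  · obtain ⟨A, B, C, E, hl⟩ := h.line_fst hx.2
    obtain ⟨b, hb⟩ := Rect.exists_pt_snd he
    have hx2 : x.2 = (T.vertex 0 b).2 := (Prod.ext_iff.1 hb).2
    have v0 : T.vertex 0 b = (T.x0, x.2) := Prod.ext (by simp [Rect.vertex, Rect.pt]) hx2.symm
    have v1 : T.vertex 1 b = (T.x1, x.2) := Prod.ext (by simp [Rect.vertex, Rect.pt]) hx2.symm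
    have l0 := hl T.x0 (left_mem_Icc.2 T.hx.le)
    have l1 := hl T.x1 (right_mem_Icc.2 T.hx.le)
    have m0 := hm 0 b
    have m1 := hm 1 b
    have n0 := hn 0 0 b
    have n1 := hn 0 1 b
    rw [v0, l0.1] at m0
    rw [v1, l1.1] at m1
    rw [v0, l0.2] at n0
    rw [v1, l1.2] at n1
    have := abs_cubic_le_hermite T.hx hx.1 m0 m1 n0 n1
    rw [← (hl x.1 hx.1).1] at this
    refine this.trans ?_
    gcongr

/-- Nine nodal values, each at most K in modulus, with shape functions bounded by one on the unit
interval. -/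
theorem abs_quadInterp_le {ψ : Plane → ℝ} {K : ℝ} (hψ : ∀ x ∈ T.carrier, |ψ x| ≤ K) {x : Plane}
    (hx : x ∈ T.carrier) : |quadInterp T ψ x| ≤ 9 * K := by
  have hsh : ∀ (a : Fin 3) (s : ℝ), s ∈ Icc (0 : ℝ) 1 → |quadShape a s| ≤ 1 := by
    intro a s hs
    have := mul_nonneg hs.1 (sub_nonneg.2 hs.2)
    have := sq_nonneg (2 * s - 1)
    rw [abs_le]
    fin_cases a <;> simp [quadShape] <;> constructor <;> nlinarith [hs.1, hs.2]
  have hN : ∀ a b, |quadNodal T ψ a b| ≤ K := by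
    intro a b
    unfold quadNodal
    split_ifs
    · have h := fun c d => hψ _ (T.vertex_mem c d)
      simp only [Fin.sum_univ_two, smul_eq_mul]
      have h00 := h 0 0
      have h01 := h 0 1
      have h10 := h 1 0
      have h11 := h 1 1
      rw [abs_le] at *
      constructor <;> linarith [h00.1, h00.2, h01.1, h01.2, h10.1, h10.2, h11.1, h11.2]
    · exact hψ _ (Rect.pt_mem (Rect.half_mem_unit a) (Rect.half_mem_unit b))
  have hK : 0 ≤ K := (abs_nonneg _).trans (hψ x hx)
  have hterm : ∀ a b, |(quadShape a (T.relx x) * quadShape b (T.rely x)) • quadNodal T ψ a b| ≤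
      K := by
    intro a b
    rw [smul_eq_mul, abs_mul, abs_mul]
    have h1 := mul_le_one₀ (hsh a _ (Rect.relx_mem hx)) (abs_nonneg _)
      (hsh b _ (Rect.rely_mem hx))
    exact (mul_le_mul h1 (hN a b) (abs_nonneg _) zero_le_one).trans (one_mul K).le
  unfold quadInterp
  refine (Finset.abs_sum_le_sum_abs _ _).trans ((Finset.sum_le_sum fun a _ =>
    (Finset.abs_sum_le_sum_abs _ _).trans (Finset.sum_le_sum fun b _ => hterm a b)).trans ?_)
  simp
  linarith

end Elementwise

/-! ### Control of vertex values -/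

theorem vertexSum_mono {𝒯 : Finset Rect} {F G : Rect → Plane → ℝ}
    (h : ∀ T ∈ 𝒯, ∀ a b, F T (T.vertex a b) ≤ G T (T.vertex a b)) :
    vertexSum 𝒯 F ≤ vertexSum 𝒯 G :=
  Finset.sum_le_sum fun T hT => mul_le_mul_of_nonneg_left
    (Finset.sum_le_sum fun a _ => Finset.sum_le_sum fun b _ => h T hT a b)
    (div_nonneg T.area_pos.le (by norm_num))

theorem vertexSum_add (𝒯 : Finset Rect) (F G : Rect → Plane → ℝ) :
    vertexSum 𝒯 (fun T z => F T z + G T z) = vertexSum 𝒯 F + vertexSum 𝒯 G := by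
  simp only [vertexSum, Finset.sum_add_distrib, mul_add]

theorem vertexSum_const_mul (𝒯 : Finset Rect) (c : ℝ) (F : Rect → Plane → ℝ) :
    vertexSum 𝒯 (fun T z => c * F T z) = c * vertexSum 𝒯 F := by
  simp only [vertexSum, ← Finset.mul_sum]
  rw [Finset.mul_sum]
  exact Finset.sum_congr rfl fun T _ => by ring

theorem vertexSum_sum {ι : Type} [Fintype ι] (𝒯 : Finset Rect) (F : ι → Rect → Plane → ℝ) :
    vertexSum 𝒯 (fun T z => ∑ k, F k T z) = ∑ k, vertexSum 𝒯 (F k) := by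
  simp only [vertexSum]
  rw [Finset.sum_comm]
  refine Finset.sum_congr rfl fun T _ => ?_
  rw [← Finset.mul_sum]
  congr 1
  rw [Finset.sum_comm]
  simp only [Finset.sum_comm (s := (Finset.univ : Finset ι))]
  rw [Finset.sum_comm]

theorem IsConformingMesh.vertexSum_const {ω : Set Plane} {𝒯 : Finset Rect}
    (h : IsConformingMesh ω 𝒯) (c : ℝ) :
    vertexSum 𝒯 (fun _ _ => c) = c * volume.real (closure ω) := by
  rw [← h.sum_area, Finset.mul_sum, vertexSum]
  refine Finset.sum_congr rfl fun T _ => ?_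
  simp only [Fin.sum_univ_two]
  ring

/-- Four vertices with weight one quarter of the area: an elementwise bound passes to the sum
without loss. -/
theorem vertexSum_le_of_area_mul_le {𝒯 : Finset Rect} {F : Rect → Plane → ℝ} {I : Rect → ℝ}
    (h : ∀ T ∈ 𝒯, ∀ a b, T.area * F T (T.vertex a b) ≤ I T) : vertexSum 𝒯 F ≤ ∑ T ∈ 𝒯, I T := by
  refine Finset.sum_le_sum fun T hT => ?_
  simp only [Fin.sum_univ_two]
  linarith [h T hT 0 0, h T hT 0 1, h T hT 1 0, h T hT 1 1]

/-- The squared norm of the elementwise gradient of the discrete gradient of a scalar function. -/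
noncomputable def scalarHess (𝒯 : Finset Rect) (w : Plane → ℝ) : ℝ :=
  ∑ i : Fin 2, ∑ j : Fin 2, ∑ T ∈ 𝒯, ∫ x in T.carrier, pdOn i T (quadInterp T (pdOn j T w)) x ^ 2

/-- Friedrichs' inequality is used twice: the second derivatives bound the discrete gradient, which
then bounds the bilinear interpolant and thereby the vertex values. -/
theorem exists_vertexSum_sq_le {ω ΓD : Set Plane} (hω : interior (closure ω) = ω)
    (hconn : IsConnected ω) (hΓ : ΓD ⊆ frontier ω)
    (hΓpos : 0 < Measure.hausdorffMeasure 1 ΓD) (σ : ℝ) :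
    ∃ κ : ℝ, 0 ≤ κ ∧ ∀ 𝒯 : Finset Rect, IsConformingMesh ω 𝒯 → ShapeRegular σ 𝒯 →
      ∀ w : Plane → ℝ, InW ω 𝒯 w → ∀ M₀ M₁ : ℝ, 0 ≤ M₀ → (∀ x ∈ ΓD, |w x| ≤ M₀) →
      (∀ j, ∀ T ∈ 𝒯, ∀ x ∈ ΓD ∩ T.carrier, |quadInterp T (pdOn j T w) x| ≤ M₁) →
      vertexSum 𝒯 (fun _ z => w z ^ 2) ≤ κ * (M₀ ^ 2 + M₁ ^ 2 + scalarHess 𝒯 w) := by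
  obtain ⟨κ, hκ, hF⟩ := exists_friedrichs_family hω hconn hΓ hΓpos
  have hσ := abs_nonneg σ
  refine ⟨81 * κ * (2 + 2 * (648 * |σ| + 81) * κ), by positivity, ?_⟩
  intro 𝒯 h hreg w hw M₀ M₁ hM₀ hb₀ hb₁
  set F : Fin 2 → ℝ := fun j => ∑ T ∈ 𝒯, ∫ x in T.carrier, quadInterp T (pdOn j T w) x ^ 2
  have hFnn : ∀ j, 0 ≤ F j := fun j => Finset.sum_nonneg fun T _ =>
    integral_nonneg fun x => sq_nonneg _
  have hgrad := fun j => hF 𝒯 h (fun T => quadInterp T (pdOn j T w))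
    (fun T hT T' hT' x hx hx' => quadInterp_pdOn_consistent h hw hT hT' hx hx' j)
    (fun T _ => (contDiff_quadInterp T _).contDiffOn) M₁ (hb₁ j)
  -- First use, for both columns of the discrete gradient.
  have hH : F 0 + F 1 ≤ κ * (2 * M₁ ^ 2 + scalarHess 𝒯 w) := by
    have g0 := hgrad 0
    have g1 := hgrad 1
    simp only [scalarHess, Fin.sum_univ_two]
    simp only [F]
    linarith
  -- The boundary condition prescribes `w`, not its bilinear interpolant; the root bounds their
  -- difference on edges.
  set M₂ := M₀ + Real.sqrt (324 * |σ| * (F 0 + F 1))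
  have hM₂ : M₂ ^ 2 ≤ 2 * M₀ ^ 2 + 648 * |σ| * (F 0 + F 1) := by
    have h0 : 0 ≤ 324 * |σ| * (F 0 + F 1) :=
      mul_nonneg (by positivity) (add_nonneg (hFnn 0) (hFnn 1))
    have h1 := Real.sq_sqrt h0
    have h2 : M₂ = M₀ + Real.sqrt (324 * |σ| * (F 0 + F 1)) := rfl
    nlinarith [sq_nonneg (M₀ - Real.sqrt (324 * |σ| * (F 0 + F 1)))]
  have hbdry : ∀ T ∈ 𝒯, ∀ x ∈ ΓD ∩ T.carrier, |bilinInterp T w x| ≤ M₂ := by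
    rintro T hT x ⟨hxΓ, hxT⟩
    have hr := hreg.sq_le hT
    have h1 := (hw.poly T hT).bilinInterp_sub_sq_le hσ hr.1 hr.2 hxT
      (h.mem_edge hω (hΓ hxΓ) hT hxT)
    have hle : ∀ j, ∫ z in T.carrier, quadInterp T (pdOn j T w) z ^ 2 ≤ F j := fun j =>
      Finset.single_le_sum (f := fun T : Rect => ∫ z in T.carrier, quadInterp T (pdOn j T w) z ^ 2)
        (fun T _ => integral_nonneg fun x => sq_nonneg _) hT
    have h2 : (bilinInterp T w x - w x) ^ 2 ≤ 324 * |σ| * (F 0 + F 1) :=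
      h1.trans (mul_le_mul_of_nonneg_left (add_le_add (hle 0) (hle 1)) (by positivity))
    have h3 : |bilinInterp T w x - w x| ≤ Real.sqrt (324 * |σ| * (F 0 + F 1)) := by
      rw [← Real.sqrt_sq_eq_abs]; exact Real.sqrt_le_sqrt h2
    have h4 := hb₀ x hxΓ
    have h5 : bilinInterp T w x = w x + (bilinInterp T w x - w x) := by ring
    rw [h5]
    exact (abs_add_le _ _).trans (add_le_add h4 h3)
  have hbil := hF 𝒯 h (fun T => bilinInterp T w)
    (fun T hT T' hT' x hx hx' => bilinInterp_consistent h w hT hT' hx hx')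
    (fun T _ => (contDiff_bilinInterp T _).contDiffOn) M₂ hbdry
  have hpd : ∀ i, ∑ T ∈ 𝒯, ∫ x in T.carrier, pdOn i T (bilinInterp T w) x ^ 2 ≤ 81 * F i := by
    intro i
    rw [Finset.mul_sum]
    exact Finset.sum_le_sum fun T hT => (hw.poly T hT).setIntegral_pdOn_bilinInterp_sq_le i
  -- At vertices `w` and its interpolant agree, and the interpolant satisfies the inverse estimate.
  have hvs : vertexSum 𝒯 (fun _ z => w z ^ 2) ≤
      81 * ∑ T ∈ 𝒯, ∫ x in T.carrier, bilinInterp T w x ^ 2 := by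
    rw [Finset.mul_sum]
    refine vertexSum_le_of_area_mul_le fun T _ a b => ?_
    have := (isBiquad_bilinInterp T w).area_mul_sq_le (T.vertex_mem a b)
    rwa [bilinInterp_vertex] at this
  have hHnn : 0 ≤ scalarHess 𝒯 w := Finset.sum_nonneg fun i _ => Finset.sum_nonneg fun j _ =>
    Finset.sum_nonneg fun T _ => integral_nonneg fun x => sq_nonneg _
  calc vertexSum 𝒯 (fun _ z => w z ^ 2)
      ≤ 81 * (κ * (M₂ ^ 2 + 81 * F 0 + 81 * F 1)) := by
        refine hvs.trans (mul_le_mul_of_nonneg_left (hbil.trans ?_) (by norm_num))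
        exact mul_le_mul_of_nonneg_left (by linarith [hpd 0, hpd 1]) hκ
    _ ≤ 81 * (κ * (2 * M₀ ^ 2 + (648 * |σ| + 81) * (F 0 + F 1))) := by
        refine mul_le_mul_of_nonneg_left (mul_le_mul_of_nonneg_left ?_ hκ) (by norm_num)
        linarith
    _ ≤ 81 * (κ * (2 * M₀ ^ 2 + (648 * |σ| + 81) * (κ * (2 * M₁ ^ 2 + scalarHess 𝒯 w)))) := by
        gcongr
    _ ≤ _ := by
        -- The constant is rounded up to treat the three quantities alike; the excess is visibly
        -- nonnegative.
        have e : 81 * κ * (2 + 2 * (648 * |σ| + 81) * κ) * (M₀ ^ 2 + M₁ ^ 2 + scalarHess 𝒯 w) -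
          81 * (κ * (2 * M₀ ^ 2 + (648 * |σ| + 81) * (κ * (2 * M₁ ^ 2 + scalarHess 𝒯 w)))) =
          81 * κ * (2 * (M₁ ^ 2 + scalarHess 𝒯 w) + (648 * |σ| + 81) * κ *
            (2 * M₀ ^ 2 + scalarHess 𝒯 w)) := by ring
        have : 0 ≤ 81 * κ * (2 * (M₁ ^ 2 + scalarHess 𝒯 w) + (648 * |σ| + 81) * κ *
            (2 * M₀ ^ 2 + scalarHess 𝒯 w)) := by positivity
        linarith

/-! ### Reduction of vector quantities to scalar components -/

section Components

variable {T : Rect} {y : Plane → Vec}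

theorem contDiffOn_of_components (h : ∀ k, IsQ 3 T fun x => y x k) : ContDiffOn ℝ 1 y T.carrier :=
  contDiffOn_pi.2 fun k => (h k).contDiffOn

theorem discGrad_apply (h : ∀ k, IsQ 3 T fun x => y x k) (j : Fin 2) (k : Fin 3) :
    (fun x => discGrad T y j x k) = quadInterp T (pdOn j T fun x => y x k) := by
  funext x
  rw [discGrad, quadInterp_apply]
  exact quadInterp_congr (fun z hz => pdOn_apply hz
    ((contDiffOn_of_components h).differentiableOn one_ne_zero z hz) j k) x

theorem pdOn_discGrad_apply (h : ∀ k, IsQ 3 T fun x => y x k) (i j : Fin 2) (k : Fin 3)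
    {x : Plane} (hx : x ∈ T.carrier) :
    pdOn i T (discGrad T y j) x k = pdOn i T (quadInterp T (pdOn j T fun x => y x k)) x := by
  rw [pdOn_apply hx (((contDiff_quadInterp T _).differentiable one_ne_zero) x).differentiableWithinAt,
    discGrad_apply h]

theorem pdOn_bilinInterp_discGrad_apply (h : ∀ k, IsQ 3 T fun x => y x k) (i j : Fin 2)
    (k : Fin 3) {x : Plane} (hx : x ∈ T.carrier) :
    pdOn i T (bilinInterp T (discGrad T y j)) x k =
      pdOn i T (bilinInterp T (quadInterp T (pdOn j T fun x => y x k))) x := by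
  rw [pdOn_apply hx
    (((contDiff_bilinInterp T _).differentiable one_ne_zero) x).differentiableWithinAt]
  simp only [bilinInterp_apply, discGrad_apply h]

end Components

theorem vnorm_sq (v : Vec) : vnorm v ^ 2 = ∑ k, v k ^ 2 := by
  rw [vnorm, Real.sq_sqrt]
  · simp only [dotProduct, sq]
  · exact Finset.sum_nonneg fun k _ => mul_self_nonneg _

theorem integrableOn_pdOn_quadInterp_sq (T : Rect) (ψ : Plane → ℝ) (i : Fin 2) :
    IntegrableOn (fun x => pdOn i T (quadInterp T ψ) x ^ 2) T.carrier :=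
  ((continuousOn_pdOn (contDiff_quadInterp T ψ).contDiffOn i).pow 2).integrableOn_compact
    T.isCompact_carrier

theorem hessSq_eq_sum {𝒯 : Finset Rect} {y : Plane → Vec}
    (h : ∀ T ∈ 𝒯, ∀ k, IsQ 3 T fun x => y x k) :
    hessSq 𝒯 y = ∑ k, scalarHess 𝒯 fun x => y x k := by
  have key : ∀ T ∈ 𝒯, ∫ x in T.carrier, ∑ i, ∑ j, vnorm (pdOn i T (discGrad T y j) x) ^ 2 =
      ∑ i : Fin 2, ∑ j : Fin 2, ∑ k,
        ∫ x in T.carrier, pdOn i T (quadInterp T (pdOn j T fun x => y x k)) x ^ 2 := by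
    intro T hT
    have hI := fun i j (k : Fin 3) =>
      integrableOn_pdOn_quadInterp_sq T (pdOn j T fun x => y x k) i
    rw [setIntegral_congr_fun (g := fun x => ∑ i : Fin 2, ∑ j : Fin 2, ∑ k : Fin 3,
      pdOn i T (quadInterp T (pdOn j T fun x => y x k)) x ^ 2) T.measurableSet_carrier
      fun x hx => by simp only [vnorm_sq, pdOn_discGrad_apply (h T hT) _ _ _ hx]]
    rw [integral_finsetSum _ fun i _ => integrable_finsetSum _ fun j _ =>
      integrable_finsetSum _ fun k _ => hI i j k]
    refine Finset.sum_congr rfl fun i _ => ?_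
    rw [integral_finsetSum _ fun j _ => integrable_finsetSum _ fun k _ => hI i j k]
    refine Finset.sum_congr rfl fun j _ => ?_
    rw [integral_finsetSum _ fun k _ => hI i j k]
  rw [hessSq, Finset.sum_congr rfl key]
  simp only [scalarHess, Fin.sum_univ_two, Fin.sum_univ_three, Finset.sum_add_distrib]
  ring

/-- The discrete norm of the gradient of the bilinear interpolant of the discrete gradient. -/
theorem sum_vertexSum_dotProduct_le {𝒯 : Finset Rect} {y : Plane → Vec}
    (h : ∀ T ∈ 𝒯, ∀ k, IsQ 3 T fun x => y x k) :
    ∑ i, ∑ j, vertexSum 𝒯 (fun T z => pdOn i T (bilinInterp T (discGrad T y j)) z ⬝ᵥ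
      pdOn i T (bilinInterp T (discGrad T y j)) z) ≤ 81 * hessSq 𝒯 y := by
  have key : ∀ i j : Fin 2, vertexSum 𝒯 (fun T z =>
      pdOn i T (bilinInterp T (discGrad T y j)) z ⬝ᵥ pdOn i T (bilinInterp T (discGrad T y j)) z) ≤
      81 * ∑ k, ∑ T ∈ 𝒯,
        ∫ x in T.carrier, pdOn i T (quadInterp T (pdOn j T fun x => y x k)) x ^ 2 := by
    intro i j
    simp only [dotProduct]
    rw [vertexSum_sum 𝒯 fun k T z => pdOn i T (bilinInterp T (discGrad T y j)) z k *
      pdOn i T (bilinInterp T (discGrad T y j)) z k, Finset.mul_sum]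
    refine Finset.sum_le_sum fun k _ => ?_
    rw [Finset.mul_sum]
    refine vertexSum_le_of_area_mul_le fun T hT a b => ?_
    rw [← sq, pdOn_bilinInterp_discGrad_apply (h T hT) i j k (T.vertex_mem a b)]
    exact area_mul_pdOn_bilinInterp_quadInterp_sq_le T _ i (T.vertex_mem a b)
  refine (Finset.sum_le_sum fun i _ => Finset.sum_le_sum fun j _ => key i j).trans (le_of_eq ?_)
  rw [hessSq_eq_sum h]
  simp only [scalarHess, Fin.sum_univ_two, Fin.sum_univ_three]
  ring

/-! ### Pointwise inequalities for the discrete normal and the load -/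

section Pointwise

theorem sq_dotProduct_le (v w : Vec) : (v ⬝ᵥ w) ^ 2 ≤ (v ⬝ᵥ v) * (w ⬝ᵥ w) := by
  have := Finset.sum_mul_sq_le_sq_mul_sq Finset.univ v w
  simpa only [dotProduct, sq] using this

theorem normalize_dotProduct_self_le (v : Vec) :
    ((vnorm v)⁻¹ • v) ⬝ᵥ ((vnorm v)⁻¹ • v) ≤ 1 := by
  have h0 : 0 ≤ v ⬝ᵥ v := Finset.sum_nonneg fun k _ => mul_self_nonneg _
  have h1 : vnorm v ^ 2 = v ⬝ᵥ v := Real.sq_sqrt h0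
  rw [smul_dotProduct, dotProduct_smul, ← h1, smul_eq_mul, smul_eq_mul]
  -- A vanishing column is harmless: the inverse of zero is zero, so the normalized vector is zero.
  rcases eq_or_ne (vnorm v) 0 with h | h
  · simp [h]
  · field_simp
    rfl

theorem crossProduct_dotProduct_self_le (v w : Vec) :
    crossProduct v w ⬝ᵥ crossProduct v w ≤ (v ⬝ᵥ v) * (w ⬝ᵥ w) := by
  rw [cross_dot_cross, dotProduct_comm w v]
  nlinarith [mul_self_nonneg (v ⬝ᵥ w)]

theorem discNormal_dotProduct_self_le (T : Rect) (y : Plane → Vec) (z : Plane) :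
    discNormal T y z ⬝ᵥ discNormal T y z ≤ 1 :=
  (crossProduct_dotProduct_self_le _ _).trans
    (mul_le_one₀ (normalize_dotProduct_self_le _)
      (Finset.sum_nonneg fun _ _ => mul_self_nonneg _) (normalize_dotProduct_self_le _))

/-- Young's inequality with weight ε in completed-square form, after the length of the discrete
normal has been bounded by one. -/
theorem neg_le_dotProduct_discNormal_mul (T : Rect) (y : Plane → Vec) (z : Plane) (v : Vec)
    (c : ℝ) {ε : ℝ} (hε : 0 < ε) :
    -(ε * (v ⬝ᵥ v) + c ^ 2 / (4 * ε)) ≤ (v ⬝ᵥ discNormal T y z) * c := by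
  have h1 : (v ⬝ᵥ discNormal T y z) ^ 2 ≤ v ⬝ᵥ v :=
    (sq_dotProduct_le _ _).trans (mul_le_of_le_one_right
      (Finset.sum_nonneg fun _ _ => mul_self_nonneg _) (discNormal_dotProduct_self_le T y z))
  set q := v ⬝ᵥ discNormal T y z
  have h2 : ε * q ^ 2 + c ^ 2 / (4 * ε) + q * c = (2 * ε * q + c) ^ 2 / (4 * ε) := by
    field_simp
    ring
  have h3 : 0 ≤ (2 * ε * q + c) ^ 2 / (4 * ε) := by positivity
  have h4 := mul_le_mul_of_nonneg_left h1 hε.le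
  linarith

theorem dotProduct_le_add (v w : Vec) {ε : ℝ} (hε : 0 < ε) :
    v ⬝ᵥ w ≤ ε * (w ⬝ᵥ w) + (v ⬝ᵥ v) / (4 * ε) := by
  have h : ∀ a b : ℝ, a * b ≤ ε * (b * b) + a * a / (4 * ε) := by
    intro a b
    have h2 : ε * (b * b) + a * a / (4 * ε) - a * b = (2 * ε * b - a) ^ 2 / (4 * ε) := by
      field_simp
      ring
    have h3 : 0 ≤ (2 * ε * b - a) ^ 2 / (4 * ε) := by positivity
    linarith
  simp only [dotProduct, Finset.mul_sum, Finset.sum_div, ← Finset.sum_add_distrib]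
  exact Finset.sum_le_sum fun k _ => h _ _

end Pointwise

/-! ### From essential bounds to vertex values, and the coupling and load terms -/

theorem Rect.abs_le_of_eLpNorm_top_le (T : Rect) {F : Plane → ℝ} (hF : ContinuousOn F T.carrier)
    {M : ℝ} (hM : 0 ≤ M)
    (h : eLpNorm F ∞ (volume.restrict T.carrier) ≤ ENNReal.ofReal M) {x : Plane}
    (hx : x ∈ T.carrier) : |F x| ≤ M := by
  have h1 : ∀ᵐ z ∂volume.restrict (interior T.carrier), |F z| ≤ M := by
    have h0 : ∀ᵐ z ∂volume.restrict T.carrier, |F z| ≤ M := by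
      rw [eLpNorm_exponent_top] at h
      filter_upwards [enorm_ae_le_eLpNormEssSup F (volume.restrict T.carrier)] with z hz
      have := hz.trans h
      rwa [← ofReal_norm, ENNReal.ofReal_le_ofReal_iff hM] at this
    exact ae_mono (Measure.restrict_mono interior_subset le_rfl) h0
  -- Written as an equality of continuous functions, the almost everywhere bound holds everywhere on
  -- the open rectangle, and then on its closure, vertices included.
  have h2 : EqOn (fun z => max |F z| M) (fun _ => M) (interior T.carrier) :=
    Measure.eqOn_open_of_ae_eq (h1.mono fun z hz => max_eq_right hz) isOpen_interior
      (ContinuousOn.sup (hF.mono interior_subset).abs continuousOn_const) continuousOn_const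
  have h3 : EqOn (fun z => max |F z| M) (fun _ => M) T.carrier :=
    h2.of_subset_closure (ContinuousOn.sup hF.abs continuousOn_const) continuousOn_const interior_subset
      T.closure_interior.ge
  exact max_eq_right_iff.1 (h3 hx)

/-- The maximum with zero reflects that `ENNReal.ofReal` truncates a negative bound to zero. -/
theorem abs_le_of_brokenLinfty_le {𝒯 : Finset Rect} {g : Rect → Plane → ℝ} {M : ℝ}
    (h : brokenLinfty 𝒯 g ≤ ENNReal.ofReal M) {T : Rect} (hT : T ∈ 𝒯)
    (hg : ContinuousOn (g T) T.carrier) {x : Plane} (hx : x ∈ T.carrier) :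
    |g T x| ≤ max M 0 := by
  refine T.abs_le_of_eLpNorm_top_le hg (le_max_right _ _) ?_ hx
  refine (le_iSup₂ (f := fun T (_ : T ∈ 𝒯) => eLpNorm (g T) ∞ (volume.restrict T.carrier))
    T hT).trans (h.trans (ENNReal.ofReal_le_ofReal (le_max_left _ _)))

theorem continuousOn_frob {s : Set Plane} {Z : Plane → Matrix (Fin 2) (Fin 2) ℝ}
    (hZ : ContinuousOn Z s) : ContinuousOn (fun x => frob (Z x)) s :=
  Real.continuous_sqrt.comp_continuousOn (continuousOn_finsetSum _ fun i _ =>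
    continuousOn_finsetSum _ fun j _ => (((continuous_apply_apply i j).comp_continuousOn hZ).pow 2))

theorem continuousOn_vnorm {s : Set Plane} {f : Plane → Vec}
    (hf : ContinuousOn f s) : ContinuousOn (fun x => vnorm (f x)) s :=
  Real.continuous_sqrt.comp_continuousOn (continuousOn_finsetSum _ fun k _ =>
    ((continuous_apply k).comp_continuousOn hf).mul ((continuous_apply k).comp_continuousOn hf))

theorem sq_le_frob_sq (A : Matrix (Fin 2) (Fin 2) ℝ) (i j : Fin 2) : A i j ^ 2 ≤ frob A ^ 2 := by
  have h0 : frob A ^ 2 = ∑ i, ∑ j, A i j ^ 2 :=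
    Real.sq_sqrt (Finset.sum_nonneg fun i _ => Finset.sum_nonneg fun j _ => sq_nonneg (A i j))
  rw [h0]
  exact (Finset.single_le_sum (f := fun j => A i j ^ 2) (fun _ _ => sq_nonneg _)
    (Finset.mem_univ j)).trans (Finset.single_le_sum (f := fun i => ∑ j, A i j ^ 2)
    (fun _ _ => Finset.sum_nonneg fun _ _ => sq_nonneg _) (Finset.mem_univ i))

/-- The coupling term of the discrete energy is controlled by the bending term. -/
theorem neg_le_coupling {ω : Set Plane} {𝒯 : Finset Rect} (h𝒯 : IsConformingMesh ω 𝒯)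
    {y : Plane → Vec} (h : ∀ T ∈ 𝒯, ∀ k, IsQ 3 T fun x => y x k)
    {Z : Rect → Plane → Matrix (Fin 2) (Fin 2) ℝ} {M : ℝ}
    (hZ : ∀ T ∈ 𝒯, ∀ x ∈ T.carrier, ∀ i j, Z T x i j ^ 2 ≤ M ^ 2) :
    -(hessSq 𝒯 y / 8 + 648 * M ^ 2 * volume.real (closure ω)) ≤
      ∑ i, ∑ j, vertexSum 𝒯 (fun T z =>
        (pdOn i T (bilinInterp T (discGrad T y j)) z ⬝ᵥ discNormal T y z) * Z T z i j) := by
  -- Chosen so that 81 · (1/648) = 1/8. The price is 1/(4ε) = 162 for each of the four index pairs,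
  -- together 648.
  have hε : (0 : ℝ) < 1 / 648 := by norm_num
  have key : ∀ i j : Fin 2, -(1 / 648) * vertexSum 𝒯 (fun T z =>
      pdOn i T (bilinInterp T (discGrad T y j)) z ⬝ᵥ pdOn i T (bilinInterp T (discGrad T y j)) z) -
      162 * M ^ 2 * volume.real (closure ω) ≤ vertexSum 𝒯 (fun T z =>
        (pdOn i T (bilinInterp T (discGrad T y j)) z ⬝ᵥ discNormal T y z) * Z T z i j) := by
    intro i j
    rw [sub_eq_add_neg, ← neg_mul, ← h𝒯.vertexSum_const, ← vertexSum_const_mul, ← vertexSum_add]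
    refine vertexSum_mono fun T hT a b => ?_
    have h1 := neg_le_dotProduct_discNormal_mul T y (T.vertex a b)
      (pdOn i T (bilinInterp T (discGrad T y j)) (T.vertex a b)) (Z T (T.vertex a b) i j) hε
    have h2 := hZ T hT _ (T.vertex_mem a b) i j
    refine le_trans ?_ h1
    generalize pdOn i T (bilinInterp T (discGrad T y j)) (T.vertex a b) ⬝ᵥ
      pdOn i T (bilinInterp T (discGrad T y j)) (T.vertex a b) = q
    generalize Z T (T.vertex a b) i j ^ 2 = r at h2 ⊢
    have h3 : r / (4 * (1 / 648)) = 162 * r := by ring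
    rw [h3]
    linarith only [h2]
  have hs := sum_vertexSum_dotProduct_le h
  simp only [Fin.sum_univ_two] at hs ⊢
  linarith [key 0 0, key 0 1, key 1 0, key 1 1]

theorem hessSq_nonneg (𝒯 : Finset Rect) (y : Plane → Vec) : 0 ≤ hessSq 𝒯 y :=
  Finset.sum_nonneg fun _ _ => integral_nonneg fun _ => Finset.sum_nonneg fun _ _ =>
    Finset.sum_nonneg fun _ _ => sq_nonneg _

theorem dotProduct_le_of_vnorm_le {v : Vec} {M : ℝ} (h : |vnorm v| ≤ M) : v ⬝ᵥ v ≤ M ^ 2 := by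
  rw [← Real.sq_sqrt (show 0 ≤ v ⬝ᵥ v from Finset.sum_nonneg fun _ _ => mul_self_nonneg _)]
  exact sq_le_sq' (abs_le.1 h).1 (abs_le.1 h).2

theorem vertexSum_force_le {ω : Set Plane} {𝒯 : Finset Rect} (h𝒯 : IsConformingMesh ω 𝒯)
    {y : Plane → Vec} {f : Rect → Plane → Vec} {M ε : ℝ} (hε : 0 < ε)
    (hf : ∀ T ∈ 𝒯, ∀ x ∈ T.carrier, |vnorm (f T x)| ≤ M) :
    vertexSum 𝒯 (fun T z => f T z ⬝ᵥ y z) ≤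
      ε * ∑ k, vertexSum 𝒯 (fun _ z => y z k ^ 2) + M ^ 2 / (4 * ε) * volume.real (closure ω) := by
  rw [← h𝒯.vertexSum_const, ← vertexSum_sum 𝒯 fun k _ z => y z k ^ 2, ← vertexSum_const_mul,
    ← vertexSum_add]
  refine vertexSum_mono fun T hT a b => ?_
  have h1 := dotProduct_le_add (f T (T.vertex a b)) (y (T.vertex a b)) hε
  have h2 := dotProduct_le_of_vnorm_le (hf T hT _ (T.vertex_mem a b))
  have h3 : f T (T.vertex a b) ⬝ᵥ f T (T.vertex a b) / (4 * ε) ≤ M ^ 2 / (4 * ε) := by gcongr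
  simp only [dotProduct, sq] at *
  linarith

/-! ### Bounds for the discrete boundary data -/

theorem IsConformingMesh.side_le_diam {ω : Set Plane} {𝒯 : Finset Rect}
    (h : IsConformingMesh ω 𝒯) {T : Rect} (hT : T ∈ 𝒯) :
    T.x1 - T.x0 ≤ Metric.diam (closure ω) ∧ T.y1 - T.y0 ≤ Metric.diam (closure ω) := by
  have hs := h.carrier_subset hT
  have hx := T.hx.le
  have hy := T.hy.le
  have h1 : ((T.x1, T.y1) : Plane) ∈ closure ω := hs ⟨right_mem_Icc.2 hx, right_mem_Icc.2 hy⟩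
  have h0 : ((T.x0, T.y0) : Plane) ∈ closure ω := hs ⟨left_mem_Icc.2 hx, left_mem_Icc.2 hy⟩
  have hd := Metric.dist_le_diam_of_mem h.isCompact.isBounded h1 h0
  rw [Prod.dist_eq] at hd
  exact ⟨(le_abs_self _).trans ((le_max_left _ _).trans hd),
    (le_abs_self _).trans ((le_max_right _ _).trans hd)⟩

/-- Boundary values of nodal interpolants are bounded by the Sobolev norm. -/
theorem IsConformingMesh.exists_interp3_bound {ω : Set Plane} {𝒯₀ : Finset Rect}
    (h₀ : IsConformingMesh ω 𝒯₀) (hω : interior (closure ω) = ω) :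
    ∃ K : ℝ, 0 ≤ K ∧ ∀ 𝒯 : Finset Rect, IsConformingMesh ω 𝒯 → ∀ (y yh : Plane → Vec) (M : ℝ),
      (∀ k, MemH ω 3 fun x => y x k) → normH ω 3 (fun (k : Fin 3) x => y x k) ≤ M →
      IsInterp3 ω 𝒯 y yh → ∀ x ∈ frontier ω, ∀ k, |yh x k| ≤ K * M := by
  obtain ⟨K₁, hK₁, hsup⟩ := h₀.exists_sup_bound hω
  obtain ⟨K₂, hK₂, hgrad⟩ := h₀.exists_grad_bound hω
  refine ⟨K₁ + 2 * Metric.diam (closure ω) * K₂,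
    add_nonneg hK₁ (mul_nonneg (mul_nonneg zero_le_two Metric.diam_nonneg) hK₂), ?_⟩
  intro 𝒯 h y yh M hy hM hint x hx k
  obtain ⟨hW, u, hae, hu, hnode⟩ := hint
  have hM0 : 0 ≤ M := (Real.sqrt_nonneg _).trans hM
  obtain ⟨T, hT, hxT⟩ := h.exists_mem (frontier_subset_closure hx)
  have haek : (fun z => u z k) =ᵐ[volume.restrict ω] fun z => y z k :=
    hae.mono fun z hz => congrFun hz k
  have huk : ContDiffOn ℝ 1 (fun z => u z k) (closure ω) := contDiffOn_pi.1 hu k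
  have hd := fun m n (hmn : m + n ≤ 3) => exists_weakDeriv_bound hy hM k hmn
  have hs := hsup _ _ M huk.continuousOn haek hM0 fun m n hmn => hd m n (by omega)
  have hg := fun i => hgrad _ _ M huk haek hM0 hd i T (h.carrier_subset hT)
  have hside := h.side_le_diam hT
  have hm : ∀ a b, |yh (T.vertex a b) k| ≤ K₁ * M := fun a b => by
    rw [(hnode T hT a b).1]
    exact hs _ (h.carrier_subset hT (T.vertex_mem a b))
  have hn : ∀ i a b, |pdOn i T (fun z => yh z k) (T.vertex a b)| ≤ K₂ * M := fun i a b => by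
    have hv := T.vertex_mem a b
    rw [← pdOn_apply hv ((contDiffOn_of_components fun k => (hW k).poly T hT).differentiableOn
      one_ne_zero _ hv), (hnode T hT a b).2 i,
      pdOn_apply hv (((hu.mono (h.carrier_subset hT)).differentiableOn one_ne_zero) _ hv)]
    exact hg i _ hv
  -- A frontier point lies on an edge, where the interpolant is the Hermite cubic of its vertex
  -- data. Edge lengths are bounded by the diameter of the domain, so no mesh size enters.
  have := ((hW k).poly T hT).abs_le_on_edge hside.1 hside.2 hm hn hxT (h.mem_edge hω hx hT hxT)
  linarith

theorem IsConformingMesh.exists_interp2_bound {ω : Set Plane} {𝒯₀ : Finset Rect}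
    (h₀ : IsConformingMesh ω 𝒯₀) (hω : interior (closure ω) = ω) :
    ∃ K : ℝ, 0 ≤ K ∧ ∀ 𝒯 : Finset Rect, IsConformingMesh ω 𝒯 →
      ∀ (Φ Φh : Fin 2 → Plane → Vec) (M : ℝ), (∀ j k, MemH ω 2 fun x => Φ j x k) →
      normH ω 2 (fun (p : Fin 2 × Fin 3) x => Φ p.1 x p.2) ≤ M →
      IsInterp2 ω 𝒯 Φ Φh → ∀ T ∈ 𝒯, ∀ x ∈ T.carrier, ∀ j k, |Φh j x k| ≤ K * M := by
  obtain ⟨K, hK, hsup⟩ := h₀.exists_sup_bound hω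
  refine ⟨9 * K, by positivity, ?_⟩
  intro 𝒯 h Φ Φh M hΦ hM hint T hT x hx j k
  obtain ⟨U, hae, hU, hnode⟩ := hint
  have hM0 : 0 ≤ M := (Real.sqrt_nonneg _).trans hM
  have hs := hsup (fun z => U j z k) (fun z => Φ j z k) M
    ((continuous_apply k).comp_continuousOn (hU j)) ((hae j).mono fun z hz => congrFun hz k) hM0
    fun m n hmn => exists_weakDeriv_bound (u := fun (p : Fin 2 × Fin 3) x => Φ p.1 x p.2)
      (fun p => hΦ p.1 p.2) hM (j, k) hmn
  rw [hnode j T hT x hx, quadInterp_apply, mul_assoc]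
  exact abs_quadInterp_le (fun z hz => hs z (h.carrier_subset hT hz)) hx

/-- The scalar estimate is summed over the components. The boundary conditions of an admissible
deformation supply its two boundary bounds. -/
theorem sum_vertexSum_sq_le {ω ΓD : Set Plane} {𝒯 : Finset Rect} {δ κ M₀ M₁ : ℝ}
    {yDh y : Plane → Vec} {ΦDh : Fin 2 → Plane → Vec}
    (hκ : ∀ w : Plane → ℝ, InW ω 𝒯 w → ∀ M₀ M₁ : ℝ, 0 ≤ M₀ → (∀ x ∈ ΓD, |w x| ≤ M₀) →
      (∀ j, ∀ T ∈ 𝒯, ∀ x ∈ ΓD ∩ T.carrier, |quadInterp T (pdOn j T w) x| ≤ M₁) →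
      vertexSum 𝒯 (fun _ z => w z ^ 2) ≤ κ * (M₀ ^ 2 + M₁ ^ 2 + scalarHess 𝒯 w))
    (hy : Admissible ω ΓD 𝒯 δ yDh ΦDh y) (hM₀ : 0 ≤ M₀) (h₀ : ∀ x ∈ ΓD, ∀ k, |yDh x k| ≤ M₀)
    (h₁ : ∀ T ∈ 𝒯, ∀ x ∈ T.carrier, ∀ j k, |ΦDh j x k| ≤ M₁) :
    ∑ k, vertexSum 𝒯 (fun _ z => y z k ^ 2) ≤
      κ * (3 * M₀ ^ 2 + 3 * M₁ ^ 2 + hessSq 𝒯 y) := by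
  have hQ : ∀ T ∈ 𝒯, ∀ k, IsQ 3 T fun x => y x k := fun T hT k => (hy.mem k).poly T hT
  refine (Finset.sum_le_sum fun k _ => hκ (fun x => y x k) (hy.mem k) M₀ M₁ hM₀
    (fun x hx => ?_) fun j T hT x hx => ?_).trans (le_of_eq ?_)
  · rw [hy.bdry x hx]
    exact h₀ x hx k
  · rw [← discGrad_apply (hQ T hT) j k]
    beta_reduce
    rw [hy.bdry_grad T hT x hx j]
    exact h₁ T hT x hx.2 j k
  · rw [hessSq_eq_sum hQ, Fin.sum_univ_three, Fin.sum_univ_three]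
    ring

end Bilayer

/-! ### Coercivity of the discrete energy -/

theorem proposition4p1
    (ω : Set Plane) (hω : interior (closure ω) = ω) (hconn : IsConnected ω)
    (ΓD : Set Plane) (hΓ : ΓD ⊆ frontier ω) (hΓpos : 0 < Measure.hausdorffMeasure 1 ΓD)
    (σ C MZ Mf My MΦ : ℝ) :
    ∃ Ct : ℝ, ∀ 𝒯 : Finset Rect, IsConformingMesh ω 𝒯 → ShapeRegular σ 𝒯 →
      ∀ δ : ℝ, 0 ≤ δ →
      ∀ yD yDh : Plane → Vec,
        (∀ k, MemH ω 3 (fun x => yD x k)) →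
        normH ω 3 (fun (k : Fin 3) x => yD x k) ≤ My →
        IsInterp3 ω 𝒯 yD yDh →
      ∀ ΦD ΦDh : Fin 2 → Plane → Vec,
        (∀ j k, MemH ω 2 (fun x => ΦD j x k)) →
        normH ω 2 (fun (p : Fin 2 × Fin 3) x => ΦD p.1 x p.2) ≤ MΦ →
        IsInterp2 ω 𝒯 ΦD ΦDh →
      ∀ (Z : Rect → Plane → Matrix (Fin 2) (Fin 2) ℝ) (f : Rect → Plane → Vec),
        (∀ T ∈ 𝒯, ContinuousOn (Z T) T.carrier) →
        (∀ T ∈ 𝒯, ContinuousOn (f T) T.carrier) →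
        brokenLinfty 𝒯 (fun T x => frob (Z T x)) ≤ ENNReal.ofReal MZ →
        brokenLinfty 𝒯 (fun T x => vnorm (f T x)) ≤ ENNReal.ofReal Mf →
      ∀ y : Plane → Vec,
        discEnergy ω ΓD 𝒯 δ yDh ΦDh Z f y ≤ (C : EReal) →
          Admissible ω ΓD 𝒯 δ yDh ΦDh y ∧ Real.sqrt (hessSq 𝒯 y) ≤ Ct := by
  -- The reference partition that supplies the embedding constants is fixed before the actual
  -- partition.
  by_cases hex : ∃ 𝒯₀, IsConformingMesh ω 𝒯₀
  swap
  · exact ⟨0, fun 𝒯 h => (hex ⟨𝒯, h⟩).elim⟩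
  obtain ⟨𝒯₀, h𝒯₀⟩ := hex
  obtain ⟨K₃, hK₃, hy3⟩ := h𝒯₀.exists_interp3_bound hω
  obtain ⟨K₂, hK₂, hΦ2⟩ := h𝒯₀.exists_interp2_bound hω
  obtain ⟨κ, hκ, hV⟩ := exists_vertexSum_sq_le hω hconn hΓ hΓpos σ
  -- The factor 4 inverts 1/2 - 1/8 - 1/8, the share of the bending term that remains after
  -- absorption.
  refine ⟨Real.sqrt (4 * (C + 648 * max MZ 0 ^ 2 * volume.real (closure ω) +
    2 * (κ + 1) * max Mf 0 ^ 2 * volume.real (closure ω) +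
    (3 * (K₃ * My) ^ 2 + 3 * (K₂ * MΦ) ^ 2) / 8)), ?_⟩
  intro 𝒯 h𝒯 hreg δ _ yD yDh hyD hyM hyI ΦD ΦDh hΦD hΦM hΦI Z f hZc hfc hZ hf y hE
  have hadm : Admissible ω ΓD 𝒯 δ yDh ΦDh y := by
    by_contra hn
    rw [discEnergy, if_neg hn] at hE
    exact EReal.coe_ne_top C (top_le_iff.1 hE)
  refine ⟨hadm, Real.sqrt_le_sqrt ?_⟩
  rw [discEnergy, if_pos hadm, EReal.coe_le_coe_iff, energyValue] at hE
  have hQ : ∀ T ∈ 𝒯, ∀ k, IsQ 3 T fun x => y x k := fun T hT k => (hadm.mem k).poly T hT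
  have hMy : 0 ≤ My := (Real.sqrt_nonneg _).trans hyM
  have hcoup := neg_le_coupling (Z := Z) (M := max MZ 0) h𝒯 hQ fun T hT x hx i j =>
    (sq_le_frob_sq (Z T x) i j).trans (by
      have := abs_le.1 (abs_le_of_brokenLinfty_le (g := fun T x => frob (Z T x)) hZ hT
        (continuousOn_frob (hZc T hT)) hx)
      exact sq_le_sq' this.1 this.2)
  -- This weight turns the vertex bound with constant κ into at most one eighth; adding one to κ
  -- avoids division by zero.
  have hε : 0 < 1 / (8 * (κ + 1)) := by positivity
  have hforce := vertexSum_force_le (y := y) h𝒯 hε fun T hT x hx =>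
    abs_le_of_brokenLinfty_le (g := fun T x => vnorm (f T x)) hf hT
      (continuousOn_vnorm (hfc T hT)) hx
  have hsum := sum_vertexSum_sq_le (hV 𝒯 h𝒯 hreg) hadm (mul_nonneg hK₃ hMy)
    (fun x hx => hy3 𝒯 h𝒯 yD yDh My hyD hyM hyI x (hΓ hx))
    (hΦ2 𝒯 h𝒯 ΦD ΦDh MΦ hΦD hΦM hΦI)
  have hZZ : 0 ≤ vertexSum 𝒯 (fun T z => ∑ i, ∑ j, Z T z i j * Z T z i j) :=
    Finset.sum_nonneg fun T _ => mul_nonneg (div_nonneg T.area_pos.le zero_le_four)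
      (Finset.sum_nonneg fun _ _ => Finset.sum_nonneg fun _ _ => Finset.sum_nonneg fun _ _ =>
        Finset.sum_nonneg fun _ _ => mul_self_nonneg _)
  have hH := hessSq_nonneg 𝒯 y
  set D := 3 * (K₃ * My) ^ 2 + 3 * (K₂ * MΦ) ^ 2 with hD
  have hD0 : 0 ≤ D := by positivity
  -- Since κ/(κ + 1) is at most one, the load costs only an eighth of the bending term plus boundary
  -- data.
  have hweight : 1 / (8 * (κ + 1)) * ∑ k, vertexSum 𝒯 (fun _ z => y z k ^ 2) ≤
      (D + hessSq 𝒯 y) / 8 := by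
    rw [div_mul_eq_mul_div, one_mul, div_le_div_iff₀ (by positivity) (by norm_num)]
    nlinarith
  have hscale : max Mf 0 ^ 2 / (4 * (1 / (8 * (κ + 1)))) = 2 * (κ + 1) * max Mf 0 ^ 2 := by
    field_simp
    ring
  rw [hscale] at hforce
  linarith
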